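/- Let $D := x\,\frac{\mathrm d}{\mathrm dx}$ and $\mathcal A := \partial_x (x^3+x^2)\,\partial_x^3$ on $(0,\infty)$, i.e. $\mathcal A u = \big((x^3+x^2)u'''\big)'$. For $\alpha\in\mathbb R$, $k\in\mathbb N_0$ and locally integrable $u:(0,\infty)\to\mathbb R$ put $$|u|_\alpha^2 := \int_0^\infty x^{-2\alpha}\,u(x)^2\,\frac{\mathrm dx}{x},\qquad |u|_{k,\alpha}^2 := \sum_{j=0}^k |D^j u|_\alpha^2,$$ where derivatives are understood in the weak (distributional) sense on $(0,\infty)$. **Proposition.** Let $\lambda>0$ and let $g\in C^\infty([0,\infty))$ be real-valued with $g(0)=0$ and $$\limsup_{x\to\infty}\Big| e^{4\nu\sqrt[4]{\lambda x}}\,\frac{\mathrm d^j g}{\mathrm dx^j}(x)\Big|<\infty\quad\text{for all } j\in\mathbb N_0 \text{ and } \nu\in\big[0,\tfrac1{\sqrt2}\big).\qquad(\ast)$$ Then the resolvent equation $$\lambda u+\mathcal A u=g\quad\text{for } x>0$$ (understood in the sense of distributions on $(0,\infty)$) has, up to equality almost everywhere, exactly one locally integrable solution $u:(0,\infty)\to\mathbb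 R$ with $|u|_{2,\frac12}<\infty$, $|(D-1)u|_1<\infty$, $|(D-1)^2u|_1<\infty$, and $u_{|x=0}=0$ (meaning that the essential limit of $u(x)$ as $x\searrow0$ is $0$). This solution has a representative $u\in C^\infty([0,\infty))$ with $u(0)=0$, which satisfies the equation pointwise for all $x>0$ and fulfills $(\ast)$ with $u$ in place of $g$. -/

import Mathlib

open Set Filter Topology MeasureTheory TopologicalSpace
open scoped ENNReal ContDiff Distributions

/-- The open half-line `(0, ∞)`. -/
def halfLine : Opens ℝ := ⟨Ioi 0, isOpen_Ioi⟩

/-- The operator `𝒜 = ∂ₓ (x³ + x²) ∂ₓ³`, applied classically. -/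
noncomputable def opA (u : ℝ → ℝ) (x : ℝ) : ℝ :=
  deriv (fun y => (y ^ 3 + y ^ 2) * iteratedDeriv 3 u y) x

/-- The formal adjoint `φ ↦ ∂ₓ³ ((x³ + x²) ∂ₓ φ)` of `𝒜` with respect to `dx`: four integrations by
parts give `∫ (𝒜 u) φ dx = ∫ u (opAAdj φ) dx` for `φ` smooth with compact support in `(0, ∞)`. -/
noncomputable def opAAdj (φ : ℝ → ℝ) (x : ℝ) : ℝ :=
  iteratedDeriv 3 (fun y => (y ^ 3 + y ^ 2) * deriv φ y) x

/-- `u` solves `lam u + 𝒜 u = g` on `(0, ∞)` in the sense of distributions. -/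
def SolvesResolvent (lam : ℝ) (g u : ℝ → ℝ) : Prop :=
  ∀ φ : 𝓓(halfLine, ℝ),
    ∫ x in Ioi (0 : ℝ), u x * (lam * φ x + opAAdj φ x) = ∫ x in Ioi (0 : ℝ), g x * φ x

/-- `w = (D - γ) u` weakly on `(0, ∞)`, where `D = x ∂ₓ`: the function `w` is locally integrable on
`(0, ∞)` and represents the distribution `x ∂ₓ u - γ u`, whose value at `φ` is
`- ∫ u ((x φ)' + γ φ) dx`. For `γ = 0` this says `w = D u`. -/
def IsWeakEuler (γ : ℝ) (u w : ℝ → ℝ) : Prop :=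
  LocallyIntegrableOn w (Ioi 0) ∧
    ∀ φ : 𝓓(halfLine, ℝ),
      ∫ x in Ioi (0 : ℝ), w x * φ x =
        - ∫ x in Ioi (0 : ℝ), u x * (deriv (fun y => y * φ y) x + γ * φ x)

/-- `|u|_α² = ∫₀^∞ x^{-2α} u² dx/x`, with values in `[0, ∞]`. -/
noncomputable def wNormSq (α : ℝ) (u : ℝ → ℝ) : ℝ≥0∞ :=
  ∫⁻ x in Ioi (0 : ℝ), ENNReal.ofReal (x ^ (-2 * α) * u x ^ 2 / x)

/-- `|u|_α`, with values in `[0, ∞]`. -/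
noncomputable def wNorm (α : ℝ) (u : ℝ → ℝ) : ℝ≥0∞ := wNormSq α u ^ (1 / 2 : ℝ)

/-- `|u|_{k,α} = (∑_{j ≤ k} |D^j u|_α²)^{1/2}`, with values in `[0, ∞]` and weak derivatives `D^j u`.
Weak derivatives are unique up to null sets, so the infimum runs over a single value if
`D u, …, D^k u` exist as locally integrable functions; otherwise it is empty, with value `∞`. -/
noncomputable def wSobolevNorm (k : ℕ) (α : ℝ) (u : ℝ → ℝ) : ℝ≥0∞ :=
  ⨅ (w : ℕ → ℝ → ℝ) (_ : w 0 = u ∧ ∀ j < k, IsWeakEuler 0 (w j) (w (j + 1))),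
    (∑ j ∈ Finset.range (k + 1), wNormSq α (w j)) ^ (1 / 2 : ℝ)

/-- `u` vanishes at the boundary point `0`: the essential limit of `u` as `x ↘ 0` is `0`. -/
def HasZeroTrace (u : ℝ → ℝ) : Prop := Tendsto u (𝓝[>] 0 ⊓ ae volume) (𝓝 0)

/-- Stretched-exponential decay of all derivatives: for every `j` and every `ν ∈ [0, 1/√2)`,
`limsup_{x → ∞} |exp(4 ν (lam x)^{1/4}) u^{(j)}(x)| < ∞`. -/
def HasStretchedExpDecay (lam : ℝ) (u : ℝ → ℝ) : Prop :=
  ∀ j : ℕ, ∀ ν ∈ Ico (0 : ℝ) (1 / √2),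
    limsup (fun x : ℝ => ENNReal.ofReal
      |Real.exp (ν * 4 * (lam * x) ^ (1 / 4 : ℝ)) * iteratedDeriv j u x|) atTop < ⊤

/-- The solutions of the resolvent equation in the class in which uniqueness is claimed: locally
integrable, with `|u|_{2,1/2}`, `|(D-1)u|_1` and `|(D-1)²u|_1` finite, and `u = 0` at `x = 0`. -/
structure IsResolventSolution (lam : ℝ) (g u : ℝ → ℝ) : Prop where
  locallyIntegrable : LocallyIntegrableOn u (Ioi 0)
  solves : SolvesResolvent lam g u
  norm_lt_top : wSobolevNorm 2 (1 / 2) u < ⊤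
  euler_lt_top : ∃ u₁ u₂ : ℝ → ℝ, IsWeakEuler 1 u u₁ ∧ IsWeakEuler 1 u₁ u₂ ∧
    wNorm 1 u₁ < ⊤ ∧ wNorm 1 u₂ < ⊤
  zero_trace : HasZeroTrace u

/-! Write p = x³ + x² and let q = p u''' be the flux, so that the equation reads q' = g - lam u.

Existence. The derivative w = u' should solve lam w + (p w'')'' = g', which is the Euler equation of
the coercive quadratic form lam ∫ w² + ∫ p (w'')². A Hilbert space projection
(`exists_energy_solution`) produces w in L². Its test functions are unconstrained at 0, so the
natural boundary conditions hold there: p w'' is the double primitive from 0 of g' - lam w. Setting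
u = ∫₀ˣ w and using g(0) = 0, the inner primitive is g - lam u, so the differentiated equation
integrates back to the original one without a constant. Moreover a double primitive from 0 is x²
times an average that is as smooth as the integrand (`primitive_primitive_eq`). This x² cancels the
degeneracy of p at 0, and a bootstrap gives smoothness up to the boundary.

Decay. In the variable s = 4 (lam x)^{1/4} the equation is a small perturbation of y'''' + y = 0,
whose characteristic roots have real parts ±1/√2. An indefinite quadratic form whose derivative
along the unperturbed flow is |y|² shows that a solution without exponential growth decays at every
rate below 1/√2 (`exists_decay_of_perturbed_biharmonic`). Polynomial growth of u is enough to apply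
this. Higher derivatives follow from the equation by the Leibniz rule.

Uniqueness. A distributional solution is classical in the open half-line (`exists_resolventSystem`).
The two weighted bounds on (D-1)u and (D-1)²u give integrability of x (u'')². For the difference of
two solutions this forces the flux to vanish at 0, where the trace condition also holds, and limits
growth at infinity to x², hence yields decay. The function E = -lam u u' - q u'' then tends to 0 at
both ends, while E' = -(lam (u')² + q²/p) ≤ 0. So q = 0, and q' = -lam u gives u = 0. -/

/-! ### Test functions on the half-line. -/

/-- Smooth functions on `ℝ` vanishing outside `(a, b)`. -/
structure TestOn (a b : ℝ) (φ : ℝ → ℝ) : Prop where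
  smooth : ContDiff ℝ ∞ φ
  left : ∀ x ≤ a, φ x = 0
  right : ∀ x, b ≤ x → φ x = 0

/-- Smooth functions with compact support in `(0, ∞)`. -/
def IsTest (φ : ℝ → ℝ) : Prop := ∃ a b : ℝ, 0 < a ∧ a < b ∧ TestOn a b φ

theorem deriv_eq_zero_of_forall_ge {φ : ℝ → ℝ} (hφ : ContDiff ℝ ∞ φ) {b : ℝ}
    (h : ∀ x, b ≤ x → φ x = 0) (x : ℝ) (hx : b ≤ x) : deriv φ x = 0 := by
  have h1 : HasDerivWithinAt φ (deriv φ x) (Ici b) x :=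
    ((hφ.differentiable (by simp)).differentiableAt.hasDerivAt).hasDerivWithinAt
  have h2 : HasDerivWithinAt φ 0 (Ici b) x :=
    (hasDerivWithinAt_const x (Ici b) (0 : ℝ)).congr (fun y hy => h y hy) (h x hx)
  exact (uniqueDiffOn_Ici b x hx).eq_deriv _ h1 h2

theorem deriv_eq_zero_of_forall_le {φ : ℝ → ℝ} (hφ : ContDiff ℝ ∞ φ) {a : ℝ}
    (h : ∀ x ≤ a, φ x = 0) (x : ℝ) (hx : x ≤ a) : deriv φ x = 0 := by
  have h1 : HasDerivWithinAt φ (deriv φ x) (Iic a) x :=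
    ((hφ.differentiable (by simp)).differentiableAt.hasDerivAt).hasDerivWithinAt
  have h2 : HasDerivWithinAt φ 0 (Iic a) x :=
    (hasDerivWithinAt_const x (Iic a) (0 : ℝ)).congr (fun y hy => h y hy) (h x hx)
  exact (uniqueDiffOn_Iic a x hx).eq_deriv _ h1 h2

namespace TestOn

variable {a b : ℝ} {φ ψ : ℝ → ℝ}

theorem continuous (h : TestOn a b φ) : Continuous φ := h.smooth.continuous

theorem hasDerivAt (h : TestOn a b φ) (x : ℝ) : HasDerivAt φ (deriv φ x) x :=
  (h.smooth.differentiable (by simp)).differentiableAt.hasDerivAt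

theorem deriv (h : TestOn a b φ) : TestOn a b (deriv φ) :=
  ⟨(contDiff_infty_iff_deriv.1 h.smooth).2, deriv_eq_zero_of_forall_le h.smooth h.left,
    deriv_eq_zero_of_forall_ge h.smooth h.right⟩

theorem mono (h : TestOn a b φ) {a' b' : ℝ} (ha : a' ≤ a) (hb : b ≤ b') : TestOn a' b' φ :=
  ⟨h.smooth, fun x hx => h.left x (hx.trans ha), fun x hx => h.right x (hb.trans hx)⟩

theorem sub_const_mul (hφ : TestOn a b φ) (hψ : TestOn a b ψ) (c : ℝ) :
    TestOn a b (fun x => φ x - c * ψ x) :=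
  ⟨hφ.smooth.sub (contDiff_const.mul hψ.smooth),
    fun x hx => by simp [hφ.left x hx, hψ.left x hx],
    fun x hx => by simp [hφ.right x hx, hψ.right x hx]⟩

theorem mul_left (ha : 0 < a) (hφ : TestOn a b φ) {f : ℝ → ℝ} (hf : ContDiffOn ℝ ∞ f (Ioi 0)) :
    TestOn a b (fun x => f x * φ x) := by
  refine ⟨contDiff_iff_contDiffAt.2 fun x => ?_, fun x hx => by simp [hφ.left x hx],
    fun x hx => by simp [hφ.right x hx]⟩
  rcases lt_or_ge 0 x with hx | hx
  · exact (hf.contDiffAt (Ioi_mem_nhds hx)).mul hφ.smooth.contDiffAt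
  · refine (contDiffAt_const (c := (0 : ℝ))).congr_of_eventuallyEq ?_
    filter_upwards [Iio_mem_nhds (hx.trans_lt ha)] with y hy
    simp [hφ.left y (le_of_lt hy)]

theorem setIntegral_mul (ha : 0 ≤ a) (hab : a ≤ b) (hφ : TestOn a b φ) (f : ℝ → ℝ) :
    ∫ x in Ioi (0 : ℝ), f x * φ x = ∫ x in a..b, f x * φ x := by
  rw [intervalIntegral.integral_of_le hab]
  refine setIntegral_eq_of_subset_of_forall_sdiff_eq_zero measurableSet_Ioi
    (fun x hx => ha.trans_lt hx.1) fun x hx => ?_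
  rcases le_or_gt x a with h | h
  · simp [hφ.left x h]
  · simp [hφ.right x (not_lt.1 fun h' => hx.2 ⟨h, h'.le⟩)]

end TestOn

namespace IsTest

variable {φ ψ : ℝ → ℝ}

theorem smooth (h : IsTest φ) : ContDiff ℝ ∞ φ := by
  obtain ⟨a, b, -, -, h⟩ := h; exact h.smooth

theorem hasDerivAt (h : IsTest φ) (x : ℝ) : HasDerivAt φ (deriv φ x) x :=
  (h.smooth.differentiable (by simp)).differentiableAt.hasDerivAt

theorem deriv (h : IsTest φ) : IsTest (deriv φ) := by
  obtain ⟨a, b, ha, hab, h⟩ := h; exact ⟨a, b, ha, hab, h.deriv⟩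

theorem mul_left (h : IsTest φ) {f : ℝ → ℝ} (hf : ContDiffOn ℝ ∞ f (Ioi 0)) :
    IsTest (fun x => f x * φ x) := by
  obtain ⟨a, b, ha, hab, h⟩ := h; exact ⟨a, b, ha, hab, h.mul_left ha hf⟩

theorem exists_testOn₂ (hφ : IsTest φ) (hψ : IsTest ψ) :
    ∃ a b : ℝ, 0 < a ∧ a < b ∧ TestOn a b φ ∧ TestOn a b ψ := by
  obtain ⟨a, b, ha, hab, h⟩ := hφ
  obtain ⟨a', b', ha', hab', h'⟩ := hψ
  exact ⟨min a a', max b b', lt_min ha ha', (min_le_left _ _).trans_lt (hab.trans_le (le_max_left _ _)),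
    h.mono (min_le_left _ _) (le_max_left _ _), h'.mono (min_le_right _ _) (le_max_right _ _)⟩

theorem sub_const_mul (hφ : IsTest φ) (hψ : IsTest ψ) (c : ℝ) :
    IsTest (fun x => φ x - c * ψ x) := by
  obtain ⟨a, b, ha, hab, h, h'⟩ := hφ.exists_testOn₂ hψ
  exact ⟨a, b, ha, hab, h.sub_const_mul h' c⟩

theorem hasCompactSupport (h : IsTest φ) : HasCompactSupport φ := by
  obtain ⟨a, b, ha, hab, h⟩ := h
  refine HasCompactSupport.intro (isCompact_Icc (a := a) (b := b)) fun x hx => ?_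
  rcases lt_or_ge x a with h1 | h1
  · exact h.left x h1.le
  · exact h.right x (le_of_not_ge fun h2 => hx ⟨h1, h2⟩)

theorem tsupport_subset (h : IsTest φ) : tsupport φ ⊆ Ioi 0 := by
  obtain ⟨a, b, ha, hab, h⟩ := h
  refine (closure_minimal (t := Ici a) (fun x hx => ?_) isClosed_Ici).trans (Ici_subset_Ioi.2 ha)
  by_contra h1
  exact hx (h.left x (le_of_not_ge h1))

theorem of_support (h : ContDiff ℝ ∞ φ) (hc : HasCompactSupport φ) (hs : tsupport φ ⊆ Ioi 0) :
    IsTest φ := by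
  rcases (tsupport φ).eq_empty_or_nonempty with he | hne
  · refine ⟨1, 2, by norm_num, by norm_num, h, ?_, ?_⟩ <;>
    · intro x _
      exact image_eq_zero_of_notMem_tsupport (by simp [he])
  · obtain ⟨a, ha, hal⟩ := hc.isCompact.exists_isLeast hne
    obtain ⟨b, hb, hbl⟩ := hc.isCompact.exists_isGreatest hne
    have ha0 : 0 < a := hs ha
    have hab : a ≤ b := hal hb
    refine ⟨a / 2, b + 1, by positivity, by linarith, h, ?_, ?_⟩ <;>
    · intro x hx
      refine image_eq_zero_of_notMem_tsupport fun hx' => ?_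
      first
      | have := hal hx'; linarith
      | have := hbl hx'; linarith

theorem of_testFunction (φ : 𝓓(halfLine, ℝ)) : IsTest φ :=
  of_support φ.contDiff φ.hasCompactSupport φ.tsupport_subset

theorem exists_testFunction (h : IsTest φ) : ∃ φ' : 𝓓(halfLine, ℝ), ⇑φ' = φ :=
  ⟨⟨φ, h.smooth, h.hasCompactSupport, h.tsupport_subset⟩, rfl⟩

end IsTest

/-! ### Distributional calculus on the half-line: integration by parts, primitives, du Bois-Reymond.
-/

/-- The duality pairing on the half-line. -/
noncomputable def pair (f φ : ℝ → ℝ) : ℝ := ∫ x in Ioi (0 : ℝ), f x * φ x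

section pair

variable {f f₁ f₂ φ ψ : ℝ → ℝ}

theorem MeasureTheory.LocallyIntegrableOn.intervalIntegrable_of_pos (hf : LocallyIntegrableOn f (Ioi 0)) {a b : ℝ}
    (ha : 0 < a) (hb : 0 < b) : IntervalIntegrable f volume a b := by
  rw [intervalIntegrable_iff']
  exact hf.integrableOn_compact_subset (fun x hx => (lt_min ha hb).trans_le hx.1) isCompact_uIcc

theorem IsTest.integrableOn_mul (hφ : IsTest φ) (hf : LocallyIntegrableOn f (Ioi 0)) :
    IntegrableOn (fun x => f x * φ x) (Ioi 0) := by
  obtain ⟨a, b, ha, hab, h⟩ := hφ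
  have h1 : IntegrableOn (fun x => f x * φ x) (Ioc a b) :=
    (intervalIntegrable_iff_integrableOn_Ioc_of_le hab.le).1
      ((hf.intervalIntegrable_of_pos ha (ha.trans hab)).mul_continuousOn h.continuous.continuousOn)
  refine h1.of_forall_sdiff_eq_zero measurableSet_Ioi fun x hx => ?_
  rcases le_or_gt x a with h' | h'
  · simp [h.left x h']
  · simp [h.right x (not_lt.1 fun h'' => hx.2 ⟨h', h''.le⟩)]

theorem pair_sub_const_mul (hf : LocallyIntegrableOn f (Ioi 0)) (hφ : IsTest φ) (hψ : IsTest ψ)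
    (c : ℝ) : pair f (fun x => φ x - c * ψ x) = pair f φ - c * pair f ψ := by
  unfold pair
  rw [← integral_const_mul, ← integral_sub (hφ.integrableOn_mul hf)
    ((hψ.integrableOn_mul hf).const_mul c)]
  congr 1 with x; ring

theorem pair_sub_left (hf₁ : LocallyIntegrableOn f₁ (Ioi 0)) (hf₂ : LocallyIntegrableOn f₂ (Ioi 0))
    (hφ : IsTest φ) : pair (fun x => f₁ x - f₂ x) φ = pair f₁ φ - pair f₂ φ := by
  unfold pair
  rw [← integral_sub (hφ.integrableOn_mul hf₁) (hφ.integrableOn_mul hf₂)]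
  congr 1 with x; ring

theorem pair_const_mul_left (c : ℝ) : pair (fun x => c * f x) φ = c * pair f φ := by
  unfold pair
  rw [← integral_const_mul]
  congr 1 with x; ring

theorem pair_congr (h : ∀ x, 0 < x → f₁ x * φ x = f₂ x * ψ x) : pair f₁ φ = pair f₂ ψ :=
  setIntegral_congr_fun measurableSet_Ioi fun x hx => h x hx

theorem pair_congr_ae (h : f₁ =ᵐ[volume.restrict (Ioi 0)] f₂) : pair f₁ φ = pair f₂ φ := by
  refine integral_congr_ae ?_
  filter_upwards [h] with x hx
  rw [hx]

theorem locallyIntegrableOn_of_continuousOn (hf : ContinuousOn f (Ioi 0)) :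
    LocallyIntegrableOn f (Ioi 0) :=
  hf.locallyIntegrableOn measurableSet_Ioi

/-- Integration by parts against a test function. -/
theorem pair_deriv (hf : ∀ x, 0 < x → HasDerivAt f (f₁ x) x) (hc : ContinuousOn f₁ (Ioi 0))
    (hφ : IsTest φ) : pair f (deriv φ) = - pair f₁ φ := by
  obtain ⟨a, b, ha, hab, h⟩ := hφ
  have hsub : uIcc a b ⊆ Ioi 0 := fun x hx => ha.trans_le (by simpa [hab.le] using hx.1)
  unfold pair
  rw [h.deriv.setIntegral_mul ha.le hab.le, h.setIntegral_mul ha.le hab.le,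
    intervalIntegral.integral_mul_deriv_eq_deriv_mul (u' := f₁) (fun x hx => hf x (hsub hx))
      (fun x _ => h.hasDerivAt x) (hc.mono hsub).intervalIntegrable
      h.deriv.continuous.continuousOn.intervalIntegrable]
  simp [h.left a le_rfl, h.right b le_rfl]

/-- Integration by parts with a primitive of an integrable function. -/
theorem integral_primitive_mul_deriv {a b c : ℝ} (hc : c ∈ uIcc a b)
    (hf : IntervalIntegrable f volume a b) (hφ : ContDiff ℝ ∞ φ) :
    ∫ x in a..b, (∫ t in c..x, f t) * deriv φ x =
      (∫ t in c..b, f t) * φ b - (∫ t in c..a, f t) * φ a - ∫ x in a..b, f x * φ x := by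
  have h1 := hf.absolutelyContinuousOnInterval_intervalIntegral hc
  have h2 : AbsolutelyContinuousOnInterval φ a b :=
    (hφ.contDiffOn.of_le (by simp)).absolutelyContinuousOnInterval
  rw [h1.integral_mul_deriv_eq_deriv_mul h2]
  congr 1
  refine intervalIntegral.integral_congr_ae ?_
  filter_upwards [hf.ae_hasDerivAt_integral] with x hx hx'
  rw [(hx (uIoc_subset_uIcc hx') c hc).deriv]

theorem pair_primitive_deriv (hf : LocallyIntegrableOn f (Ioi 0)) {c : ℝ} (hc : 0 < c)
    (hφ : IsTest φ) : pair (fun x => ∫ t in c..x, f t) (deriv φ) = - pair f φ := by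
  obtain ⟨a, b, ha, hab, h⟩ := hφ
  replace h := h.mono (min_le_left a c) (le_max_left b c)
  have ha' : 0 < min a c := lt_min ha hc
  have hab' : min a c ≤ max b c := (min_le_right _ _).trans (le_max_right _ _)
  unfold pair
  rw [h.deriv.setIntegral_mul ha'.le hab', h.setIntegral_mul ha'.le hab',
    integral_primitive_mul_deriv (by simp)
      (hf.intervalIntegrable_of_pos ha' (ha'.trans_le hab')) h.smooth]
  simp [h.left _ le_rfl, h.right _ le_rfl]

/-- The fundamental lemma of the calculus of variations on the half-line. -/
theorem ae_eq_zero_of_pair_eq_zero (hf : LocallyIntegrableOn f (Ioi 0))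
    (h : ∀ φ, IsTest φ → pair f φ = 0) : f =ᵐ[volume.restrict (Ioi 0)] 0 := by
  refine (ae_restrict_iff' measurableSet_Ioi).2 ?_
  refine isOpen_Ioi.ae_eq_zero_of_integral_contDiff_smul_eq_zero hf fun φ h1 h2 h3 => ?_
  have h4 := IsTest.of_support h1 h2 h3
  rw [← h φ h4, pair, ← setIntegral_eq_integral_of_forall_compl_eq_zero (s := Ioi 0)]
  · congr 1 with x; simp [mul_comm]
  · intro x hx
    obtain ⟨a, b, ha, hab, h⟩ := h4
    simp [h.left x ((not_lt.1 hx).trans ha.le)]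

theorem ae_eq_of_pair_eq (hf₁ : LocallyIntegrableOn f₁ (Ioi 0))
    (hf₂ : LocallyIntegrableOn f₂ (Ioi 0))
    (h : ∀ φ, IsTest φ → pair f₁ φ = pair f₂ φ) : f₁ =ᵐ[volume.restrict (Ioi 0)] f₂ := by
  have := ae_eq_zero_of_pair_eq_zero (hf₁.sub hf₂) fun φ hφ => by
    have := pair_sub_left hf₁ hf₂ hφ
    rw [h φ hφ, sub_self] at this
    exact this
  filter_upwards [this] with x hx
  simpa [sub_eq_zero] using hx

theorem IsTest.exists_primitive (hψ : IsTest ψ) (h0 : pair 1 ψ = 0) :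
    ∃ φ, IsTest φ ∧ _root_.deriv φ = ψ := by
  obtain ⟨a, b, ha, hab, h⟩ := hψ
  have hd : ∀ x, HasDerivAt (fun x => ∫ t in a..x, ψ t) (ψ x) x := fun x =>
    intervalIntegral.integral_hasDerivAt_right (h.continuous.intervalIntegrable _ _)
      (h.continuous.stronglyMeasurableAtFilter _ _) h.continuous.continuousAt
  have hd' : _root_.deriv (fun x => ∫ t in a..x, ψ t) = ψ := funext fun x => (hd x).deriv
  have hab0 : ∫ t in a..b, ψ t = 0 := by
    have := h.setIntegral_mul ha.le hab.le 1
    rw [pair] at h0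
    rw [h0] at this
    simpa using this.symm
  refine ⟨fun x => ∫ t in a..x, ψ t, ⟨a, b, ha, hab, ?_, fun x hx => ?_, fun x hx => ?_⟩, hd'⟩
  · exact contDiff_infty_iff_deriv.2 ⟨fun x => (hd x).differentiableAt, by rw [hd']; exact h.smooth⟩
  · refine (intervalIntegral.integral_congr (g := fun _ => (0 : ℝ)) fun t ht => ?_).trans (by simp)
    rw [uIcc_of_ge hx] at ht
    exact h.left t ht.2
  · rw [← intervalIntegral.integral_add_adjacent_intervals (h.continuous.intervalIntegrable a b)
      (h.continuous.intervalIntegrable b x), hab0, zero_add]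
    refine (intervalIntegral.integral_congr (g := fun _ => (0 : ℝ)) fun t ht => ?_).trans (by simp)
    rw [uIcc_of_le hx] at ht
    exact h.right t ht.1

/-- A functional on test functions vanishing on the kernel of another one is a multiple of it. -/
theorem exists_eq_const_mul_of_ker_le (Λ M : (ℝ → ℝ) → ℝ)
    (hΛ : ∀ φ ψ c, IsTest φ → IsTest ψ → Λ (fun x => φ x - c * ψ x) = Λ φ - c * Λ ψ)
    (hM : ∀ φ ψ c, IsTest φ → IsTest ψ → M (fun x => φ x - c * ψ x) = M φ - c * M ψ)
    (h : ∀ φ, IsTest φ → M φ = 0 → Λ φ = 0) : ∃ c : ℝ, ∀ φ, IsTest φ → Λ φ = c * M φ := by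
  by_cases hex : ∃ ψ, IsTest ψ ∧ M ψ ≠ 0
  · obtain ⟨ψ, hψ, hne⟩ := hex
    refine ⟨Λ ψ / M ψ, fun φ hφ => ?_⟩
    have h1 := h _ (hφ.sub_const_mul hψ (M φ / M ψ)) (by rw [hM _ _ _ hφ hψ]; field_simp; ring)
    rw [hΛ _ _ _ hφ hψ] at h1
    field_simp at h1 ⊢
    linarith
  · push Not at hex
    exact ⟨0, fun φ hφ => by rw [h φ hφ (hex φ hφ), zero_mul]⟩

theorem IsTest.iterate_deriv (hφ : IsTest φ) (n : ℕ) : IsTest (_root_.deriv^[n] φ) := by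
  induction n with
  | zero => exact hφ
  | succ n ih => rw [Function.iterate_succ_apply']; exact ih.deriv

theorem iterate_deriv_sub_const_mul (hφ : IsTest φ) (hψ : IsTest ψ) (c : ℝ) (n : ℕ) :
    deriv^[n] (fun x => φ x - c * ψ x) = fun x => deriv^[n] φ x - c * deriv^[n] ψ x := by
  induction n with
  | zero => rfl
  | succ n ih =>
    simp only [Function.iterate_succ_apply', ih]
    ext x
    exact (((hφ.iterate_deriv n).hasDerivAt x).sub
      (((hψ.iterate_deriv n).hasDerivAt x).const_mul c)).deriv

theorem pair_pow_iterate_deriv (hφ : IsTest φ) (n : ℕ) :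
    pair (fun x => x ^ n) (deriv^[n] φ) = (-1) ^ n * n.factorial * pair 1 φ := by
  induction n with
  | zero => simp [pair]
  | succ n ih =>
    rw [Function.iterate_succ_apply', pair_deriv (f₁ := fun x => ((n + 1 : ℕ) : ℝ) * x ^ n)
      (fun x _ => by simpa using hasDerivAt_pow (n + 1) x) (by fun_prop) (hφ.iterate_deriv n),
      pair_const_mul_left, ih, Nat.factorial_succ]
    push_cast
    ring

/-- Du Bois-Reymond: a distribution on the half-line with vanishing `n`-th derivative is a
polynomial of degree less than `n`. -/
theorem exists_polynomial_ae_eq (n : ℕ) : ∀ {f : ℝ → ℝ}, LocallyIntegrableOn f (Ioi 0) →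
    (∀ φ, IsTest φ → pair f (deriv^[n] φ) = 0) →
    ∃ P : Polynomial ℝ, P.degree < n ∧ f =ᵐ[volume.restrict (Ioi 0)] fun x => P.eval x := by
  induction n with
  | zero =>
    intro f hf h
    exact ⟨0, by simp, (ae_eq_zero_of_pair_eq_zero hf h).trans (.of_eq (by ext x; simp))⟩
  | succ n ih =>
    intro f hf h
    -- A test function with zero integral is the derivative of a test function, so the functional on
    -- the left vanishes on the kernel of the integral and is a multiple of it.
    obtain ⟨c, hc⟩ := exists_eq_const_mul_of_ker_le (fun φ => pair f (deriv^[n] φ)) (pair 1)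
      (fun φ ψ c hφ hψ => by
        rw [iterate_deriv_sub_const_mul hφ hψ, pair_sub_const_mul hf (hφ.iterate_deriv n)
          (hψ.iterate_deriv n)])
      (fun φ ψ c hφ hψ => pair_sub_const_mul
        (locallyIntegrableOn_of_continuousOn continuousOn_const) hφ hψ c)
      (fun ψ hψ h0 => by
        obtain ⟨φ, hφ, rfl⟩ := hψ.exists_primitive h0
        simpa using h φ hφ)
    -- The monomial x ^ n paired with an n-th derivative gives (-1)ⁿ n! times the integral; dividing
    -- by this factor makes d x ^ n reproduce c times the integral.
    set d : ℝ := c / ((-1) ^ n * n.factorial) with hd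
    have hpow : LocallyIntegrableOn (fun x : ℝ => d * x ^ n) (Ioi 0) :=
      locallyIntegrableOn_of_continuousOn (by fun_prop)
    obtain ⟨P, hP, hfP⟩ := ih (hf.sub hpow) fun φ hφ => by
      have h1 := pair_sub_left hf hpow (hφ.iterate_deriv n)
      rw [pair_const_mul_left, pair_pow_iterate_deriv hφ, hc φ hφ] at h1
      refine h1.trans ?_
      have : ((-1 : ℝ) ^ n * n.factorial) ≠ 0 := by positivity
      rw [hd]; field_simp; ring
    refine ⟨P + Polynomial.C d * Polynomial.X ^ n, ?_, ?_⟩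
    · refine (Polynomial.degree_add_le _ _).trans_lt (max_lt (hP.trans ?_) ?_)
      · exact_mod_cast Nat.lt_succ_self n
      · exact (Polynomial.degree_C_mul_X_pow_le n d).trans_lt (by exact_mod_cast Nat.lt_succ_self n)
    · filter_upwards [hfP] with x hx
      simp only [Pi.sub_apply] at hx
      simp [← hx]

end pair

/-! ### Exponential decay for perturbations of y'''' + y = 0. -/

theorem antitoneOn_Ici_of_hasDerivAt_nonpos {f f' : ℝ → ℝ} {S : ℝ}
    (h : ∀ s, S ≤ s → HasDerivAt f (f' s) s) (h' : ∀ s, S ≤ s → f' s ≤ 0) :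
    AntitoneOn f (Ici S) := by
  refine antitoneOn_of_deriv_nonpos (convex_Ici S)
    (fun s hs => (h s hs).continuousAt.continuousWithinAt)
    (fun s hs => (h s (interior_subset hs)).differentiableAt.differentiableWithinAt) fun s hs => ?_
  rw [(h s (interior_subset hs)).deriv]
  exact h' s (interior_subset hs)

/-- With T the sum of the absolute values, Young's inequality bounds 2(ηT + h)T by 3ηT² + h²/η, and
Cauchy-Schwarz gives T² ≤ 4|y|²; hence the constant 12. -/
theorem abs_mul_sum_le {y₀ y₁ y₂ y₃ η h m : ℝ} (hη : 0 < η)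
    (hm : m ≤ η * (|y₀| + |y₁| + |y₂| + |y₃|) + h) :
    2 * m * (|y₀| + |y₁| + |y₂| + |y₃|) ≤
      12 * η * (y₀ ^ 2 + y₁ ^ 2 + y₂ ^ 2 + y₃ ^ 2) + h ^ 2 / η := by
  set T := |y₀| + |y₁| + |y₂| + |y₃| with hT
  have hT0 : 0 ≤ T := by positivity
  have h1 : T ^ 2 ≤ 4 * (y₀ ^ 2 + y₁ ^ 2 + y₂ ^ 2 + y₃ ^ 2) := by
    rw [← sq_abs y₀, ← sq_abs y₁, ← sq_abs y₂, ← sq_abs y₃, hT]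
    linarith [sq_nonneg (|y₀| - |y₁|), sq_nonneg (|y₀| - |y₂|), sq_nonneg (|y₀| - |y₃|),
      sq_nonneg (|y₁| - |y₂|), sq_nonneg (|y₁| - |y₃|), sq_nonneg (|y₂| - |y₃|)]
  have h2 : 2 * h * T ≤ η * T ^ 2 + h ^ 2 / η := by
    have : η * T ^ 2 + h ^ 2 / η - 2 * h * T = (η * T - h) ^ 2 / η := by field_simp; ring
    have h3 : 0 ≤ (η * T - h) ^ 2 / η := by positivity
    linarith
  have h3 : 2 * m * T ≤ 2 * (η * T + h) * T := by gcongr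
  linarith [mul_le_mul_of_nonneg_left h1 hη.le]

theorem abs_quadratic_error_le {y₀ y₁ y₂ y₃ e₁ e₂ e₃ η h : ℝ} (hη : 0 < η)
    (h₁ : |e₁| ≤ η * (|y₀| + |y₁| + |y₂| + |y₃|) + h)
    (h₂ : |e₂| ≤ η * (|y₀| + |y₁| + |y₂| + |y₃|) + h)
    (h₃ : |e₃| ≤ η * (|y₀| + |y₁| + |y₂| + |y₃|) + h) :
    |e₃ * (y₂ - y₀) + y₃ * e₂ + (e₁ * (y₂ + y₀) + y₁ * e₂)| ≤
      12 * η * (y₀ ^ 2 + y₁ ^ 2 + y₂ ^ 2 + y₃ ^ 2) + h ^ 2 / η := by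
  refine le_trans ?_ (abs_mul_sum_le hη le_rfl)
  set m := η * (|y₀| + |y₁| + |y₂| + |y₃|) + h
  have hm : 0 ≤ m := (abs_nonneg _).trans h₁
  calc |e₃ * (y₂ - y₀) + y₃ * e₂ + (e₁ * (y₂ + y₀) + y₁ * e₂)|
      ≤ |e₃| * (|y₂| + |y₀|) + |y₃| * |e₂| + (|e₁| * (|y₂| + |y₀|) + |y₁| * |e₂|) := by
        refine (abs_add_le _ _).trans (add_le_add ((abs_add_le _ _).trans ?_)
          ((abs_add_le _ _).trans ?_))
        · rw [abs_mul, abs_mul]; gcongr; exact abs_sub _ _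
        · rw [abs_mul, abs_mul]; gcongr; exact abs_add_le _ _
    _ ≤ m * (|y₂| + |y₀|) + |y₃| * m + (m * (|y₂| + |y₀|) + |y₁| * m) := by gcongr
    _ ≤ 2 * m * (|y₀| + |y₁| + |y₂| + |y₃|) := by
        have := mul_nonneg hm (abs_nonneg y₁)
        have := mul_nonneg hm (abs_nonneg y₃)
        linarith

/-- After multiplication by √2 the difference of the two sides is a sum of two squares. The constant
√2 is what makes 1/√2 the critical rate: the form grows at logarithmic rate at least √2 where it is
positive. -/
theorem abs_indefinite_form_le (y₀ y₁ y₂ y₃ : ℝ) :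
    2 * |y₃ * (y₂ - y₀) + y₁ * (y₂ + y₀)| ≤ √2 * (y₀ ^ 2 + y₁ ^ 2 + y₂ ^ 2 + y₃ ^ 2) := by
  have h2 : √2 ^ 2 = 2 := Real.sq_sqrt (by norm_num)
  have h0 : 0 ≤ √2 := Real.sqrt_nonneg 2
  have : 2 * (y₃ * (y₂ - y₀) + y₁ * (y₂ + y₀)) ≤ √2 * (y₀ ^ 2 + y₁ ^ 2 + y₂ ^ 2 + y₃ ^ 2) := by
    have h3 : √2 * (√2 * (y₀ ^ 2 + y₁ ^ 2 + y₂ ^ 2 + y₃ ^ 2) - 2 * (y₃ * (y₂ - y₀) + y₁ * (y₂ + y₀)))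
      = (√2 * y₃ - (y₂ - y₀)) ^ 2 + (√2 * y₁ - (y₂ + y₀)) ^ 2 := by
        linear_combination (y₀ ^ 2 + y₂ ^ 2) * h2
    have h4 := h3.symm ▸ (add_nonneg (sq_nonneg _) (sq_nonneg _))
    have h5 := (mul_nonneg_iff_of_pos_left (by positivity : (0 : ℝ) < √2)).1 h4
    linarith
  have : -(√2 * (y₀ ^ 2 + y₁ ^ 2 + y₂ ^ 2 + y₃ ^ 2)) ≤ 2 * (y₃ * (y₂ - y₀) + y₁ * (y₂ + y₀)) := by
    have h3 : √2 * (√2 * (y₀ ^ 2 + y₁ ^ 2 + y₂ ^ 2 + y₃ ^ 2) + 2 * (y₃ * (y₂ - y₀) + y₁ * (y₂ + y₀)))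
      = (√2 * y₃ + (y₂ - y₀)) ^ 2 + (√2 * y₁ + (y₂ + y₀)) ^ 2 := by
        linear_combination (y₀ ^ 2 + y₂ ^ 2) * h2
    have h4 := h3.symm ▸ (add_nonneg (sq_nonneg _) (sq_nonneg _))
    have h5 := (mul_nonneg_iff_of_pos_left (by positivity : (0 : ℝ) < √2)).1 h4
    linarith
  rw [show (2 : ℝ) * |y₃ * (y₂ - y₀) + y₁ * (y₂ + y₀)| = |2 * (y₃ * (y₂ - y₀) + y₁ * (y₂ + y₀))| by
    rw [abs_mul, abs_two]]
  exact abs_le.2 ⟨by linarith, by linarith⟩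

/-- Subexponentially growing solutions of a small perturbation of `y'''' + y = 0` decay with any
rate below `1 / √2`, provided the inhomogeneity does. -/
theorem exists_decay_of_perturbed_biharmonic {ν ν' η S B : ℝ} {y₀ y₁ y₂ y₃ e₁ e₂ e₃ : ℝ → ℝ}
    (hν : 0 ≤ ν) (hνν' : ν < ν') (hν' : √2 * ν' < 1) (hη : 0 < η)
    (hη' : 24 * η ≤ 1 - √2 * ν') (hS : 0 ≤ S)
    (h₀ : ∀ s, S ≤ s → HasDerivAt y₀ (y₁ s) s)
    (h₁ : ∀ s, S ≤ s → HasDerivAt y₁ (y₂ s + e₁ s) s)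
    (h₂ : ∀ s, S ≤ s → HasDerivAt y₂ (y₃ s + e₂ s) s)
    (h₃ : ∀ s, S ≤ s → HasDerivAt y₃ (-y₀ s + e₃ s) s)
    (he₁ : ∀ s, S ≤ s → |e₁ s| ≤ η * (|y₀ s| + |y₁ s| + |y₂ s| + |y₃ s|) + B * Real.exp (-ν' * s))
    (he₂ : ∀ s, S ≤ s → |e₂ s| ≤ η * (|y₀ s| + |y₁ s| + |y₂ s| + |y₃ s|) + B * Real.exp (-ν' * s))
    (he₃ : ∀ s, S ≤ s → |e₃ s| ≤ η * (|y₀ s| + |y₁ s| + |y₂ s| + |y₃ s|) + B * Real.exp (-ν' * s))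
    (hgrowth : Tendsto (fun s => Real.exp (-(2 * (ν' - ν)) * s) *
      (y₀ s ^ 2 + y₁ s ^ 2 + y₂ s ^ 2 + y₃ s ^ 2)) atTop (𝓝 0)) :
    ∃ C, ∀ s, S ≤ s →
      Real.exp (2 * ν * s) * (y₀ s ^ 2 + y₁ s ^ 2 + y₂ s ^ 2 + y₃ s ^ 2) ≤ C := by
  set n : ℝ → ℝ := fun s => y₀ s ^ 2 + y₁ s ^ 2 + y₂ s ^ 2 + y₃ s ^ 2 with hn
  -- For the unperturbed flow the derivative of this form is exactly |y|², the function n. It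
  -- separates modes: positive values signal growth, and on decaying solutions it is nonpositive.
  -- The function E collects the contribution of the perturbation.
  set q : ℝ → ℝ := fun s => y₃ s * (y₂ s - y₀ s) + y₁ s * (y₂ s + y₀ s) with hq
  set E : ℝ → ℝ := fun s => e₃ s * (y₂ s - y₀ s) + y₃ s * e₂ s + (e₁ s * (y₂ s + y₀ s) + y₁ s * e₂ s)
    with hE
  have hn0 : ∀ s, 0 ≤ n s := fun s => by positivity
  have hs2 : 0 < √2 := by positivity
  have hs2' : 1 < √2 := Real.lt_sqrt_of_sq_lt (by norm_num)
  have hν'0 : 0 < ν' := hν.trans_lt hνν'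
  have hν1 : ν' < 1 := by nlinarith
  have hh : ∀ s, (B * Real.exp (-ν' * s)) ^ 2 / η = B ^ 2 / η * Real.exp (-(2 * ν') * s) := fun s => by
    rw [mul_pow, ← Real.exp_nat_mul]; push_cast; ring_nf
  have hEs : ∀ s, S ≤ s → |E s| ≤ 12 * η * n s + B ^ 2 / η * Real.exp (-(2 * ν') * s) := fun s hs => by
    rw [← hh]; exact abs_quadratic_error_le hη (he₁ s hs) (he₂ s hs) (he₃ s hs)
  have hqn : ∀ s, 2 * |q s| ≤ √2 * n s := fun s => abs_indefinite_form_le _ _ _ _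
  have hqd : ∀ s, S ≤ s → HasDerivAt q (n s + E s) s := fun s hs => by
    convert! ((h₃ s hs).mul ((h₂ s hs).sub (h₀ s hs))).add
      ((h₁ s hs).mul ((h₂ s hs).add (h₀ s hs))) using 1
    simp only [hn, hE, Pi.sub_apply, Pi.add_apply]; ring
  have hexp : ∀ c s : ℝ, HasDerivAt (fun s => Real.exp (c * s)) (c * Real.exp (c * s)) s := fun c s => by
    simpa [mul_comm] using ((hasDerivAt_id s).const_mul c).exp
  have hB : 0 ≤ B ^ 2 / η := by positivity
  -- upper bound for the indefinite form
  set τ := ν' - ν with hτ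
  have hτ0 : 0 < τ := by linarith
  -- This value makes the derivative of -A exp(-2ν's) cancel the inhomogeneous part of the bound for
  -- E. The corrected form, damped by exp(-2τs), is then nondecreasing; as the growth hypothesis
  -- sends it to 0, it is nonpositive.
  set A := B ^ 2 / η / (2 * ν') with hA
  have hA0 : 0 ≤ A := by positivity
  have hJ : AntitoneOn (fun s => -(Real.exp (-(2 * τ) * s) * q s - A * Real.exp (-(2 * ν') * s)))
      (Ici S) := by
    refine antitoneOn_Ici_of_hasDerivAt_nonpos (fun s hs =>
      ((((hexp (-(2 * τ)) s).mul (hqd s hs)).sub ((hexp (-(2 * ν')) s).const_mul A)).neg)) ?_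
    intro s hs
    have h1 : A * (-(2 * ν') * Real.exp (-(2 * ν') * s)) =
        -(B ^ 2 / η * Real.exp (-(2 * ν') * s)) := by rw [hA]; field_simp
    have h2 : Real.exp (-(2 * τ) * s) ≤ 1 := Real.exp_le_one_iff.2 (by nlinarith)
    have h3 : 0 < Real.exp (-(2 * τ) * s) := Real.exp_pos _
    have h4 : 0 ≤ B ^ 2 / η * Real.exp (-(2 * ν') * s) := by positivity
    have h5 := hEs s hs
    have h6 := neg_abs_le (E s)
    have h7 : 2 * τ * q s ≤ √2 * ν' * n s := by
      have : 2 * τ * q s ≤ 2 * ν' * |q s| :=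
        (mul_le_mul_of_nonneg_left (le_abs_self _) (by positivity)).trans
          (mul_le_mul_of_nonneg_right (by linarith) (abs_nonneg _))
      have := mul_le_mul_of_nonneg_left (hqn s) hν'0.le
      linarith
    have h8 : 0 ≤ n s + E s - 2 * τ * q s + B ^ 2 / η * Real.exp (-(2 * ν') * s) := by
      have h10 := mul_nonneg (sub_nonneg.2 hη') (hn0 s)
      have h11 := mul_nonneg hη.le (hn0 s)
      linarith
    rw [h1]
    have h9 := mul_nonneg h3.le h8
    have h10 := mul_le_mul_of_nonneg_right h2 h4
    linarith
  have hJlim : Tendsto (fun s => -(Real.exp (-(2 * τ) * s) * q s - A * Real.exp (-(2 * ν') * s)))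
      atTop (𝓝 0) := by
    have h1 : Tendsto (fun s => Real.exp (-(2 * τ) * s) * q s) atTop (𝓝 0) := by
      refine squeeze_zero_norm (fun s => ?_) (by simpa using hgrowth.const_mul (√2 / 2))
      rw [norm_mul, Real.norm_eq_abs, Real.norm_eq_abs, abs_of_pos (Real.exp_pos _)]
      have := mul_le_mul_of_nonneg_left (hqn s) (Real.exp_pos (-(2 * τ) * s)).le
      simp only [hn, neg_mul] at this ⊢
      linarith
    have h2 : Tendsto (fun s => A * Real.exp (-(2 * ν') * s)) atTop (𝓝 0) := by
      have : Tendsto (fun s : ℝ => -(2 * ν') * s) atTop atBot :=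
        tendsto_id.const_mul_atTop_of_neg (by linarith)
      simpa using (Real.tendsto_exp_atBot.comp this).const_mul A
    simpa using (h1.sub h2).neg
  have hqA : ∀ s, S ≤ s → Real.exp (2 * ν * s) * q s ≤ A := by
    intro s hs
    have h1 : 0 ≤ -(Real.exp (-(2 * τ) * s) * q s - A * Real.exp (-(2 * ν') * s)) :=
      le_of_tendsto hJlim ((eventually_ge_atTop s).mono fun t ht => hJ hs (hs.trans ht) ht)
    have h2 : Real.exp (2 * ν * s) = Real.exp (-(2 * τ) * s) * Real.exp (2 * ν' * s) := by
      rw [← Real.exp_add]; congr 1; rw [hτ]; ring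
    have h3 : Real.exp (-(2 * ν') * s) * Real.exp (2 * ν' * s) = 1 := by
      rw [← Real.exp_add]; simp
    rw [h2]
    have h4 := mul_nonneg h1 (Real.exp_pos (2 * ν' * s)).le
    have h5 : A * Real.exp (-(2 * ν') * s) * Real.exp (2 * ν' * s) = A := by rw [mul_assoc, h3, mul_one]
    linarith
  -- the weighted norm is controlled by the weighted form
  set c := (1 - √2 * ν') / 2 with hc
  have hc0 : 0 < c := by rw [hc]; linarith
  -- The derivative of n is at most 3n plus the inhomogeneity, and the weight adds 2νn ≤ 2n. The
  -- choice L c = 5 lets the growth of L q absorb both, and K absorbs what remains of the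
  -- inhomogeneity.
  set L := 5 / c with hL
  have hL0 : 0 < L := by positivity
  set K := (1 + L) * (B ^ 2 / η) / (2 * τ) with hK
  have hK0 : 0 ≤ K := by positivity
  have hΦ : AntitoneOn (fun s => Real.exp (2 * ν * s) * n s - L * (Real.exp (2 * ν * s) * q s)
      + K * Real.exp (-(2 * τ) * s)) (Ici S) := by
    have hnd : ∀ s, S ≤ s → HasDerivAt n (2 * (y₀ s * y₁ s + y₁ s * (y₂ s + e₁ s)
        + y₂ s * (y₃ s + e₂ s) + y₃ s * (-y₀ s + e₃ s))) s := fun s hs => by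
      convert! ((((h₀ s hs).pow 2).add ((h₁ s hs).pow 2)).add ((h₂ s hs).pow 2)).add
        ((h₃ s hs).pow 2) using 1
      simp; ring
    refine antitoneOn_Ici_of_hasDerivAt_nonpos (fun s hs =>
      ((((hexp (2 * ν) s).mul (hnd s hs)).sub (((hexp (2 * ν) s).mul (hqd s hs)).const_mul L)).add
        ((hexp (-(2 * τ)) s).const_mul K))) ?_
    intro s hs
    have h1 : K * (-(2 * τ) * Real.exp (-(2 * τ) * s)) =
        -((1 + L) * (Real.exp (2 * ν * s) * (B ^ 2 / η * Real.exp (-(2 * ν') * s)))) := by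
      have : Real.exp (-(2 * τ) * s) = Real.exp (2 * ν * s) * Real.exp (-(2 * ν') * s) := by
        rw [← Real.exp_add]; congr 1; rw [hτ]; ring
      rw [hK, this]; field_simp
    set h := B ^ 2 / η * Real.exp (-(2 * ν') * s) with hdef
    obtain ⟨N, hN⟩ : ∃ N, N = 2 * (y₀ s * y₁ s + y₁ s * (y₂ s + e₁ s) + y₂ s * (y₃ s + e₂ s)
        + y₃ s * (-y₀ s + e₃ s)) := ⟨_, rfl⟩
    have h2 : N ≤ 3 * n s + h := by
      rw [hN]
      have h3 : 2 * (y₁ s * e₁ s + y₂ s * e₂ s + y₃ s * e₃ s) ≤ 12 * η * n s + h := by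
        rw [hdef, ← hh]
        refine le_trans ?_ (abs_mul_sum_le hη le_rfl)
        have hp : ∀ {y e m : ℝ}, |e| ≤ m → y * e ≤ m * |y| := fun {y e m} he =>
          (le_abs_self _).trans (by rw [abs_mul, mul_comm]; gcongr)
        have := hp (y := y₁ s) (he₁ s hs)
        have := hp (y := y₂ s) (he₂ s hs)
        have := hp (y := y₃ s) (he₃ s hs)
        have := mul_nonneg ((abs_nonneg _).trans (he₁ s hs)) (abs_nonneg (y₀ s))
        linarith
      have h4 : 2 * (y₀ s * y₁ s + y₁ s * y₂ s + y₂ s * y₃ s - y₃ s * y₀ s) ≤ 2 * n s := by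
        simp only [hn]
        linarith [sq_nonneg (y₀ s - y₁ s), sq_nonneg (y₁ s - y₂ s), sq_nonneg (y₂ s - y₃ s),
          sq_nonneg (y₃ s + y₀ s)]
      have h24 : 24 * η ≤ 1 := by linarith [mul_pos hs2 hν'0]
      have h5 : 12 * η * n s ≤ 1 * n s := by
        gcongr
        linarith
      linarith
    have h5 := hEs s hs
    have h6 := neg_abs_le (E s)
    have h7 : -(√2 * ν' * n s) ≤ 2 * ν * q s := by
      have h8 : -(2 * ν' * |q s|) ≤ 2 * ν * q s := by
        have : 2 * ν * (-|q s|) ≤ 2 * ν * q s :=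
          mul_le_mul_of_nonneg_left (neg_abs_le _) (by positivity)
        have := mul_le_mul_of_nonneg_right hνν'.le (abs_nonneg (q s))
        linarith
      have := mul_le_mul_of_nonneg_left (hqn s) hν'0.le
      linarith
    have h8 : c * n s - h ≤ 2 * ν * q s + (n s + E s) := by
      rw [hc]
      have h10 := mul_nonneg (sub_nonneg.2 hη') (hn0 s)
      linarith
    have h9 : 2 * ν * n s + N - L * (2 * ν * q s + (n s + E s)) - (1 + L) * h ≤ 0 := by
      have : L * (c * n s) = 5 * n s := by rw [hL]; field_simp
      have h10 := mul_le_mul_of_nonneg_left h8 hL0.le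
      have h11 := mul_le_mul_of_nonneg_right (hνν'.le.trans hν1.le) (hn0 s)
      rw [mul_sub, this] at h10
      linarith
    rw [h1, ← hN]
    have := mul_le_mul_of_nonneg_left h9 (Real.exp_pos (2 * ν * s)).le
    linarith
  refine ⟨L * A + (Real.exp (2 * ν * S) * n S - L * (Real.exp (2 * ν * S) * q S)
      + K * Real.exp (-(2 * τ) * S)), fun s hs => ?_⟩
  have h1 := hΦ (mem_Ici.2 le_rfl) hs hs
  have h2 := mul_le_mul_of_nonneg_left (hqA s hs) hL0.le
  have h3 : 0 ≤ K * Real.exp (-(2 * τ) * s) := by positivity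
  simp only at h1
  linarith

/-! ### The first order system and decay at infinity. -/

open Asymptotics

/-- The resolvent equation on `(0, ∞)` as a first order system, with `u₁ = u'`, `u₂ = u''` and
flux `q = (x³ + x²) u'''`. -/
structure ResolventSystem (lam : ℝ) (g u u₁ u₂ q : ℝ → ℝ) : Prop where
  hasDerivAt : ∀ x, 0 < x → HasDerivAt u (u₁ x) x
  hasDerivAt₁ : ∀ x, 0 < x → HasDerivAt u₁ (u₂ x) x
  hasDerivAt₂ : ∀ x, 0 < x → HasDerivAt u₂ (q x / (x ^ 3 + x ^ 2)) x
  hasDerivAt_flux : ∀ x, 0 < x → HasDerivAt q (g x - lam * u x) x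

/-- Decay of `f` at every rate `4 ν (lam x)^{1/4}` with `ν < 1/√2`. -/
def HasSubcriticalDecay (lam : ℝ) (f : ℝ → ℝ) : Prop :=
  ∀ ν ∈ Ico (0 : ℝ) (1 / √2),
    f =O[atTop] fun x => Real.exp (-(ν * (4 * (lam * x) ^ (1 / 4 : ℝ))))

theorem tendsto_stretched_atTop {lam : ℝ} (hlam : 0 < lam) :
    Tendsto (fun x : ℝ => 4 * (lam * x) ^ (1 / 4 : ℝ)) atTop atTop :=
  ((tendsto_rpow_atTop (by norm_num)).comp (tendsto_id.const_mul_atTop hlam)).const_mul_atTop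
    (by norm_num)

theorem stretched_pow_four {lam x : ℝ} (hlam : 0 < lam) (hx : 0 ≤ x) :
    (4 * (lam * x) ^ (1 / 4 : ℝ)) ^ 4 = 256 * lam * x := by
  rw [mul_pow, ← Real.rpow_natCast ((lam * x) ^ (1 / 4 : ℝ)), ← Real.rpow_mul (by positivity)]
  norm_num
  ring

theorem stretched_inv {lam s : ℝ} (hlam : 0 < lam) (hs : 0 ≤ s) :
    4 * (lam * (s ^ 4 / (256 * lam))) ^ (1 / 4 : ℝ) = s := by
  have : lam * (s ^ 4 / (256 * lam)) = (s / 4) ^ 4 := by field_simp; norm_num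
  rw [this, one_div, show (4 : ℝ) = ((4 : ℕ) : ℝ) by norm_num,
    Real.pow_rpow_inv_natCast (by positivity) (by norm_num)]
  push_cast; ring

namespace HasSubcriticalDecay

variable {lam : ℝ} {f h : ℝ → ℝ}

/-- The range of rates is open at its upper end, so a polynomial factor is absorbed by passing to a
slightly larger rate: x is a constant times the fourth power of the stretched variable. -/
theorem mul_isBigO (hlam : 0 < lam) (hf : HasSubcriticalDecay lam f) {k : ℕ}
    (hh : h =O[atTop] fun x : ℝ => x ^ k) : HasSubcriticalDecay lam (fun x => h x * f x) := by
  intro ν hν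
  obtain ⟨ν', h1, h2⟩ := exists_between hν.2
  have h3 : (fun x : ℝ => x ^ k) =O[atTop]
      fun x => Real.exp ((ν' - ν) * (4 * (lam * x) ^ (1 / 4 : ℝ))) := by
    have h4 := ((isLittleO_pow_exp_pos_mul_atTop (4 * k) (sub_pos.2 h1)).isBigO).comp_tendsto
      (tendsto_stretched_atTop hlam)
    refine IsBigO.trans (IsBigO.of_bound ((256 * lam)⁻¹ ^ k) ?_) h4
    filter_upwards [eventually_ge_atTop 0] with x hx
    simp only [Function.comp]
    rw [pow_mul, stretched_pow_four hlam hx, ← Real.norm_of_nonneg (by positivity :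
      (0 : ℝ) ≤ (256 * lam)⁻¹ ^ k), ← norm_mul, ← mul_pow, inv_mul_cancel_left₀ (by positivity)]
  refine ((hh.trans h3).mul (hf ν' ⟨hν.1.trans h1.le, h2⟩)).congr_right fun x => ?_
  rw [← Real.exp_add]
  congr 1; ring

theorem of_isBigO (hf : HasSubcriticalDecay lam f) (h' : h =O[atTop] f) :
    HasSubcriticalDecay lam h := fun ν hν => h'.trans (hf ν hν)

theorem sub (hf : HasSubcriticalDecay lam f) (hh : HasSubcriticalDecay lam h) :
    HasSubcriticalDecay lam (fun x => f x - h x) := fun ν hν => (hf ν hν).sub (hh ν hν)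

theorem const_mul (hf : HasSubcriticalDecay lam f) (c : ℝ) :
    HasSubcriticalDecay lam (fun x => c * f x) := fun ν hν => (hf ν hν).const_mul_left c

theorem sum {ι : Type*} (t : Finset ι) {F : ι → ℝ → ℝ}
    (hF : ∀ i ∈ t, HasSubcriticalDecay lam (F i)) :
    HasSubcriticalDecay lam (fun x => ∑ i ∈ t, F i x) :=
  fun ν hν => IsBigO.fun_sum fun i hi => hF i hi ν hν

/-- Functions with subcritical decay are `O(x^{-k})` for every `k`. -/
theorem isBigO_inv_pow (hlam : 0 < lam) (hf : HasSubcriticalDecay lam f) (k : ℕ) :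
    f =O[atTop] fun x : ℝ => (x ^ k)⁻¹ := by
  have h1 := (hf.mul_isBigO hlam (isBigO_refl (fun x : ℝ => x ^ k) atTop)) 0
    ⟨le_rfl, by positivity⟩
  simp only [zero_mul, neg_zero, Real.exp_zero] at h1
  have h2 := (isBigO_refl (fun x : ℝ => (x ^ k)⁻¹) atTop).mul h1
  refine (h2.congr' ?_ (by simp))
  filter_upwards [eventually_gt_atTop 0] with x hx
  field_simp

end HasSubcriticalDecay

/-- A function whose derivative grows at most like `x^k` grows at most like `x^{k+1}`. -/
theorem isBigO_pow_succ_of_deriv {f f' : ℝ → ℝ} {k : ℕ}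
    (hf : ∀ x, 0 < x → HasDerivAt f (f' x) x) (hf' : ∃ C, ∀ x, 1 ≤ x → |f' x| ≤ C * x ^ k) :
    ∃ C, ∀ x, 1 ≤ x → |f x| ≤ C * x ^ (k + 1) := by
  obtain ⟨C, hC⟩ := hf'
  have hC0 : 0 ≤ C := by simpa using (abs_nonneg _).trans (hC 1 le_rfl)
  refine ⟨|f 1| + C, fun x hx => ?_⟩
  have h1 := Convex.norm_image_sub_le_of_norm_hasDerivWithin_le (f := f) (f' := f')
    (C := C * x ^ k) (s := Icc 1 x)
    (fun y hy => (hf y (by linarith [hy.1])).hasDerivWithinAt)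
    (fun y hy => (hC y hy.1).trans (by gcongr; exacts [by linarith [hy.1], hy.2])) (convex_Icc 1 x)
    (left_mem_Icc.2 hx) (right_mem_Icc.2 hx)
  rw [Real.norm_eq_abs, Real.norm_eq_abs, abs_of_nonneg (by linarith : 0 ≤ x - 1)] at h1
  have h2 : |f x| ≤ |f 1| + |f x - f 1| := by
    have := abs_add_le (f 1) (f x - f 1); simpa using this
  have h3 : 1 ≤ x ^ (k + 1) := one_le_pow₀ hx
  have h4 : C * x ^ k * (x - 1) ≤ C * x ^ (k + 1) := by
    rw [pow_succ, ← mul_assoc]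
    exact mul_le_mul_of_nonneg_left (by linarith) (by positivity)
  nlinarith [abs_nonneg (f 1)]

namespace ResolventSystem

variable {lam : ℝ} {g u u₁ u₂ q : ℝ → ℝ}

/-- The bound propagates through the system: q' = O(x²), so q = O(x³), u''' = O(1), u'' = O(x), u' =
O(x²). Any polynomial bounds would serve for the decay argument. -/
theorem exists_growth_bounds (h : ResolventSystem lam g u u₁ u₂ q)
    (hg : ∃ C, ∀ x, 1 ≤ x → |g x| ≤ C * x ^ 2) (hu : ∃ C, ∀ x, 1 ≤ x → |u x| ≤ C * x ^ 2) :
    (∃ C, ∀ x, 1 ≤ x → |u₁ x| ≤ C * x ^ 2) ∧ (∃ C, ∀ x, 1 ≤ x → |u₂ x| ≤ C * x ^ 1) ∧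
      (∃ C, ∀ x, 1 ≤ x → |q x| ≤ C * x ^ 3) := by
  obtain ⟨C, hC⟩ := hg
  obtain ⟨C', hC'⟩ := hu
  have hq : ∃ C, ∀ x, 1 ≤ x → |q x| ≤ C * x ^ 3 := by
    refine isBigO_pow_succ_of_deriv h.hasDerivAt_flux ⟨C + |lam| * C', fun x hx => ?_⟩
    calc |g x - lam * u x| ≤ |g x| + |lam| * |u x| := by
          rw [← abs_mul]; exact abs_sub _ _
      _ ≤ C * x ^ 2 + |lam| * (C' * x ^ 2) := by gcongr; exacts [hC x hx, hC' x hx]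
      _ = _ := by ring
  have h2 : ∃ C, ∀ x, 1 ≤ x → |u₂ x| ≤ C * x ^ 1 := by
    obtain ⟨C, hC⟩ := hq
    refine isBigO_pow_succ_of_deriv h.hasDerivAt₂ ⟨C, fun x hx => ?_⟩
    have hx0 : 0 < x := by linarith
    rw [abs_div, abs_of_pos (by positivity : 0 < x ^ 3 + x ^ 2), div_le_iff₀ (by positivity)]
    have hC0 : 0 ≤ C := by simpa using (abs_nonneg _).trans (hC 1 le_rfl)
    nlinarith [hC x hx, mul_nonneg hC0 (sq_nonneg x)]
  exact ⟨isBigO_pow_succ_of_deriv h.hasDerivAt₁ h2, h2, hq⟩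

theorem isBigO_of_forall_le {f : ℝ → ℝ} {k : ℕ} (h : ∃ C, ∀ x, 1 ≤ x → |f x| ≤ C * x ^ k) :
    f =O[atTop] fun x : ℝ => x ^ k := by
  obtain ⟨C, hC⟩ := h
  refine IsBigO.of_bound C ?_
  filter_upwards [eventually_ge_atTop 1] with x hx
  rw [Real.norm_eq_abs, Real.norm_eq_abs, abs_of_nonneg (by positivity : 0 ≤ x ^ k)]
  exact hC x hx

/-- At infinity p behaves like x³, and x = s⁴/(256 lam) turns lam u + (x³ u''')' into a multiple of
u plus its fourth s-derivative, up to terms of relative size 1/s and 1/x. These errors become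
arbitrarily small for large s, so polynomial growth is upgraded to decay. -/
theorem hasSubcriticalDecay (hlam : 0 < lam) (h : ResolventSystem lam g u u₁ u₂ q)
    (hgd : HasSubcriticalDecay lam g)
    (hg : ∃ C, ∀ x, 1 ≤ x → |g x| ≤ C * x ^ 2) (hu : ∃ C, ∀ x, 1 ≤ x → |u x| ≤ C * x ^ 2) :
    HasSubcriticalDecay lam u ∧ HasSubcriticalDecay lam u₁ ∧ HasSubcriticalDecay lam u₂ ∧
      HasSubcriticalDecay lam q := by
  obtain ⟨hu₁, hu₂, hq⟩ := h.exists_growth_bounds hg hu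
  set X : ℝ → ℝ := fun s => s ^ 4 / (256 * lam) with hX
  set m : ℝ → ℝ := fun s => s ^ 3 / (64 * lam) with hm
  have hXt : Tendsto X atTop atTop :=
    (tendsto_pow_atTop (by norm_num)).atTop_div_const (by positivity)
  have hX0 : ∀ s, 0 < s → 0 < X s := fun s hs => by positivity
  have hXd : ∀ s, HasDerivAt X (m s) s := fun s => by
    convert! (hasDerivAt_pow 4 s).div_const (256 * lam) using 1
    simp only [hm]; field_simp; norm_num; ring
  have hmd : ∀ s, s ≠ 0 → HasDerivAt m (3 / s * m s) s := fun s hs => by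
    convert! (hasDerivAt_pow 3 s).div_const (64 * lam) using 1
    simp only [hm]; field_simp; norm_num
  set y₀ : ℝ → ℝ := fun s => u (X s) with hy₀
  set y₁ : ℝ → ℝ := fun s => m s * u₁ (X s) with hy₁
  set y₂ : ℝ → ℝ := fun s => m s ^ 2 * u₂ (X s) with hy₂
  set y₃ : ℝ → ℝ := fun s => 64 / s ^ 3 * q (X s) with hy₃
  have hd₀ : ∀ s, 0 < s → HasDerivAt y₀ (y₁ s) s := fun s hs => by
    convert! (h.hasDerivAt _ (hX0 s hs)).comp s (hXd s) using 1
    simp only [hy₁]; ring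
  have hd₁ : ∀ s, 0 < s → HasDerivAt y₁ (y₂ s + 3 / s * y₁ s) s := fun s hs => by
    convert! (hmd s hs.ne').mul ((h.hasDerivAt₁ _ (hX0 s hs)).comp s (hXd s)) using 1
    simp only [hy₁, hy₂, Function.comp]; ring
  have hd₂ : ∀ s, 0 < s → HasDerivAt y₂ (y₃ s + (6 / s * y₂ s - y₃ s / (X s + 1))) s := fun s hs => by
    convert! ((hmd s hs.ne').pow 2).mul ((h.hasDerivAt₂ _ (hX0 s hs)).comp s (hXd s)) using 1
    have hXs := hX0 s hs
    have e1 : m s ^ 3 = 64 / s ^ 3 * X s ^ 3 := by simp only [hm, hX]; field_simp; norm_num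
    have e2 : m s ^ 2 * (q (X s) / (X s ^ 3 + X s ^ 2) * m s) =
        m s ^ 3 * (q (X s) / (X s ^ 3 + X s ^ 2)) := by ring
    simp only [hy₂, hy₃, Function.comp, Pi.pow_apply]
    rw [e2, e1]
    generalize X s = x at hXs
    field_simp
    push_cast
    ring
  have hd₃ : ∀ s, 0 < s → HasDerivAt y₃ (-y₀ s + (-(3 / s * y₃ s) + g (X s) / lam)) s := fun s hs => by
    have e1 : HasDerivAt (fun s : ℝ => 64 / s ^ 3) (-(3 / s) * (64 / s ^ 3)) s := by
      convert! ((hasDerivAt_pow 3 s).inv (by positivity)).const_mul 64 using 1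
      field_simp
      norm_num
    convert! e1.mul ((h.hasDerivAt_flux _ (hX0 s hs)).comp s (hXd s)) using 1
    simp only [hy₀, hy₃, hm, Function.comp]
    field_simp
    ring
  have hXO : ∀ k : ℕ, (fun s => X s ^ k) =O[atTop] fun s : ℝ => s ^ (4 * k) := fun k => by
    simp only [hX, pow_mul, div_eq_inv_mul, mul_pow]
    exact (isBigO_refl _ _).const_mul_left _
  have hmO : m =O[atTop] fun s : ℝ => s ^ 3 := by
    simp only [hm, div_eq_inv_mul]
    exact (isBigO_refl _ _).const_mul_left _
  have hpow : ∀ {f : ℝ → ℝ} {k : ℕ}, k ≤ 12 → f =O[atTop] (fun s : ℝ => s ^ k) →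
      f =O[atTop] fun s : ℝ => s ^ 12 := fun hk hf =>
    hf.trans (IsBigO.of_bound 1 ((eventually_ge_atTop 1).mono fun s hs => by
      rw [norm_pow, norm_pow, one_mul]
      exact pow_le_pow_right₀ (hs.trans (le_abs_self s)) hk))
  have hcomp : ∀ {f : ℝ → ℝ} {k : ℕ}, (∃ C, ∀ x, 1 ≤ x → |f x| ≤ C * x ^ k) →
      (fun s => f (X s)) =O[atTop] fun s : ℝ => s ^ (4 * k) := fun hf =>
    ((isBigO_of_forall_le hf).comp_tendsto hXt).trans (hXO _)
  have g₀ : y₀ =O[atTop] fun s : ℝ => s ^ 12 := hpow (by norm_num) (hcomp hu)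
  have g₁ : y₁ =O[atTop] fun s : ℝ => s ^ 12 := hpow (k := 3 + 4 * 2) (by norm_num)
    ((hmO.mul (hcomp hu₁)).congr_right fun s => (pow_add s 3 (4 * 2)).symm)
  have g₂ : y₂ =O[atTop] fun s : ℝ => s ^ 12 := hpow (k := 6 + 4 * 1) (by norm_num)
    (((hmO.pow 2).mul (hcomp hu₂)).congr_right fun s => by ring)
  have g₃ : y₃ =O[atTop] fun s : ℝ => s ^ 12 := by
    have : (fun s : ℝ => 64 / s ^ 3) =O[atTop] fun s => (1 : ℝ) := by
      refine IsBigO.of_bound 64 ?_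
      filter_upwards [eventually_ge_atTop 1] with s hs
      rw [Real.norm_eq_abs, abs_of_nonneg (by positivity)]
      simpa using div_le_self (by norm_num : (0 : ℝ) ≤ 64) (one_le_pow₀ hs)
    exact (this.mul (hcomp hq)).congr_right fun s => by ring
  -- decay of the transformed unknowns
  have key : ∀ ν ∈ Ico (0 : ℝ) (1 / √2), ∃ C, ∀ᶠ s in atTop,
      Real.exp (2 * ν * s) * (y₀ s ^ 2 + y₁ s ^ 2 + y₂ s ^ 2 + y₃ s ^ 2) ≤ C := by
    intro ν hν
    obtain ⟨ν', h1, h2⟩ := exists_between hν.2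
    have hs2 : (0 : ℝ) < √2 := by positivity
    have h2' : √2 * ν' < 1 := by rwa [lt_div_iff₀ hs2, mul_comm] at h2
    set η := (1 - √2 * ν') / 24 with hη
    have hη0 : 0 < η := by rw [hη]; linarith
    obtain ⟨B, hB⟩ := (((hgd ν' ⟨hν.1.trans h1.le, h2⟩).comp_tendsto hXt).const_mul_left lam⁻¹).bound
    -- Beyond S the inhomogeneity decays at rate ν', and 6/s and 1/(X+1) are at most η. The bound on
    -- 6/s also covers the coefficient 3/s.
    obtain ⟨S, hS⟩ := eventually_atTop.1 (hB.and ((eventually_ge_atTop (max 1 (6 / η))).and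
      (hXt.eventually_ge_atTop (1 / η))))
    have hS1 : 1 ≤ max S 1 := le_max_right _ _
    have hB' : ∀ s, max S 1 ≤ s → |g (X s) / lam| ≤ |B| * Real.exp (-ν' * s) := by
      intro s hs
      have h3 := (hS s ((le_max_left _ _).trans hs)).1
      simp only [Function.comp, hX] at h3
      rw [stretched_inv hlam (by linarith), Real.norm_eq_abs, Real.norm_eq_abs, Real.abs_exp] at h3
      rw [div_eq_inv_mul, neg_mul]
      exact h3.trans (by gcongr; exact le_abs_self B)
    have h6 : ∀ s, max S 1 ≤ s → 6 / s ≤ η := by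
      intro s hs
      have h3 := (le_max_right _ _).trans (hS s ((le_max_left _ _).trans hs)).2.1
      rw [div_le_iff₀ hη0] at h3
      rw [div_le_iff₀ (by linarith)]
      linarith
    have hXη : ∀ s, max S 1 ≤ s → 1 / (X s + 1) ≤ η := by
      intro s hs
      have h3 := (hS s ((le_max_left _ _).trans hs)).2.2
      have := hX0 s (by linarith)
      rw [div_le_iff₀ hη0] at h3
      rw [div_le_iff₀ (by linarith)]
      linarith
    have hpos : ∀ s, max S 1 ≤ s → 0 < s := fun s hs => by linarith
    have h36 : ∀ s, max S 1 ≤ s → ∀ y, |3 / s * y| ≤ η * |y| := by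
      intro s hs y
      have hs0 := hpos s hs
      rw [abs_mul, abs_of_pos (by positivity)]
      gcongr
      refine le_trans ?_ (h6 s hs)
      gcongr; norm_num
    obtain ⟨C, hC⟩ := exists_decay_of_perturbed_biharmonic (S := max S 1) (B := |B|)
      hν.1 h1 h2' hη0 (by rw [hη]; linarith) (by linarith)
      (fun s hs => hd₀ s (hpos s hs)) (fun s hs => hd₁ s (hpos s hs))
      (fun s hs => hd₂ s (hpos s hs)) (fun s hs => hd₃ s (hpos s hs))
      (fun s hs => by
        have := h36 s hs (y₁ s)
        have : 0 ≤ η * (|y₀ s| + |y₂ s| + |y₃ s|) := by positivity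
        have : 0 ≤ |B| * Real.exp (-ν' * s) := by positivity
        linarith)
      (fun s hs => by
        have hs0 := hpos s hs
        have e1 : |6 / s * y₂ s| ≤ η * |y₂ s| := by
          rw [abs_mul, abs_of_pos (by positivity)]
          gcongr; exact h6 s hs
        have e2 : |y₃ s / (X s + 1)| ≤ η * |y₃ s| := by
          have := hX0 s hs0
          rw [div_eq_mul_one_div, abs_mul, abs_of_pos (a := 1 / (X s + 1)) (by positivity), mul_comm]
          gcongr; exact hXη s hs
        have := abs_sub (6 / s * y₂ s) (y₃ s / (X s + 1))
        have : 0 ≤ η * (|y₀ s| + |y₁ s|) := by positivity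
        have : 0 ≤ |B| * Real.exp (-ν' * s) := by positivity
        linarith)
      (fun s hs => by
        have e1 := h36 s hs (y₃ s)
        have e2 := hB' s hs
        have := abs_add_le (-(3 / s * y₃ s)) (g (X s) / lam)
        rw [abs_neg] at this
        have : 0 ≤ η * (|y₀ s| + |y₁ s| + |y₂ s|) := by positivity
        linarith)
      (by
        have e1 : (fun s => y₀ s ^ 2 + y₁ s ^ 2 + y₂ s ^ 2 + y₃ s ^ 2) =O[atTop]
            fun s : ℝ => (s ^ 12) ^ 2 :=
          (((g₀.pow 2).add (g₁.pow 2)).add (g₂.pow 2)).add (g₃.pow 2)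
        have e2 : (fun s : ℝ => (s ^ 12) ^ 2) =o[atTop] fun s => Real.exp (2 * (ν' - ν) * s) := by
          simp_rw [← pow_mul]
          exact isLittleO_pow_exp_pos_mul_atTop _ (by linarith)
        have e3 := (e1.trans_isLittleO e2).tendsto_div_nhds_zero
        refine e3.congr fun s => ?_
        rw [neg_mul, Real.exp_neg]; field_simp)
    exact ⟨C, (eventually_ge_atTop _).mono hC⟩
  -- transfer back
  have hback : ∀ {y : ℝ → ℝ}, (∀ s, y s ^ 2 ≤ y₀ s ^ 2 + y₁ s ^ 2 + y₂ s ^ 2 + y₃ s ^ 2) →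
      HasSubcriticalDecay lam (fun x => y (4 * (lam * x) ^ (1 / 4 : ℝ))) := by
    intro y hy ν hν
    obtain ⟨C, hC⟩ := key ν hν
    have : y =O[atTop] fun s => Real.exp (-(ν * s)) := by
      refine IsBigO.of_bound (√|C|) ?_
      filter_upwards [hC] with s hs
      rw [Real.norm_eq_abs, Real.norm_eq_abs, Real.abs_exp]
      refine abs_le_of_sq_le_sq ?_ (by positivity)
      rw [mul_pow, Real.sq_sqrt (abs_nonneg C)]
      have e1 : Real.exp (2 * ν * s) * Real.exp (-(ν * s)) ^ 2 = 1 := by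
        rw [← Real.exp_nat_mul, ← Real.exp_add, Real.exp_eq_one_iff]; push_cast; ring
      have e2 : Real.exp (2 * ν * s) * y s ^ 2 ≤ |C| :=
        (mul_le_mul_of_nonneg_left (hy s) (Real.exp_pos _).le).trans (hs.trans (le_abs_self C))
      calc y s ^ 2 = (Real.exp (2 * ν * s) * y s ^ 2) * Real.exp (-(ν * s)) ^ 2 := by
            linear_combination (-(y s ^ 2)) * e1
        _ ≤ |C| * Real.exp (-(ν * s)) ^ 2 := by gcongr
    exact this.comp_tendsto (tendsto_stretched_atTop hlam)
  have hXs : ∀ x, 0 < x → X (4 * (lam * x) ^ (1 / 4 : ℝ)) = x := fun x hx => by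
    simp only [hX]; rw [stretched_pow_four hlam hx.le]; field_simp
  have hst : ∀ᶠ x : ℝ in atTop, 0 < x ∧ 1 ≤ 4 * (lam * x) ^ (1 / 4 : ℝ) ∧
      1 ≤ m (4 * (lam * x) ^ (1 / 4 : ℝ)) := by
    refine (eventually_gt_atTop 0).and (((tendsto_stretched_atTop hlam).eventually_ge_atTop 1).and ?_)
    have hmt : Tendsto m atTop atTop :=
      (tendsto_pow_atTop (by norm_num)).atTop_div_const (by positivity)
    exact (hmt.comp (tendsto_stretched_atTop hlam)).eventually_ge_atTop 1
  refine ⟨(hback (y := y₀) fun s => by nlinarith [sq_nonneg (y₁ s), sq_nonneg (y₂ s), sq_nonneg (y₃ s)]).of_isBigO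
      (IsBigO.of_bound 1 ?_),
    (hback (y := y₁) fun s => by nlinarith [sq_nonneg (y₀ s), sq_nonneg (y₂ s), sq_nonneg (y₃ s)]).of_isBigO
      (IsBigO.of_bound 1 ?_),
    (hback (y := y₂) fun s => by nlinarith [sq_nonneg (y₀ s), sq_nonneg (y₁ s), sq_nonneg (y₃ s)]).of_isBigO
      (IsBigO.of_bound 1 ?_),
    ((hback (y := y₃) fun s => by nlinarith [sq_nonneg (y₀ s), sq_nonneg (y₁ s), sq_nonneg (y₂ s)]).mul_isBigO
      hlam (isBigO_refl (fun x : ℝ => x ^ 1) atTop)).of_isBigO (IsBigO.of_bound (256 * lam) ?_)⟩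
  · filter_upwards [hst] with x hx
    simp only [hy₀]; rw [hXs x hx.1, one_mul]
  · filter_upwards [hst] with x hx
    simp only [hy₁]
    rw [hXs x hx.1, one_mul, norm_mul]
    refine le_mul_of_one_le_left (norm_nonneg _) (hx.2.2.trans (le_abs_self _))
  · filter_upwards [hst] with x hx
    simp only [hy₂]
    rw [hXs x hx.1, one_mul, norm_mul, norm_pow]
    refine le_mul_of_one_le_left (norm_nonneg _) (one_le_pow₀ (hx.2.2.trans (le_abs_self _)))
  · filter_upwards [hst] with x hx
    simp only [hy₃]
    have h4 := stretched_pow_four hlam hx.1.le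
    have hs1 := hx.2.1
    rw [hXs x hx.1, ← mul_assoc, norm_mul, ← mul_assoc]
    refine le_mul_of_one_le_left (norm_nonneg _) ?_
    set s := 4 * (lam * x) ^ (1 / 4 : ℝ)
    rw [Real.norm_eq_abs, abs_of_nonneg (by have := hx.1; positivity), pow_one, ← mul_assoc, ← h4]
    -- Since 256 lam x = s⁴, the factor relating q to x y₃ is 64s ≥ 1; recovering q from y₃
    -- therefore costs only a power of x.
    have : s ^ 4 * (64 / s ^ 3) = 64 * s := by field_simp
    rw [this]; linarith

end ResolventSystem

/-! ### Decay of all derivatives. -/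

theorem hasStretchedExpDecay_iff {lam : ℝ} {f : ℝ → ℝ} :
    HasStretchedExpDecay lam f ↔ ∀ j, HasSubcriticalDecay lam (iteratedDeriv j f) := by
  have hrw : ∀ (j : ℕ) (ν x : ℝ), |Real.exp (ν * 4 * (lam * x) ^ (1 / 4 : ℝ)) * iteratedDeriv j f x| =
      |iteratedDeriv j f x| / Real.exp (-(ν * (4 * (lam * x) ^ (1 / 4 : ℝ)))) := fun j ν x => by
    rw [abs_mul, Real.abs_exp, Real.exp_neg, div_inv_eq_mul, mul_comm, mul_assoc]
  refine forall_congr' fun j => forall₂_congr fun ν hν => ⟨fun h => ?_, fun h => ?_⟩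
  · obtain ⟨c, hc1, hc2⟩ := exists_between h
    have := eventually_lt_of_limsup_lt hc1
    refine IsBigO.of_bound c.toReal ?_
    filter_upwards [this] with x hx
    have h1 := (ENNReal.ofReal_le_iff_le_toReal hc2.ne).1 hx.le
    rw [hrw, div_le_iff₀ (Real.exp_pos _)] at h1
    rwa [Real.norm_eq_abs, Real.norm_eq_abs, Real.abs_exp]
  · obtain ⟨c, hc⟩ := h.bound
    refine (limsup_le_of_le (a := ENNReal.ofReal c) (by isBoundedDefault) ?_).trans_lt
      ENNReal.ofReal_lt_top
    filter_upwards [hc] with x hx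
    refine ENNReal.ofReal_le_ofReal ?_
    rwa [hrw, div_le_iff₀ (Real.exp_pos _), ← Real.abs_exp, ← Real.norm_eq_abs, ← Real.norm_eq_abs]

theorem HasSubcriticalDecay.polynomial_mul {lam : ℝ} (hlam : 0 < lam) {f : ℝ → ℝ}
    (hf : HasSubcriticalDecay lam f) (P : Polynomial ℝ) :
    HasSubcriticalDecay lam (fun x => P.eval x * f x) := by
  refine hf.mul_isBigO hlam (k := P.natDegree) ?_
  have := Polynomial.isBigO_atTop_of_degree_le P (Polynomial.X ^ P.natDegree : Polynomial ℝ)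
    (by rw [Polynomial.degree_X_pow]; exact Polynomial.degree_le_natDegree)
  simpa using this

theorem HasSubcriticalDecay.congr {lam : ℝ} {f h : ℝ → ℝ} (hf : HasSubcriticalDecay lam f)
    (heq : ∀ x, 0 < x → h x = f x) : HasSubcriticalDecay lam h :=
  hf.of_isBigO (EventuallyEq.isBigO ((eventually_gt_atTop 0).mono heq))

theorem iteratedDeriv_polynomial_eval (P : Polynomial ℝ) (n : ℕ) :
    iteratedDeriv n (fun x => P.eval x) = fun x => (Polynomial.derivative^[n] P).eval x := by
  induction n with
  | zero => simp
  | succ n ih =>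
    rw [iteratedDeriv_succ, ih, Function.iterate_succ_apply']
    ext x
    exact Polynomial.deriv _

theorem iteratedDeriv_congr_pos {f h : ℝ → ℝ} (heq : ∀ x, 0 < x → f x = h x) (n : ℕ) {x : ℝ}
    (hx : 0 < x) : iteratedDeriv n f x = iteratedDeriv n h x :=
  Filter.EventuallyEq.iteratedDeriv_eq n (by filter_upwards [Ioi_mem_nhds hx] with y hy using heq y hy)

theorem contDiffOn_iteratedDeriv {f : ℝ → ℝ} (hf : ContDiffOn ℝ ∞ f (Ioi 0)) (n : ℕ) :
    ContDiffOn ℝ ∞ (iteratedDeriv n f) (Ioi 0) := by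
  induction n with
  | zero => simpa using hf
  | succ n ih =>
    rw [iteratedDeriv_succ]
    exact ((contDiffOn_infty_iff_deriv_of_isOpen isOpen_Ioi).1 ih).2

theorem iteratedDeriv_iteratedDeriv' (f : ℝ → ℝ) (m n : ℕ) :
    iteratedDeriv m (iteratedDeriv n f) = iteratedDeriv (m + n) f := by
  rw [iteratedDeriv_eq_iterate, iteratedDeriv_eq_iterate, iteratedDeriv_eq_iterate,
    Function.iterate_add_apply]

namespace ResolventSystem

variable {lam : ℝ} {g u u₁ u₂ q : ℝ → ℝ}

theorem iteratedDeriv_one (h : ResolventSystem lam g u u₁ u₂ q) {x : ℝ} (hx : 0 < x) :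
    iteratedDeriv 1 u x = u₁ x := by
  rw [_root_.iteratedDeriv_one, (h.hasDerivAt x hx).deriv]

theorem iteratedDeriv_two (h : ResolventSystem lam g u u₁ u₂ q) {x : ℝ} (hx : 0 < x) :
    iteratedDeriv 2 u x = u₂ x := by
  rw [← (h.hasDerivAt₁ x hx).deriv, iteratedDeriv_succ]
  exact EventuallyEq.deriv_eq (by filter_upwards [Ioi_mem_nhds hx] with y hy using h.iteratedDeriv_one hy)

theorem iteratedDeriv_three (h : ResolventSystem lam g u u₁ u₂ q) {x : ℝ} (hx : 0 < x) :
    iteratedDeriv 3 u x = q x / (x ^ 3 + x ^ 2) := by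
  rw [← (h.hasDerivAt₂ x hx).deriv, iteratedDeriv_succ]
  exact EventuallyEq.deriv_eq (by filter_upwards [Ioi_mem_nhds hx] with y hy using h.iteratedDeriv_two hy)

theorem mul_iteratedDeriv_three (h : ResolventSystem lam g u u₁ u₂ q) {x : ℝ} (hx : 0 < x) :
    (x ^ 3 + x ^ 2) * iteratedDeriv 3 u x = q x := by
  rw [h.iteratedDeriv_three hx]; field_simp

theorem opA_eq (h : ResolventSystem lam g u u₁ u₂ q) {x : ℝ} (hx : 0 < x) :
    lam * u x + opA u x = g x := by
  have : opA u x = g x - lam * u x := by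
    rw [← (h.hasDerivAt_flux x hx).deriv]
    exact EventuallyEq.deriv_eq
      (by filter_upwards [Ioi_mem_nhds hx] with y hy using h.mul_iteratedDeriv_three hy)
  rw [this]; ring

/-- Differentiating p u''' = q repeatedly expresses p u^{(n+4)} through derivatives of g and lower
derivatives of u with polynomial coefficients, none of which harms subcritical decay; dividing by p,
which exceeds 1 for large x, does not either. -/
theorem hasSubcriticalDecay_iteratedDeriv (hlam : 0 < lam) (h : ResolventSystem lam g u u₁ u₂ q)
    (hu : ContDiffOn ℝ ∞ u (Ioi 0)) (hg : ContDiffOn ℝ ∞ g (Ioi 0))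
    (hgd : ∀ j, HasSubcriticalDecay lam (iteratedDeriv j g)) (h₀ : HasSubcriticalDecay lam u)
    (h₁ : HasSubcriticalDecay lam u₁) (h₂ : HasSubcriticalDecay lam u₂)
    (hq : HasSubcriticalDecay lam q) (j : ℕ) : HasSubcriticalDecay lam (iteratedDeriv j u) := by
  have hdiv : ∀ {f : ℝ → ℝ}, HasSubcriticalDecay lam f →
      HasSubcriticalDecay lam (fun x => f x / (x ^ 3 + x ^ 2)) := fun hf => by
    refine hf.of_isBigO (IsBigO.of_bound 1 ?_)
    filter_upwards [eventually_ge_atTop 1] with x hx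
    rw [one_mul, norm_div]
    refine div_le_self (norm_nonneg _) ?_
    rw [Real.norm_eq_abs, abs_of_nonneg (by positivity)]
    have := one_le_pow₀ hx (n := 3)
    have := sq_nonneg x
    linarith
  induction j using Nat.strong_induction_on with
  | _ j ih =>
  match j, ih with
  | 0, _ => simpa using h₀
  | 1, _ => exact h₁.congr fun x hx => h.iteratedDeriv_one hx
  | 2, _ => exact h₂.congr fun x hx => h.iteratedDeriv_two hx
  | 3, _ => exact (hdiv hq).congr fun x hx => h.iteratedDeriv_three hx
  | n + 4, ih =>
    set P : Polynomial ℝ := Polynomial.X ^ 3 + Polynomial.X ^ 2 with hP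
    have hPe : ∀ x, P.eval x = x ^ 3 + x ^ 2 := fun x => by simp [hP]
    -- Leibniz rule for the derivative of order n + 1 of p u''', whose left side is the n-th
    -- derivative of g - lam u. The term with p undifferentiated is isolated, so the sum is shifted
    -- by one and only involves orders up to n + 3.
    have hL : ∀ x, 0 < x → P.eval x * iteratedDeriv (n + 4) u x =
        (iteratedDeriv n g x - lam * iteratedDeriv n u x) - ∑ i ∈ Finset.range (n + 1),
          ((n + 1).choose (i + 1) : ℝ) * ((Polynomial.derivative^[i + 1] P).eval x *
            iteratedDeriv (n - i + 3) u x) := by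
      intro x hx
      have e1 := iteratedDeriv_mul (n := n + 1) (x := x) (f := fun x => P.eval x)
        (g := iteratedDeriv 3 u) (by simp only [hPe]; fun_prop)
        (((contDiffOn_iteratedDeriv hu 3).contDiffAt (Ioi_mem_nhds hx)).of_le (by exact_mod_cast le_top))
      have e2 : iteratedDeriv (n + 1) ((fun x => P.eval x) * iteratedDeriv 3 u) x =
          iteratedDeriv n g x - lam * iteratedDeriv n u x := by
        rw [iteratedDeriv_congr_pos (h := q) (fun y hy => by
          simpa [hPe] using h.mul_iteratedDeriv_three hy) _ hx, iteratedDeriv_succ',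
          iteratedDeriv_congr_pos (h := g - fun y => lam * u y)
            (fun y hy => (h.hasDerivAt_flux y hy).deriv) _ hx]
        have hg' : ContDiffAt ℝ n g x := (hg.contDiffAt (Ioi_mem_nhds hx)).of_le (by exact_mod_cast le_top)
        have hu' : ContDiffAt ℝ n u x := (hu.contDiffAt (Ioi_mem_nhds hx)).of_le (by exact_mod_cast le_top)
        rw [iteratedDeriv_sub hg' (contDiffAt_const.mul hu'), iteratedDeriv_const_mul _ hu']
      rw [e2, Finset.sum_range_succ'] at e1
      rw [e1]
      simp only [iteratedDeriv_polynomial_eval, iteratedDeriv_iteratedDeriv', Nat.add_sub_add_right,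
        Nat.choose_zero_right, Function.iterate_zero, id, Nat.sub_zero]
      push_cast
      simp only [mul_assoc, add_sub_cancel_left, one_mul]
    have hR : HasSubcriticalDecay lam (fun x => P.eval x * iteratedDeriv (n + 4) u x) := by
      refine HasSubcriticalDecay.congr (((hgd n).sub ((ih n (by omega)).const_mul lam)).sub
        (HasSubcriticalDecay.sum (Finset.range (n + 1)) fun i hi =>
          (((ih (n - i + 3) (by omega)).polynomial_mul hlam
            (Polynomial.derivative^[i + 1] P)).const_mul ((n + 1).choose (i + 1) : ℝ)))) hL
    refine (hdiv hR).congr fun x hx => ?_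
    rw [hPe]; field_simp

end ResolventSystem

/-! ### Averages and smoothness up to the boundary. -/

/-- The average `x ↦ ∫₀¹ t^m f(x t) dt`. -/
noncomputable def powAverage (m : ℕ) (f : ℝ → ℝ) (x : ℝ) : ℝ := ∫ t in (0 : ℝ)..1, t ^ m * f (x * t)

/-- Extension by a constant to the left of 0, so that results for functions continuous on the whole
line apply to one-sided data. -/
theorem continuous_comp_max {f : ℝ → ℝ} (hf : ContinuousOn f (Ici 0)) :
    Continuous fun x => f (max x 0) :=
  hf.comp_continuous (by fun_prop) fun x => le_max_right x 0

theorem powAverage_comp_max (m : ℕ) (f : ℝ → ℝ) {x : ℝ} (hx : 0 ≤ x) :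
    powAverage m (fun y => f (max y 0)) x = powAverage m f x := by
  refine intervalIntegral.integral_congr fun t ht => ?_
  rw [uIcc_of_le zero_le_one] at ht
  simp only [max_eq_left (mul_nonneg hx ht.1)]

theorem continuous_powAverage (m : ℕ) {f : ℝ → ℝ} (hf : Continuous f) :
    Continuous (powAverage m f) :=
  intervalIntegral.continuous_parametric_intervalIntegral_of_continuous' (by fun_prop) 0 1

theorem continuousOn_powAverage (m : ℕ) {f : ℝ → ℝ} (hf : ContinuousOn f (Ici 0)) :
    ContinuousOn (powAverage m f) (Ici 0) :=
  (continuous_powAverage m (continuous_comp_max hf)).continuousOn.congr fun _ hx =>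
    (powAverage_comp_max m f hx).symm

theorem hasDerivWithinAt_primitive {f : ℝ → ℝ} (hf : ContinuousOn f (Ici 0)) {x : ℝ} (hx : 0 ≤ x) :
    HasDerivWithinAt (fun x => ∫ t in (0 : ℝ)..x, f t) (f x) (Ici 0) x := by
  have hc := continuous_comp_max hf
  have h1 : HasDerivAt (fun x => ∫ t in (0 : ℝ)..x, f (max t 0)) (f (max x 0)) x :=
    intervalIntegral.integral_hasDerivAt_right (hc.intervalIntegrable _ _)
      (hc.stronglyMeasurableAtFilter _ _) hc.continuousAt
  rw [max_eq_left hx] at h1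
  have h2 : ∀ y, 0 ≤ y → ∫ t in (0 : ℝ)..y, f t = ∫ t in (0 : ℝ)..y, f (max t 0) := fun y hy => by
    refine intervalIntegral.integral_congr fun t ht => ?_
    rw [uIcc_of_le hy] at ht
    simp only [max_eq_left ht.1]
  exact h1.hasDerivWithinAt.congr h2 (h2 x hx)

theorem integral_hasDerivWithinAt_eq_sub {f f' : ℝ → ℝ}
    (hf : ∀ x, 0 ≤ x → HasDerivWithinAt f (f' x) (Ici 0) x) (hf' : ContinuousOn f' (Ici 0)) {x : ℝ}
    (hx : 0 ≤ x) : ∫ t in (0 : ℝ)..x, f' t = f x - f 0 := by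
  have hsub : Icc 0 x ⊆ Ici (0 : ℝ) := fun y hy => hy.1
  refine intervalIntegral.integral_eq_sub_of_hasDeriv_right_of_le hx
    (fun y hy => (hf y hy.1).continuousWithinAt.mono hsub)
    (fun y hy => ((hf y hy.1.le).mono fun z hz => (hy.1.trans hz).le)) ?_
  exact (hf'.mono (by rw [uIcc_of_le hx]; exact hsub)).intervalIntegrable

/-- Fubini shows that the average of f is the primitive of the average of f' with one more factor t;
the one-sided derivative at 0 then comes from the fundamental theorem. -/
theorem hasDerivWithinAt_powAverage (m : ℕ) {f f' : ℝ → ℝ}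
    (hf : ∀ x, 0 ≤ x → HasDerivWithinAt f (f' x) (Ici 0) x) (hf' : ContinuousOn f' (Ici 0)) {x : ℝ}
    (hx : 0 ≤ x) : HasDerivWithinAt (powAverage m f) (powAverage (m + 1) f' x) (Ici 0) x := by
  have hfc : ContinuousOn f (Ici 0) := fun y hy => (hf y hy).continuousWithinAt
  have hc := continuous_comp_max hf'
  have h1 : ∀ y, 0 ≤ y → powAverage m f y =
      powAverage m f 0 + ∫ z in (0 : ℝ)..y, powAverage (m + 1) f' z := by
    intro y hy
    have h2 : ∫ z in (0 : ℝ)..y, powAverage (m + 1) f' z =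
        ∫ z in (0 : ℝ)..y, ∫ t in (0 : ℝ)..1, t ^ (m + 1) * f' (max (z * t) 0) := by
      refine intervalIntegral.integral_congr fun z hz => ?_
      rw [uIcc_of_le hy] at hz
      exact (powAverage_comp_max (m + 1) f' hz.1).symm
    rw [h2, intervalIntegral_intervalIntegral_swap]
    · rw [← sub_eq_iff_eq_add', powAverage, powAverage, ← intervalIntegral.integral_sub]
      · refine intervalIntegral.integral_congr fun t ht => ?_
        rw [uIcc_of_le zero_le_one] at ht
        simp only [zero_mul, ← mul_sub, pow_succ, mul_assoc, intervalIntegral.integral_const_mul]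
        congr 1
        rw [intervalIntegral.mul_integral_comp_mul_right (f := fun w => f' (max w 0)), zero_mul,
          ← integral_hasDerivWithinAt_eq_sub hf hf' (mul_nonneg hy ht.1)]
        refine intervalIntegral.integral_congr fun w hw => ?_
        rw [uIcc_of_le (mul_nonneg hy ht.1)] at hw
        simp only [max_eq_left hw.1]
      all_goals
        refine ContinuousOn.intervalIntegrable ?_
        rw [uIcc_of_le zero_le_one]
        refine ContinuousOn.mul (by fun_prop) (hfc.comp (by fun_prop) fun t ht => ?_)
        simp [hy, ht.1, mul_nonneg]
    · refine (Continuous.continuousOn ?_).integrableOn_compact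
        (isCompact_uIcc.prod isCompact_uIcc) |>.mono_set
        (prod_mono uIoc_subset_uIcc uIoc_subset_uIcc)
      have : Continuous fun p : ℝ × ℝ => p.2 ^ (m + 1) * f' (max (p.1 * p.2) 0) :=
        (by fun_prop : Continuous fun p : ℝ × ℝ => p.2 ^ (m + 1)).mul (hc.comp (by fun_prop))
      exact this
  exact ((hasDerivWithinAt_primitive (continuousOn_powAverage (m + 1) hf') hx).const_add _).congr
    h1 (h1 x hx)

theorem contDiffOn_Ici_succ_of_hasDerivWithinAt {n : ℕ} {f f' : ℝ → ℝ}
    (hf : ∀ x, 0 ≤ x → HasDerivWithinAt f (f' x) (Ici 0) x) (hf' : ContDiffOn ℝ n f' (Ici 0)) :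
    ContDiffOn ℝ (n + 1 : ℕ) f (Ici 0) := by
  push_cast
  refine (contDiffOn_succ_iff_derivWithin (uniqueDiffOn_Ici 0)).2
    ⟨fun x hx => (hf x hx).differentiableWithinAt, by simp, hf'.congr fun x hx => ?_⟩
  exact (hf x hx).derivWithin (uniqueDiffOn_Ici 0 x hx)

theorem contDiffOn_powAverage (n : ℕ) : ∀ (m : ℕ) {f : ℝ → ℝ}, ContDiffOn ℝ n f (Ici 0) →
    ContDiffOn ℝ n (powAverage m f) (Ici 0) := by
  induction n with
  | zero =>
    intro m f hf
    simp only [Nat.cast_zero, contDiffOn_zero] at hf ⊢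
    exact continuousOn_powAverage m hf
  | succ n ih =>
    intro m f hf
    push_cast at hf
    obtain ⟨h1, -, h2⟩ := (contDiffOn_succ_iff_derivWithin (uniqueDiffOn_Ici 0)).1 hf
    exact contDiffOn_Ici_succ_of_hasDerivWithinAt
      (fun x hx => hasDerivWithinAt_powAverage m
        (fun y hy => (h1 y hy).hasDerivWithinAt) h2.continuousOn hx) (ih (m + 1) h2)

theorem contDiffOn_primitive {n : ℕ} {f : ℝ → ℝ} (hf : ContDiffOn ℝ n f (Ici 0)) :
    ContDiffOn ℝ (n + 1 : ℕ) (fun x => ∫ t in (0 : ℝ)..x, f t) (Ici 0) :=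
  contDiffOn_Ici_succ_of_hasDerivWithinAt
    (fun _ hx => hasDerivWithinAt_primitive hf.continuousOn hx) hf

theorem primitive_eq_mul_powAverage (f : ℝ → ℝ) (x : ℝ) :
    ∫ t in (0 : ℝ)..x, f t = x * powAverage 0 f x := by
  simp [powAverage]

/-- The double primitive of `f` is `x²` times a smooth average of `f`. -/
theorem primitive_primitive_eq (f : ℝ → ℝ) (x : ℝ) :
    ∫ t in (0 : ℝ)..x, ∫ s in (0 : ℝ)..t, f s = x ^ 2 * powAverage 1 (powAverage 0 f) x := by
  simp_rw [primitive_eq_mul_powAverage f]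
  rw [primitive_eq_mul_powAverage, sq, mul_assoc]
  congr 1
  rw [powAverage, powAverage, ← intervalIntegral.integral_const_mul]
  congr 1 with t
  ring

/-! ### The energy solution of the differentiated equation. -/

theorem setIntegral_eq_intervalIntegral_of_eq_zero {f : ℝ → ℝ} {b : ℝ} (hb : 0 ≤ b)
    (hf : ∀ x, b ≤ x → f x = 0) : ∫ x in Ioi (0 : ℝ), f x = ∫ x in (0 : ℝ)..b, f x := by
  rw [intervalIntegral.integral_of_le hb]
  exact setIntegral_eq_of_subset_of_forall_sdiff_eq_zero measurableSet_Ioi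
    (fun x hx => hx.1) fun x hx => hf x (not_lt.1 fun h => hx.2 ⟨hx.1, h.le⟩)

theorem memLp_of_continuous_of_eq_zero {f : ℝ → ℝ} (hf : Continuous f) {b : ℝ}
    (hb : ∀ x, b ≤ x → f x = 0) : MemLp f 2 (volume.restrict (Ioi (0 : ℝ))) := by
  have h1 : MemLp f 2 (volume.restrict (Icc (0 : ℝ) b)) :=
    by
    obtain ⟨C, hC⟩ := (isCompact_Icc (a := (0 : ℝ)) (b := b)).exists_bound_of_continuousOn
      hf.continuousOn
    exact MemLp.of_bound hf.aestronglyMeasurable C ((ae_restrict_iff' measurableSet_Icc).2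
      (Eventually.of_forall hC))
  have h2 : MemLp ((Icc (0 : ℝ) b).indicator f) 2 volume :=
    (memLp_indicator_iff_restrict measurableSet_Icc).2 h1
  refine (memLp_congr_ae ?_).1 (h2.restrict (Ioi 0))
  filter_upwards [ae_restrict_mem measurableSet_Ioi] with x hx
  by_cases hxb : x ≤ b
  · exact Set.indicator_of_mem (show x ∈ Icc 0 b from ⟨(mem_Ioi.1 hx).le, hxb⟩) f
  · rw [Set.indicator_of_notMem (fun h => hxb h.2), hb x (not_le.1 hxb).le]

theorem inner_toLp_toLp {α : Type*} [MeasurableSpace α] {μ : Measure α} {f h : α → ℝ}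
    (hf : MemLp f 2 μ) (hh : MemLp h 2 μ) :
    inner ℝ (hf.toLp f) (hh.toLp h) = ∫ x, f x * h x ∂μ := by
  rw [L2.inner_def]
  refine integral_congr_ae ?_
  filter_upwards [hf.coeFn_toLp, hh.coeFn_toLp] with x h1 h2
  rw [h1, h2]; simp [mul_comm]

/-- Orthogonal decomposition with respect to the closed span of a set. -/
theorem exists_orthogonal_decomposition {E : Type*} [NormedAddCommGroup E] [InnerProductSpace ℝ E]
    [CompleteSpace E] (T : Set E) (e : E) :
    ∃ R : E, (∀ t ∈ T, inner ℝ t R = 0) ∧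
      ∀ v : E, (∀ t ∈ T, inner ℝ t v = 0) → inner ℝ v (e - R) = 0 := by
  let K : Submodule ℝ E := Submodule.span ℝ T
  -- R is the component of e orthogonal to the span, so e - R is orthogonal to everything that is
  -- orthogonal to the span.
  refine ⟨(K.orthogonal).starProjection e, fun t ht =>
    Submodule.starProjection_apply_mem K.orthogonal e t (Submodule.subset_span ht), fun v hv =>
    Submodule.sub_starProjection_mem_orthogonal (K := K.orthogonal) e v fun t ht => ?_⟩
  induction ht using Submodule.span_induction with
  | mem x hx => exact hv x hx
  | zero => simp
  | add x y _ _ hx hy => rw [inner_add_left, hx, hy, add_zero]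
  | smul a x _ hx => rw [inner_smul_left, hx, mul_zero]

/-- The energy solution of `lam w + ((x³ + x²) w'')'' = g₁` with natural boundary conditions at
`0`, where `r = √(x³ + x²) w''`. -/
theorem exists_energy_solution {lam : ℝ} (hlam : 0 < lam) {g₁ : ℝ → ℝ}
    (hg₁ : MemLp g₁ 2 (volume.restrict (Ioi (0 : ℝ)))) :
    ∃ w r : ℝ → ℝ, MemLp w 2 (volume.restrict (Ioi (0 : ℝ))) ∧
      MemLp r 2 (volume.restrict (Ioi (0 : ℝ))) ∧
      (∀ (φ : ℝ → ℝ) (b : ℝ), ContDiff ℝ ∞ φ → (∀ x, b ≤ x → φ x = 0) →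
        ∫ x in Ioi (0 : ℝ), (g₁ x - lam * w x) * φ x =
          ∫ x in Ioi (0 : ℝ), r x * (√(x ^ 3 + x ^ 2) * deriv (deriv φ) x)) ∧
      ∀ ψ, IsTest ψ → pair w (deriv (deriv ψ)) = pair (fun x => (√(x ^ 3 + x ^ 2))⁻¹ * r x) ψ := by
  set μ := volume.restrict (Ioi (0 : ℝ)) with hμ
  set c := √lam with hc
  have hc0 : 0 < c := Real.sqrt_pos.2 hlam
  have hcc : c * c = lam := Real.mul_self_sqrt hlam.le
  have hm₀ : ∀ {φ : ℝ → ℝ} {b : ℝ}, ContDiff ℝ ∞ φ → (∀ x, b ≤ x → φ x = 0) →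
      MemLp (fun x => c * φ x) 2 μ := fun hφ hb =>
    (memLp_of_continuous_of_eq_zero hφ.continuous hb).const_mul c
  have hφ2 : ∀ {φ : ℝ → ℝ}, ContDiff ℝ ∞ φ → ContDiff ℝ ∞ (deriv φ) := fun hφ =>
    (contDiff_infty_iff_deriv.1 hφ).2
  have hm₂ : ∀ {φ : ℝ → ℝ} {b : ℝ}, ContDiff ℝ ∞ φ → (∀ x, b ≤ x → φ x = 0) →
      MemLp (fun x => √(x ^ 3 + x ^ 2) * deriv (deriv φ) x) 2 μ := fun {φ b} hφ hb => by
    refine memLp_of_continuous_of_eq_zero (b := b) ?_ fun x hx => ?_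
    · exact (by fun_prop : Continuous fun x : ℝ => √(x ^ 3 + x ^ 2)).mul (hφ2 (hφ2 hφ)).continuous
    · rw [deriv_eq_zero_of_forall_ge (hφ2 hφ) (deriv_eq_zero_of_forall_ge hφ hb) x hx, mul_zero]
  -- Pairs (√lam φ, √p φ'') with φ unrestricted at 0; this freedom encodes the natural boundary
  -- conditions. Projecting e = (g₁/√lam, 0) onto the closed span of T yields (√lam w, r):
  -- orthogonality of the remainder to T is the weak equation.
  set T : Set (WithLp 2 (Lp ℝ 2 μ × Lp ℝ 2 μ)) :=
    {v | ∃ (φ : ℝ → ℝ) (b : ℝ) (hφ : ContDiff ℝ ∞ φ) (hb : ∀ x, b ≤ x → φ x = 0),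
      v = WithLp.toLp 2 ((hm₀ hφ hb).toLp, (hm₂ hφ hb).toLp)} with hT
  have hg' : MemLp (fun x => c⁻¹ * g₁ x) 2 μ := hg₁.const_mul _
  set e : WithLp 2 (Lp ℝ 2 μ × Lp ℝ 2 μ) := WithLp.toLp 2 (hg'.toLp, 0) with he
  obtain ⟨R, hRT, hP⟩ := exists_orthogonal_decomposition T e
  have hw : MemLp (fun x => c⁻¹ * (e - R).fst x) 2 μ := (Lp.memLp (e - R).fst).const_mul _
  have hr : MemLp (fun x => (e - R).snd x) 2 μ := Lp.memLp (e - R).snd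
  refine ⟨fun x => c⁻¹ * (e - R).fst x, fun x => (e - R).snd x, hw, hr, ?_, ?_⟩
  · intro φ b hφ hb
    have h1 := hRT _ ⟨φ, b, hφ, hb, rfl⟩
    rw [WithLp.prod_inner_apply] at h1
    have hR1 : R.fst = (hg'.sub (Lp.memLp (e - R).fst)).toLp := by
      rw [MemLp.toLp_sub hg' (Lp.memLp _), Lp.toLp_coeFn]; simp [he]
    have hR2 : R.snd = (hr.neg).toLp := by
      have : hr.toLp = (e - R).snd := Lp.toLp_coeFn _ _
      rw [MemLp.toLp_neg hr, this]; simp [he]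
    change inner ℝ ((hm₀ hφ hb).toLp) R.fst + inner ℝ ((hm₂ hφ hb).toLp) R.snd = 0 at h1
    rw [hR1, hR2, inner_toLp_toLp, inner_toLp_toLp] at h1
    have h2 : ∀ x, c * φ x * ((fun x => c⁻¹ * g₁ x) - fun x => (e - R).fst x) x =
        (g₁ x - lam * (c⁻¹ * (e - R).fst x)) * φ x := fun x => by
      simp only [Pi.sub_apply, ← hcc]; field_simp
    have h3 : ∀ x, √(x ^ 3 + x ^ 2) * deriv (deriv φ) x * (-fun x => (e - R).snd x) x =
        -((e - R).snd x * (√(x ^ 3 + x ^ 2) * deriv (deriv φ) x)) := fun x => by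
      simp only [Pi.neg_apply]; ring
    simp only [h3, integral_neg] at h1
    have h4 := (integral_congr_ae (μ := μ) (Eventually.of_forall h2))
    rw [← h4]
    linarith
  · intro ψ hψ
    have hs : ContDiffOn ℝ ∞ (fun x : ℝ => (√(x ^ 3 + x ^ 2))⁻¹) (Ioi 0) := by
      have hp : ∀ x ∈ Ioi (0 : ℝ), x ^ 3 + x ^ 2 ≠ 0 := fun x hx => by
        have := mem_Ioi.1 hx; positivity
      refine ((ContDiff.contDiffOn (by fun_prop)).sqrt hp).inv fun x hx => ?_
      have := mem_Ioi.1 hx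
      positivity
    have hψs := hψ.mul_left hs
    have hmt : ∀ {χ : ℝ → ℝ}, IsTest χ → MemLp χ 2 μ := fun {χ} hχ => by
      obtain ⟨a, b, -, -, h⟩ := id hχ
      exact memLp_of_continuous_of_eq_zero h.continuous h.right
    -- The pair (ψ''/√lam, -ψ/√p) is orthogonal to T by two integrations by parts. Orthogonality of
    -- the projection to it says that r/√p is the weak second derivative of w.
    have h1 : MemLp (fun x => c⁻¹ * deriv (deriv ψ) x) 2 μ := (hmt hψ.deriv.deriv).const_mul _
    have h2 := (hmt hψs).neg
    have ht : ∀ t ∈ T, inner ℝ t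
        (WithLp.toLp 2 (h1.toLp, h2.toLp) : WithLp 2 (Lp ℝ 2 μ × Lp ℝ 2 μ)) = 0 := by
      rintro _ ⟨φ, b, hφ, hb, rfl⟩
      rw [WithLp.prod_inner_apply]
      change inner ℝ ((hm₀ hφ hb).toLp) h1.toLp + inner ℝ ((hm₂ hφ hb).toLp) h2.toLp = 0
      rw [inner_toLp_toLp, inner_toLp_toLp]
      have hd : ∀ {φ : ℝ → ℝ}, ContDiff ℝ ∞ φ → ∀ x, 0 < x → HasDerivAt φ (deriv φ x) x :=
        fun hφ x _ => ((hφ.differentiable (by simp)) x).hasDerivAt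
      have h3 : pair φ (deriv (deriv ψ)) = pair (deriv (deriv φ)) ψ := by
        rw [pair_deriv (hd hφ) (hφ2 hφ).continuous.continuousOn hψ.deriv,
          pair_deriv (hd (hφ2 hφ)) (hφ2 (hφ2 hφ)).continuous.continuousOn hψ, neg_neg]
      have h4 : ∫ x, c * φ x * (c⁻¹ * deriv (deriv ψ) x) ∂μ = pair φ (deriv (deriv ψ)) := by
        refine integral_congr_ae (Eventually.of_forall fun x => ?_)
        simp only; field_simp
      have h5 : ∫ x, √(x ^ 3 + x ^ 2) * deriv (deriv φ) x *
          (-fun x => (√(x ^ 3 + x ^ 2))⁻¹ * ψ x) x ∂μ = - pair (deriv (deriv φ)) ψ := by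
        rw [pair, ← integral_neg]
        refine setIntegral_congr_fun measurableSet_Ioi fun x hx => ?_
        have : √(x ^ 3 + x ^ 2) ≠ 0 := by have := mem_Ioi.1 hx; positivity
        simp only [Pi.neg_apply]
        generalize √(x ^ 3 + x ^ 2) = y at this
        field_simp
      rw [h4, h5, h3, add_neg_cancel]
    have h6 := hP _ ht
    rw [WithLp.prod_inner_apply] at h6
    change inner ℝ h1.toLp (e - R).fst + inner ℝ h2.toLp (e - R).snd = 0 at h6
    rw [← Lp.toLp_coeFn (e - R).fst (Lp.memLp _), ← Lp.toLp_coeFn (e - R).snd (Lp.memLp _),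
      inner_toLp_toLp, inner_toLp_toLp] at h6
    have h7 : pair (fun x => c⁻¹ * (e - R).fst x) (deriv (deriv ψ)) =
        ∫ x, c⁻¹ * deriv (deriv ψ) x * (e - R).fst x ∂μ :=
      integral_congr_ae (Eventually.of_forall fun x => by simp only; ring)
    have h8 : ∫ x, (-fun x => (√(x ^ 3 + x ^ 2))⁻¹ * ψ x) x * (e - R).snd x ∂μ =
        - pair (fun x => (√(x ^ 3 + x ^ 2))⁻¹ * (e - R).snd x) ψ := by
      rw [pair, ← integral_neg]
      exact integral_congr_ae (Eventually.of_forall fun x => by simp only [Pi.neg_apply]; ring)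
    rw [h7]
    linarith

theorem MeasureTheory.LocallyIntegrable.intervalIntegrable' {f : ℝ → ℝ}
    (hf : LocallyIntegrable f) (a b : ℝ) : IntervalIntegrable f volume a b :=
  (intervalIntegrable_iff' (by simp)).2 (hf.integrableOn_isCompact isCompact_uIcc)

/-- Cauchy-Schwarz in additive form: |f| ≤ √x f² + 1/√x, integrated over (0, x) with x held fixed in
the weights. -/
theorem exists_abs_primitive_le_sqrt {f : ℝ → ℝ}
    (hf : MemLp f 2 (volume.restrict (Ioi (0 : ℝ)))) :
    ∃ C, 0 ≤ C ∧ ∀ x, 0 ≤ x → |∫ t in (0 : ℝ)..x, f t| ≤ C * √x := by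
  have hsq : IntegrableOn (fun x => f x ^ 2) (Ioi 0) := hf.integrable_sq
  have hM : 0 ≤ ∫ t in Ioi (0 : ℝ), f t ^ 2 := setIntegral_nonneg measurableSet_Ioi fun _ _ => sq_nonneg _
  refine ⟨(∫ t in Ioi (0 : ℝ), f t ^ 2) + 1, by linarith, fun x hx => ?_⟩
  rcases hx.eq_or_lt with rfl | hx
  · simp
  have hc : 0 < √x := Real.sqrt_pos.2 hx
  have hsub : Ioc 0 x ⊆ Ioi (0 : ℝ) := fun y hy => hy.1
  have hi2 : IntegrableOn (fun t => √x * f t ^ 2 + (√x)⁻¹) (Ioc 0 x) :=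
    ((hsq.mono_set hsub).const_mul _).add (integrableOn_const (by simp))
  have h1 : |∫ t in (0 : ℝ)..x, f t| ≤ ∫ t in Ioc 0 x, (√x * f t ^ 2 + (√x)⁻¹) := by
    rw [intervalIntegral.integral_of_le hx.le, ← Real.norm_eq_abs]
    refine norm_integral_le_of_norm_le hi2 (Eventually.of_forall fun t => ?_)
    rw [Real.norm_eq_abs]
    have h2 : √x * f t ^ 2 + (√x)⁻¹ - |f t| = (√x)⁻¹ * ((√x * |f t| - 1 / 2) ^ 2 + 3 / 4) := by
      rw [← sq_abs (f t)]; field_simp; ring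
    have h3 : 0 ≤ (√x)⁻¹ * ((√x * |f t| - 1 / 2) ^ 2 + 3 / 4) := by positivity
    linarith
  refine h1.trans ?_
  rw [integral_add ((hsq.mono_set hsub).const_mul _) (integrableOn_const (by simp)),
    integral_const_mul, setIntegral_const]
  have h2 : ∫ t in Ioc 0 x, f t ^ 2 ≤ ∫ t in Ioi (0 : ℝ), f t ^ 2 :=
    setIntegral_mono_set hsq (Eventually.of_forall fun _ => sq_nonneg _) hsub.eventuallyLE
  have h3 : x * (√x)⁻¹ = √x := by
    nth_rewrite 1 [← Real.mul_self_sqrt hx.le]; field_simp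
  simp only [Real.volume_real_Ioc, sub_zero, max_eq_left hx.le, smul_eq_mul, h3]
  nlinarith

theorem exists_primitive_of_eq_zero {ψ : ℝ → ℝ} {b : ℝ} (hψ : ContDiff ℝ ∞ ψ)
    (hb : ∀ x, b ≤ x → ψ x = 0) :
    ∃ φ : ℝ → ℝ, ContDiff ℝ ∞ φ ∧ (∀ x, b ≤ x → φ x = 0) ∧ deriv φ = ψ := by
  have hd : ∀ x, HasDerivAt (fun x => ∫ t in b..x, ψ t) (ψ x) x := fun x =>
    intervalIntegral.integral_hasDerivAt_right (hψ.continuous.intervalIntegrable _ _)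
      (hψ.continuous.stronglyMeasurableAtFilter _ _) hψ.continuous.continuousAt
  have hd' : deriv (fun x => ∫ t in b..x, ψ t) = ψ := funext fun x => (hd x).deriv
  refine ⟨fun x => ∫ t in b..x, ψ t, contDiff_infty_iff_deriv.2
    ⟨fun x => (hd x).differentiableAt, by rwa [hd']⟩, fun x hx => ?_, hd'⟩
  refine (intervalIntegral.integral_congr (g := fun _ => (0 : ℝ)) fun t ht => ?_).trans (by simp)
  rw [uIcc_of_le hx] at ht
  exact hb t ht.1

theorem hasDerivAt_primitive_of_continuous {f : ℝ → ℝ} (hf : Continuous f) (c x : ℝ) :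
    HasDerivAt (fun x => ∫ t in c..x, f t) (f x) x :=
  intervalIntegral.integral_hasDerivAt_right (hf.intervalIntegrable _ _)
    (hf.stronglyMeasurableAtFilter _ _) hf.continuousAt

theorem Polynomial.exists_eval_eq_affine {P : Polynomial ℝ} (hP : P.degree < 2) :
    ∃ A B : ℝ, ∀ x, P.eval x = A + B * x := by
  refine ⟨P.coeff 0, P.coeff 1, fun x => ?_⟩
  have h1 : P.degree ≤ 1 := Order.le_of_lt_succ hP
  conv_lhs => rw [Polynomial.eq_X_add_C_of_degree_le_one h1]
  simp; ring

theorem locallyIntegrableOn_of_memLp {f : ℝ → ℝ}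
    (hf : MemLp f 2 (volume.restrict (Ioi (0 : ℝ)))) : LocallyIntegrableOn f (Ioi 0) :=
  locallyIntegrableOn_of_locallyIntegrable_restrict (hf.locallyIntegrable (by norm_num))

/-- The energy solution is of class `C¹` up to the boundary and solves the integrated equation. -/
theorem exists_regular_energy_solution {lam : ℝ} (hlam : 0 < lam) {g₁ : ℝ → ℝ}
    (hg₁ : MemLp g₁ 2 (volume.restrict (Ioi (0 : ℝ)))) :
    ∃ W W' : ℝ → ℝ, Continuous W' ∧ MemLp W 2 (volume.restrict (Ioi (0 : ℝ))) ∧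
      (∀ x, HasDerivAt W (W' x) x) ∧
      ∀ x, 0 < x → HasDerivAt W'
        ((∫ t in (0 : ℝ)..x, ∫ s in (0 : ℝ)..t, (g₁ s - lam * W s)) / (x ^ 3 + x ^ 2)) x := by
  obtain ⟨w, r, hw, hr, h1, h2⟩ := exists_energy_solution hlam hg₁
  -- Extension by zero makes the primitives below vanish to the left of 0, so that W continues there
  -- as an affine function and is differentiable on the whole line.
  set f : ℝ → ℝ := (Ioi 0).indicator (fun x => g₁ x - lam * w x) with hf
  have hfm : MemLp f 2 volume :=
    (memLp_indicator_iff_restrict measurableSet_Ioi).2 (hg₁.sub (hw.const_mul lam))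
  have hfi := (hfm.locallyIntegrable (by norm_num)).intervalIntegrable'
  set F : ℝ → ℝ := fun x => ∫ t in (0 : ℝ)..x, f t with hF
  have hFc : Continuous F := intervalIntegral.continuous_primitive hfi 0
  set Q : ℝ → ℝ := fun x => ∫ t in (0 : ℝ)..x, F t with hQ
  have hQd : ∀ x, HasDerivAt Q (F x) x := fun x => hasDerivAt_primitive_of_continuous hFc 0 x
  have hQc : Continuous Q := continuous_iff_continuousAt.2 fun x => (hQd x).continuousAt
  have hF0 : ∀ x ≤ 0, F x = 0 := fun x hx => by
    refine (intervalIntegral.integral_congr (g := fun _ => (0 : ℝ)) fun t ht => ?_).trans (by simp)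
    rw [uIcc_of_ge hx] at ht
    exact Set.indicator_of_notMem (not_lt.2 ht.2) _
  have hQ0 : ∀ x ≤ 0, Q x = 0 := fun x hx => by
    refine (intervalIntegral.integral_congr (g := fun _ => (0 : ℝ)) fun t ht => ?_).trans (by simp)
    rw [uIcc_of_ge hx] at ht
    exact hF0 t ht.2
  obtain ⟨C, hC0, hC⟩ := exists_abs_primitive_le_sqrt (hfm.restrict (Ioi 0))
  have hQC : ∀ x, 0 ≤ x → |Q x| ≤ C * √x * x := fun x hx => by
    have := intervalIntegral.norm_integral_le_of_norm_le_const (f := F) (a := 0) (b := x)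
      (C := C * √x) fun t ht => by
        rw [uIoc_of_le hx] at ht
        refine (hC t ht.1.le).trans ?_
        gcongr
        exact ht.2
    simpa [abs_of_nonneg hx] using this
  -- identification of the flux
  have hp0 : ∀ x : ℝ, 0 < x → 0 < x ^ 3 + x ^ 2 := fun x hx => by positivity
  have hrQ : (fun x => √(x ^ 3 + x ^ 2) * r x) =ᵐ[volume.restrict (Ioi 0)] Q := by
    refine ae_eq_of_pair_eq ?_ (locallyIntegrableOn_of_continuousOn hQc.continuousOn) ?_
    · exact (locallyIntegrableOn_of_memLp hr).continuousOn_mul (by fun_prop)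
        isOpen_Ioi.isLocallyClosed
    · rintro ψ ⟨a, b, ha, hab, hψ⟩
      -- The weak equation is tested with the double primitive of ψ that vanishes beyond b. It need
      -- not vanish near 0, but F and Q do at 0, so no boundary terms survive and √p r is identified
      -- with Q with no affine correction.
      obtain ⟨φ₁, hφ₁, hb₁, hd₁⟩ := exists_primitive_of_eq_zero hψ.smooth hψ.right
      obtain ⟨φ, hφ, hb, hd⟩ := exists_primitive_of_eq_zero hφ₁ hb₁
      have hb0 : 0 ≤ b := (ha.trans hab).le
      have h3 := h1 φ b hφ hb
      have h4 : ∫ x in Ioi (0 : ℝ), (g₁ x - lam * w x) * φ x = ∫ x in Ioi (0 : ℝ), f x * φ x :=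
        setIntegral_congr_fun measurableSet_Ioi fun x hx => by
          simp only [hf, Set.indicator_of_mem hx]
      have e1 := integral_primitive_mul_deriv (c := 0) (by simp) (hfi 0 b) hφ
      have e2 := integral_primitive_mul_deriv (c := 0) (by simp) (hFc.intervalIntegrable 0 b) hφ₁
      rw [hd, hb b le_rfl] at e1
      rw [hd₁, hb₁ b le_rfl] at e2
      simp only [intervalIntegral.integral_same, zero_mul, mul_zero, sub_zero, zero_sub] at e1 e2
      rw [hd, hd₁, h4, setIntegral_eq_intervalIntegral_of_eq_zero hb0
        (fun x hx => by rw [hb x hx, mul_zero])] at h3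
      have e3 : pair Q ψ = ∫ x in (0 : ℝ)..b, Q x * ψ x :=
        setIntegral_eq_intervalIntegral_of_eq_zero hb0 fun x hx => by rw [hψ.right x hx, mul_zero]
      rw [e3, e2, e1, neg_neg, h3]
      exact pair_congr fun x _ => by ring
  set h : ℝ → ℝ := fun x => Q x / (x ^ 3 + x ^ 2) with hh
  have hh0 : ∀ x ≤ 0, h x = 0 := fun x hx => by simp [hh, hQ0 x hx]
  have hhc : ContinuousOn h (Ioi 0) :=
    hQc.continuousOn.div (by fun_prop) fun x hx => (hp0 x hx).ne'
  -- Since Q = O(x^{3/2}) at 0 and p ≥ x², the quotient is O(x^{-1/2}), hence integrable up to the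
  -- boundary. This makes the derivative of W continuous at 0.
  have hhi : ∀ a b, IntervalIntegrable h volume a b := fun a b => by
    refine IntervalIntegrable.mono_fun
      ((intervalIntegral.intervalIntegrable_rpow' (r := -(1 / 2)) (by norm_num)).const_mul C) ?_ ?_
    · exact (hQc.measurable.div (by fun_prop)).aestronglyMeasurable
    · refine Eventually.of_forall fun x => ?_
      simp only [Real.norm_eq_abs]
      rcases le_or_gt x 0 with hx | hx
      · rw [hh0 x hx, abs_zero]; exact abs_nonneg _
      · rw [abs_of_nonneg (by positivity : 0 ≤ C * x ^ (-(1 / 2) : ℝ)), hh]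
        simp only
        rw [abs_div, abs_of_pos (hp0 x hx), div_le_iff₀ (hp0 x hx), Real.rpow_neg hx.le,
          ← Real.sqrt_eq_rpow]
        refine (hQC x hx.le).trans ?_
        have hs : 0 < √x := Real.sqrt_pos.2 hx
        have hss : √x * √x = x := Real.mul_self_sqrt hx.le
        have : C * (√x)⁻¹ * (x ^ 3 + x ^ 2) = C * √x * x + C * (√x)⁻¹ * x ^ 3 := by
          have : (√x)⁻¹ * x ^ 2 = √x * x := by
            rw [inv_mul_eq_iff_eq_mul₀ hs.ne']; linear_combination (-x) * hss
          linear_combination C * this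
        rw [this]
        have : 0 ≤ C * (√x)⁻¹ * x ^ 3 := by positivity
        linarith
  have hwh : ∀ ψ, IsTest ψ → pair w (deriv (deriv ψ)) = pair h ψ := fun ψ hψ => by
    rw [h2 ψ hψ]
    refine pair_congr_ae ?_
    filter_upwards [hrQ, ae_restrict_mem measurableSet_Ioi] with x hx hx0
    have hs : √(x ^ 3 + x ^ 2) * √(x ^ 3 + x ^ 2) = x ^ 3 + x ^ 2 :=
      Real.mul_self_sqrt (hp0 x hx0).le
    have hs0 : √(x ^ 3 + x ^ 2) ≠ 0 := (Real.sqrt_pos.2 (hp0 x hx0)).ne'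
    simp only [hh]
    rw [← hx]
    have hp := (hp0 x hx0).ne'
    rw [eq_div_iff hp]
    nth_rewrite 2 [← hs]
    generalize √(x ^ 3 + x ^ 2) = y at hs0
    field_simp
  -- recover `w` from its second derivative
  set H : ℝ → ℝ := fun x => ∫ t in (0 : ℝ)..x, h t with hH
  have hHc : Continuous H := intervalIntegral.continuous_primitive hhi 0
  have hHd : ∀ x, 0 < x → HasDerivAt H (h x) x := fun x hx =>
    intervalIntegral.integral_hasDerivAt_right (hhi 0 x)
      (hhc.stronglyMeasurableAtFilter isOpen_Ioi x hx) (hhc.continuousAt (Ioi_mem_nhds hx))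
  set V : ℝ → ℝ := fun x => ∫ t in (0 : ℝ)..x, H t with hV
  have hVd : ∀ x, HasDerivAt V (H x) x := fun x => hasDerivAt_primitive_of_continuous hHc 0 x
  have hVl : LocallyIntegrableOn V (Ioi 0) := locallyIntegrableOn_of_continuousOn
    fun x _ => (hVd x).continuousAt.continuousWithinAt
  obtain ⟨P, hP, hPe⟩ := exists_polynomial_ae_eq 2 ((locallyIntegrableOn_of_memLp hw).sub hVl)
    fun ψ hψ => by
      refine (pair_sub_left (locallyIntegrableOn_of_memLp hw) hVl (hψ.iterate_deriv 2)).trans ?_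
      change pair w (deriv (deriv ψ)) - pair V (deriv (deriv ψ)) = 0
      rw [hwh ψ hψ, pair_deriv (fun x _ => hVd x) hHc.continuousOn hψ.deriv,
        pair_deriv hHd hhc hψ]
      ring
  obtain ⟨A, B, hAB⟩ := Polynomial.exists_eval_eq_affine hP
  have hWw : w =ᵐ[volume.restrict (Ioi 0)] fun x => A + B * x + V x := by
    filter_upwards [hPe] with x hx
    rw [← hAB, ← hx]; simp
  refine ⟨fun x => A + B * x + V x, fun x => B + H x, by fun_prop, (memLp_congr_ae hWw).1 hw,
    fun x => ?_, fun x hx => ?_⟩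
  · convert! (((hasDerivAt_id x).const_mul B).const_add A).add (hVd x) using 1
    simp
  · have e1 : ∀ t, 0 ≤ t → ∫ s in (0 : ℝ)..t, (g₁ s - lam * (A + B * s + V s)) = F t := fun t ht => by
      rw [hF]
      simp only
      rw [intervalIntegral.integral_of_le ht, intervalIntegral.integral_of_le ht]
      refine integral_congr_ae ?_
      have hsub : Ioc 0 t ⊆ Ioi (0 : ℝ) := fun y hy => hy.1
      filter_upwards [ae_restrict_of_ae_restrict_of_subset hsub hWw,
        ae_restrict_mem measurableSet_Ioc] with s hs hs'
      rw [hf, Set.indicator_of_mem (show s ∈ Ioi 0 from hs'.1), hs]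
    have e2 : ∫ t in (0 : ℝ)..x, ∫ s in (0 : ℝ)..t, (g₁ s - lam * (A + B * s + V s)) = Q x :=
      intervalIntegral.integral_congr fun t ht => by
        rw [uIcc_of_le hx.le] at ht
        exact e1 t ht.1
    rw [e2]
    exact (hHd x hx).const_add B

/-! ### Boundary regularity and the smooth decaying solution. -/

theorem memLp_two_of_isBigO {f : ℝ → ℝ} (hf : ContinuousOn f (Ici 0))
    (hO : f =O[atTop] fun x : ℝ => (x ^ 1)⁻¹) : MemLp f 2 (volume.restrict (Ioi (0 : ℝ))) := by
  have hm : AEStronglyMeasurable f (volume.restrict (Ioi (0 : ℝ))) :=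
    (hf.mono Ioi_subset_Ici_self).aestronglyMeasurable measurableSet_Ioi
  rw [memLp_two_iff_integrable_sq hm]
  have h1 : LocallyIntegrableOn (fun x => f x ^ 2) (Ici 0) :=
    (hf.pow 2).locallyIntegrableOn measurableSet_Ici
  have h2 : (fun x => f x ^ 2) =O[atTop] fun x : ℝ => x ^ (-2 : ℝ) := by
    refine (hO.pow 2).congr' (by rfl) ?_
    filter_upwards [eventually_ge_atTop 0] with x hx
    rw [Real.rpow_neg hx, pow_one, inv_pow]
    norm_num
  exact (h1.integrableOn_of_isBigO_atTop h2
    (integrableAtFilter_rpow_atTop_iff.2 (by norm_num))).mono_set Ioi_subset_Ici_self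

theorem HasSubcriticalDecay.exists_abs_le {lam : ℝ} (hlam : 0 < lam) {f : ℝ → ℝ}
    (h : HasSubcriticalDecay lam f) (hf : ContinuousOn f (Ici 0)) :
    ∃ C, ∀ x, 0 ≤ x → |f x| ≤ C := by
  obtain ⟨C, hC⟩ := (h.isBigO_inv_pow hlam 0).bound
  obtain ⟨R, hR⟩ := eventually_atTop.1 hC
  obtain ⟨C', hC'⟩ := (isCompact_Icc (a := (0 : ℝ)) (b := R)).exists_bound_of_continuousOn
    (hf.mono fun x hx => hx.1)
  refine ⟨max C C', fun x hx => ?_⟩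
  rcases le_total R x with h | h
  · have := hR x h
    simp only [pow_zero, inv_one, norm_one, mul_one] at this
    exact this.trans (le_max_left _ _)
  · exact (hC' x ⟨hx, h⟩).trans (le_max_right _ _)

theorem HasSubcriticalDecay.exists_le_mul_sq {lam : ℝ} (hlam : 0 < lam) {f : ℝ → ℝ}
    (h : HasSubcriticalDecay lam f) (hf : ContinuousOn f (Ici 0)) :
    ∃ C, ∀ x, 1 ≤ x → |f x| ≤ C * x ^ 2 := by
  obtain ⟨C, hC⟩ := h.exists_abs_le hlam hf
  exact ⟨C, fun x hx => (hC x (by linarith)).trans (le_mul_of_one_le_right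
    ((abs_nonneg _).trans (hC 0 le_rfl)) (one_le_pow₀ hx))⟩

theorem contDiffOn_infty_derivWithin_Ici {g : ℝ → ℝ} (hg : ContDiffOn ℝ ∞ g (Ici 0)) :
    (∀ x, 0 ≤ x → HasDerivWithinAt g (derivWithin g (Ici 0) x) (Ici 0) x) ∧
      ContDiffOn ℝ ∞ (derivWithin g (Ici 0)) (Ici 0) := by
  obtain ⟨h1, h2⟩ := (contDiffOn_infty_iff_derivWithin (uniqueDiffOn_Ici 0)).1 hg
  exact ⟨fun x hx => (h1 x hx).hasDerivWithinAt, h2⟩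

/-- Solutions of the integrated equation are smooth up to the boundary. -/
theorem contDiffOn_of_integrated_equation {lam : ℝ} {g₁ W W' : ℝ → ℝ}
    (hg₁ : ContDiffOn ℝ ∞ g₁ (Ici 0)) (hW' : Continuous W') (hW : ∀ x, HasDerivAt W (W' x) x)
    (h : ∀ x, 0 < x → HasDerivAt W'
        ((∫ t in (0 : ℝ)..x, ∫ s in (0 : ℝ)..t, (g₁ s - lam * W s)) / (x ^ 3 + x ^ 2)) x) :
    ContDiffOn ℝ ∞ W (Ici 0) := by
  set f : ℝ → ℝ := fun x => g₁ x - lam * W x with hf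
  -- This is W'' with the factor x² of the double primitive cancelled against p = x² (1 + x); it is
  -- as smooth up to 0 as W itself.
  set k : ℝ → ℝ := fun x => (1 + x)⁻¹ * powAverage 1 (powAverage 0 f) x with hk
  have hinv : ContDiffOn ℝ ∞ (fun x : ℝ => (1 + x)⁻¹) (Ici 0) :=
    ContDiffOn.inv (by fun_prop) fun x hx => by have := mem_Ici.1 hx; positivity
  have hkn : ∀ n : ℕ, ContDiffOn ℝ n W (Ici 0) → ContDiffOn ℝ n k (Ici 0) := fun n hn =>
    (hinv.of_le (by exact_mod_cast le_top)).mul (contDiffOn_powAverage n 1 (contDiffOn_powAverage n 0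
      ((hg₁.of_le (by exact_mod_cast le_top)).sub (contDiffOn_const.mul hn))))
  have hWc : Continuous W := continuous_iff_continuousAt.2 fun x => (hW x).continuousAt
  have hd : ∀ x, 0 < x → HasDerivAt W' (k x) x := fun x hx => by
    convert! h x hx using 1
    rw [primitive_primitive_eq]
    change (1 + x)⁻¹ * powAverage 1 (powAverage 0 f) x =
      x ^ 2 * powAverage 1 (powAverage 0 f) x / (x ^ 3 + x ^ 2)
    field_simp
    ring
  have hkc : ContinuousOn k (Ici 0) := by
    have := hkn 0 (by simpa using hWc.continuousOn)
    simpa using this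
  have hd' : ∀ x, 0 ≤ x → HasDerivWithinAt W' (k x) (Ici 0) x := fun x hx => by
    rcases hx.eq_or_lt with rfl | hx
    -- At 0 the equation is not available; the one-sided derivative is the limit of the derivatives
    -- from the right.
    · refine hasDerivWithinAt_Ici_of_tendsto_deriv (s := Ioi 0)
        (fun x hx => (hd x hx).differentiableAt.differentiableWithinAt)
        hW'.continuousWithinAt self_mem_nhdsWithin ?_
      have h1 : Tendsto k (𝓝[>] 0) (𝓝 (k 0)) :=
        (hkc 0 self_mem_Ici).mono_left (nhdsWithin_mono _ Ioi_subset_Ici_self)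
      refine h1.congr' ?_
      filter_upwards [self_mem_nhdsWithin] with x hx using (hd x hx).deriv.symm
    · exact (hd x hx).hasDerivWithinAt
  refine contDiffOn_infty.2 fun n => ?_
  induction n with
  | zero => simpa using hWc.continuousOn
  | succ n ih =>
    -- Bootstrap: if W is of class Cⁿ, so is k = W'', hence W' is of class Cⁿ⁺¹, more than is
    -- needed.
    refine contDiffOn_Ici_succ_of_hasDerivWithinAt (fun x _ => (hW x).hasDerivWithinAt) ?_
    exact (contDiffOn_Ici_succ_of_hasDerivWithinAt hd' (hkn n ih)).of_le (by norm_cast; omega)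

/-- The energy solution W for the datum g' is integrated from 0 to give u, which has the right
boundary value by construction. The L² bound on W controls the growth of u, so the decay theorem
applies. -/
theorem exists_smooth_solution {lam : ℝ} (hlam : 0 < lam) {g : ℝ → ℝ}
    (hg : ContDiffOn ℝ ∞ g (Ici 0)) (hg0 : g 0 = 0)
    (hgd : ∀ j, HasSubcriticalDecay lam (iteratedDeriv j g)) :
    ∃ u u₁ u₂ q : ℝ → ℝ, ResolventSystem lam g u u₁ u₂ q ∧ ContDiffOn ℝ ∞ u (Ici 0) ∧ u 0 = 0 ∧
      (∀ x, HasDerivAt u (u₁ x) x) ∧ (∀ x, HasDerivAt u₁ (u₂ x) x) ∧ Continuous u₂ ∧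
      HasSubcriticalDecay lam u ∧ HasSubcriticalDecay lam u₁ ∧ HasSubcriticalDecay lam u₂ ∧
      HasSubcriticalDecay lam q := by
  obtain ⟨hgD, hg₁⟩ := contDiffOn_infty_derivWithin_Ici hg
  set g₁ := derivWithin g (Ici 0) with hg₁def
  have hgd₁ : HasSubcriticalDecay lam g₁ := (hgd 1).congr fun x hx => by
    rw [iteratedDeriv_one, hg₁def, derivWithin_of_mem_nhds (Ici_mem_nhds hx)]
  obtain ⟨W, W', hW'c, hWm, hW, hW'⟩ := exists_regular_energy_solution hlam
    (memLp_two_of_isBigO hg₁.continuousOn (hgd₁.isBigO_inv_pow hlam 1))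
  have hWs := contDiffOn_of_integrated_equation hg₁ hW'c hW hW'
  have hWc : Continuous W := continuous_iff_continuousAt.2 fun x => (hW x).continuousAt
  set u : ℝ → ℝ := fun x => ∫ t in (0 : ℝ)..x, W t with hu
  have hud : ∀ x, HasDerivAt u (W x) x := fun x => hasDerivAt_primitive_of_continuous hWc 0 x
  have huc : Continuous u := continuous_iff_continuousAt.2 fun x => (hud x).continuousAt
  have hu0 : u 0 = 0 := by simp [hu]
  set q : ℝ → ℝ := fun x => ∫ t in (0 : ℝ)..x, (g t - lam * u t) with hq
  -- Here g(0) = 0 enters: together with u(0) = 0 it removes the integration constant, so that u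
  -- solves the original equation and not merely its derivative.
  have hint : ∀ t, 0 ≤ t → ∫ s in (0 : ℝ)..t, (g₁ s - lam * W s) = g t - lam * u t := fun t ht => by
    have hfd : ∀ x, 0 ≤ x → HasDerivWithinAt (fun x => g x - lam * u x) (g₁ x - lam * W x) (Ici 0) x :=
      fun x hx => (hgD x hx).sub ((hud x).hasDerivWithinAt.const_mul lam)
    rw [integral_hasDerivWithinAt_eq_sub hfd
      (hg₁.continuousOn.sub (hWc.const_mul lam).continuousOn) ht, hg0, hu0]
    ring
  have hqx : ∀ x, 0 < x → ∫ t in (0 : ℝ)..x, ∫ s in (0 : ℝ)..t, (g₁ s - lam * W s) = q x :=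
    fun x hx => intervalIntegral.integral_congr fun t ht => by
      rw [uIcc_of_le hx.le] at ht
      exact hint t ht.1
  have hsys : ResolventSystem lam g u W W' q := by
    refine ⟨fun x _ => hud x, fun x _ => hW x, fun x hx => ?_, fun x hx => ?_⟩
    · rw [← hqx x hx]; exact hW' x hx
    · exact (hasDerivWithinAt_primitive (hg.continuousOn.sub (huc.const_mul lam).continuousOn)
        hx.le).hasDerivAt (Ici_mem_nhds hx)
  have huS : ContDiffOn ℝ ∞ u (Ici 0) := contDiffOn_infty.2 fun n =>
    (contDiffOn_primitive (contDiffOn_infty.1 hWs n)).of_le (by norm_cast; omega)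
  obtain ⟨C, hC0, hC⟩ := exists_abs_primitive_le_sqrt hWm
  -- As a primitive of an L² function, u is O(√x), which is more than the growth bound requires.
  have hug : ∃ C, ∀ x, 1 ≤ x → |u x| ≤ C * x ^ 2 := ⟨C, fun x hx => by
    refine (hC x (by linarith)).trans (mul_le_mul_of_nonneg_left ?_ hC0)
    refine (Real.sqrt_le_sqrt (le_self_pow₀ hx (by norm_num : 4 ≠ 0))).trans ?_
    rw [show x ^ 4 = (x ^ 2) ^ 2 by ring, Real.sqrt_sq (by positivity)]⟩
  have hg0' : HasSubcriticalDecay lam g := by simpa using hgd 0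
  obtain ⟨d₀, d₁, d₂, d₃⟩ := hsys.hasSubcriticalDecay hlam hg0'
    (hg0'.exists_le_mul_sq hlam hg.continuousOn) hug
  exact ⟨u, W, W', q, hsys, huS, hu0, hud, hW, hW'c, d₀, d₁, d₂, d₃⟩

/-! ### Weak formulation and membership in the solution class. -/

theorem IsTest.flux {φ : ℝ → ℝ} (hφ : IsTest φ) :
    IsTest (fun y => (y ^ 3 + y ^ 2) * _root_.deriv φ y) :=
  hφ.deriv.mul_left (ContDiff.contDiffOn (by fun_prop))

theorem opAAdj_eq_iterate (φ : ℝ → ℝ) :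
    opAAdj φ = deriv^[3] (fun y => (y ^ 3 + y ^ 2) * deriv φ y) := by
  ext x; rw [opAAdj, iteratedDeriv_eq_iterate]

theorem IsTest.opAAdj {φ : ℝ → ℝ} (hφ : IsTest φ) : IsTest (_root_.opAAdj φ) := by
  rw [opAAdj_eq_iterate]; exact hφ.flux.iterate_deriv 3

theorem locallyIntegrableOn_const_mul {v : ℝ → ℝ} (hv : LocallyIntegrableOn v (Ioi 0)) (c : ℝ) :
    LocallyIntegrableOn (fun x => c * v x) (Ioi 0) :=
  hv.continuousOn_mul continuousOn_const isOpen_Ioi.isLocallyClosed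

theorem solvesResolvent_iff {lam : ℝ} {g v : ℝ → ℝ} (hg : LocallyIntegrableOn g (Ioi 0))
    (hv : LocallyIntegrableOn v (Ioi 0)) :
    SolvesResolvent lam g v ↔
      ∀ φ, IsTest φ → pair v (opAAdj φ) = pair (fun x => g x - lam * v x) φ := by
  have key : ∀ φ, IsTest φ → (∫ x in Ioi (0 : ℝ), v x * (lam * φ x + opAAdj φ x) =
      ∫ x in Ioi (0 : ℝ), g x * φ x ↔ pair v (opAAdj φ) = pair (fun x => g x - lam * v x) φ) := by
    intro φ hφ
    have h1 : ∫ x in Ioi (0 : ℝ), v x * (lam * φ x + opAAdj φ x) =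
        lam * pair v φ + pair v (opAAdj φ) := by
      unfold pair
      rw [← integral_const_mul, ← integral_add ((hφ.integrableOn_mul hv).const_mul lam)
        (hφ.opAAdj.integrableOn_mul hv)]
      congr 1 with x; ring
    rw [h1, pair_sub_left hg (locallyIntegrableOn_const_mul hv lam) hφ, pair_const_mul_left, eq_sub_iff_add_eq']
    rfl
  constructor
  · intro h φ hφ
    obtain ⟨φ', rfl⟩ := hφ.exists_testFunction
    exact (key _ hφ).1 (h φ')
  · intro h φ
    exact (key _ (.of_testFunction φ)).2 (h _ (.of_testFunction φ))

theorem ResolventSystem.solvesResolvent {lam : ℝ} {g u u₁ u₂ q : ℝ → ℝ}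
    (h : ResolventSystem lam g u u₁ u₂ q) (hg : ContinuousOn g (Ioi 0)) :
    SolvesResolvent lam g u := by
  have hc : ∀ {f f' : ℝ → ℝ}, (∀ x, 0 < x → HasDerivAt f (f' x) x) → ContinuousOn f (Ioi 0) :=
    fun hf x hx => (hf x hx).continuousAt.continuousWithinAt
  have hu := hc h.hasDerivAt
  refine (solvesResolvent_iff (locallyIntegrableOn_of_continuousOn hg)
    (locallyIntegrableOn_of_continuousOn hu)).2 fun φ hφ => ?_
  have hq3 : ContinuousOn (fun x => q x / (x ^ 3 + x ^ 2)) (Ioi 0) :=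
    (hc h.hasDerivAt_flux).div (by fun_prop) fun x hx => by have := mem_Ioi.1 hx; positivity
  rw [opAAdj_eq_iterate]
  change pair u (deriv (deriv (deriv _))) = _
  rw [pair_deriv h.hasDerivAt (hc h.hasDerivAt₁) hφ.flux.deriv.deriv,
    pair_deriv h.hasDerivAt₁ (hc h.hasDerivAt₂) hφ.flux.deriv,
    pair_deriv h.hasDerivAt₂ hq3 hφ.flux, neg_neg]
  have h1 : pair (fun x => q x / (x ^ 3 + x ^ 2)) (fun y => (y ^ 3 + y ^ 2) * deriv φ y) =
      pair q (deriv φ) := pair_congr fun x hx => by field_simp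
  rw [h1, pair_deriv h.hasDerivAt_flux (hg.sub (hu.const_mul lam)) hφ, neg_neg]

theorem isWeakEuler_of_hasDerivAt (γ : ℝ) {f f' : ℝ → ℝ} (hf : ∀ x, 0 < x → HasDerivAt f (f' x) x)
    (hf' : ContinuousOn f' (Ioi 0)) : IsWeakEuler γ f (fun x => x * f' x - γ * f x) := by
  have hfc : ContinuousOn f (Ioi 0) := fun x hx => (hf x hx).continuousAt.continuousWithinAt
  have hxf : ContinuousOn (fun x => x * f' x) (Ioi 0) := continuousOn_id.mul hf'
  refine ⟨locallyIntegrableOn_of_continuousOn (hxf.sub (hfc.const_mul γ)), fun φ' => ?_⟩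
  have hφ := IsTest.of_testFunction φ'
  generalize (φ' : ℝ → ℝ) = φ at hφ
  have hyφ : IsTest (fun y => y * φ y) := hφ.mul_left contDiffOn_id
  have h1 : ∫ x in Ioi (0 : ℝ), f x * (deriv (fun y => y * φ y) x + γ * φ x) =
      pair f (deriv fun y => y * φ y) + γ * pair f φ := by
    have hfl := locallyIntegrableOn_of_continuousOn hfc
    unfold pair
    rw [← integral_const_mul, ← integral_add (hyφ.deriv.integrableOn_mul hfl)
      ((hφ.integrableOn_mul hfl).const_mul γ)]
    congr 1 with x; ring
  have h2 := pair_sub_left (locallyIntegrableOn_of_continuousOn hxf)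
    (locallyIntegrableOn_of_continuousOn (hfc.const_mul γ)) hφ
  rw [h1, pair_deriv hf hf' hyφ]
  refine h2.trans ?_
  rw [pair_const_mul_left, pair_congr (f₁ := fun x => x * f' x) (f₂ := f') (ψ := fun y => y * φ y)
    (fun x _ => by ring)]
  ring

theorem wNormSq_lt_top {α C : ℝ} {f : ℝ → ℝ}
    (h₀ : ∀ x, 0 < x → x ≤ 1 → x ^ (-2 * α) * f x ^ 2 / x ≤ C)
    (h₁ : ∀ x, 1 < x → x ^ (-2 * α) * f x ^ 2 / x ≤ C * x ^ (-2 : ℝ)) : wNormSq α f < ⊤ := by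
  rw [wNormSq, ← Ioc_union_Ioi_eq_Ioi (zero_le_one' ℝ)]
  refine (lintegral_union_le _ _ _).trans_lt (ENNReal.add_lt_top.2 ⟨?_, ?_⟩)
  · refine (setLIntegral_mono measurable_const fun x hx =>
      ENNReal.ofReal_le_ofReal (h₀ x hx.1 hx.2)).trans_lt ?_
    simp
  · refine (setLIntegral_mono (by fun_prop) fun x hx =>
      ENNReal.ofReal_le_ofReal (h₁ x hx)).trans_lt ?_
    exact ((integrableOn_Ioi_rpow_of_lt (by norm_num) zero_lt_one).const_mul C).lintegral_lt_top

theorem wNormSq_half_lt_top {C : ℝ} {f : ℝ → ℝ} (h₀ : ∀ x, 0 < x → x ≤ 1 → |f x| ≤ C * x)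
    (h₁ : ∀ x, 1 < x → |f x| ≤ C) : wNormSq (1 / 2) f < ⊤ := by
  have hr : ∀ x : ℝ, 0 < x → x ^ (-2 * (1 / 2) : ℝ) = x⁻¹ := fun x hx => by
    rw [show (-2 * (1 / 2) : ℝ) = -1 by norm_num, Real.rpow_neg_one]
  refine wNormSq_lt_top (C := C ^ 2) (fun x hx hx1 => ?_) fun x hx => ?_
  · rw [hr x hx, div_le_iff₀ hx, inv_mul_le_iff₀ hx, ← sq_abs]
    calc |f x| ^ 2 ≤ (C * x) ^ 2 := by gcongr; exact h₀ x hx hx1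
      _ = _ := by ring
  · have hx0 : 0 < x := by linarith
    rw [hr x hx0, div_le_iff₀ hx0, inv_mul_le_iff₀ hx0, ← sq_abs, Real.rpow_neg hx0.le]
    calc |f x| ^ 2 ≤ C ^ 2 := by gcongr; exact h₁ x hx
      _ = _ := by norm_num; field_simp

theorem wNormSq_one_lt_top {C : ℝ} {f : ℝ → ℝ} (h₀ : ∀ x, 0 < x → x ≤ 1 → |f x| ≤ C * x ^ 2)
    (h₁ : ∀ x, 1 < x → |f x| ≤ C) : wNormSq 1 f < ⊤ := by
  have hr : ∀ x : ℝ, 0 < x → x ^ (-2 * 1 : ℝ) = (x ^ 2)⁻¹ := fun x hx => by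
    rw [show (-2 * 1 : ℝ) = -(2 : ℕ) by norm_num, Real.rpow_neg hx.le, Real.rpow_natCast]
  refine wNormSq_lt_top (C := C ^ 2) (fun x hx hx1 => ?_) fun x hx => ?_
  · rw [hr x hx, div_le_iff₀ hx, inv_mul_le_iff₀ (by positivity), ← sq_abs]
    calc |f x| ^ 2 ≤ (C * x ^ 2) ^ 2 := by gcongr; exact h₀ x hx hx1
      _ = x ^ 2 * (C ^ 2 * x) * x := by ring
      _ ≤ x ^ 2 * (C ^ 2 * x) * 1 := by gcongr
      _ ≤ _ := by rw [mul_one]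
  · have hx0 : 0 < x := by linarith
    rw [hr x hx0, div_le_iff₀ hx0, inv_mul_le_iff₀ (by positivity), ← sq_abs, Real.rpow_neg hx0.le]
    calc |f x| ^ 2 ≤ C ^ 2 * 1 := by rw [mul_one]; gcongr; exact h₁ x hx
      _ ≤ C ^ 2 * x := by gcongr
      _ = _ := by norm_num; field_simp

theorem abs_le_mul_pow_of_deriv {f f' : ℝ → ℝ} {C : ℝ} {k : ℕ} (hC : 0 ≤ C)
    (hf : ∀ x, HasDerivAt f (f' x) x)
    (h0 : f 0 = 0) (hf' : ∀ x, 0 ≤ x → |f' x| ≤ C * x ^ k) (x : ℝ) (hx : 0 ≤ x) :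
    |f x| ≤ C * x ^ (k + 1) := by
  have h1 := Convex.norm_image_sub_le_of_norm_hasDerivWithin_le (f := f) (f' := f')
    (C := C * x ^ k) (s := Icc 0 x)
    (fun y hy => (hf y).hasDerivWithinAt)
    (fun y hy => (hf' y hy.1).trans (by gcongr; exacts [hy.1, hy.2])) (convex_Icc 0 x)
    (left_mem_Icc.2 hx) (right_mem_Icc.2 hx)
  rw [h0, sub_zero, sub_zero, Real.norm_eq_abs, Real.norm_eq_abs, abs_of_nonneg hx] at h1
  rwa [pow_succ, ← mul_assoc]

/-- Decaying classical solutions vanishing at the boundary belong to the solution class. -/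
theorem ResolventSystem.isResolventSolution {lam : ℝ} (hlam : 0 < lam) {g u u₁ u₂ q : ℝ → ℝ}
    (h : ResolventSystem lam g u u₁ u₂ q) (hg : ContinuousOn g (Ioi 0)) (hu0 : u 0 = 0)
    (hu : ∀ x, HasDerivAt u (u₁ x) x) (hu₁ : ∀ x, HasDerivAt u₁ (u₂ x) x) (hu₂ : Continuous u₂)
    (d₀ : HasSubcriticalDecay lam u) (d₁ : HasSubcriticalDecay lam u₁)
    (d₂ : HasSubcriticalDecay lam u₂) : IsResolventSolution lam g u := by
  have cu : Continuous u := continuous_iff_continuousAt.2 fun x => (hu x).continuousAt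
  have cu₁ : Continuous u₁ := continuous_iff_continuousAt.2 fun x => (hu₁ x).continuousAt
  have hmul : ∀ {f : ℝ → ℝ} (k : ℕ), HasSubcriticalDecay lam f → Continuous f →
      ∃ C, 0 ≤ C ∧ ∀ x, 0 ≤ x → |x ^ k * f x| ≤ C := fun k hf hc => by
    obtain ⟨C, hC⟩ := (hf.mul_isBigO hlam (isBigO_refl (fun x : ℝ => x ^ k) atTop)).exists_abs_le
      hlam ((by fun_prop : Continuous fun x : ℝ => x ^ k).mul hc).continuousOn
    exact ⟨C, (abs_nonneg _).trans (hC 0 le_rfl), hC⟩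
  have hbd : ∀ {f : ℝ → ℝ}, HasSubcriticalDecay lam f → Continuous f →
      ∃ C, 0 ≤ C ∧ ∀ x, 0 ≤ x → |f x| ≤ C := fun hf hc => by simpa using hmul 0 hf hc
  obtain ⟨A₀, hA₀, bu⟩ := hbd d₀ cu
  obtain ⟨A₁, hA₁, bu₁⟩ := hbd d₁ cu₁
  obtain ⟨A₂, hA₂, bu₂⟩ := hbd d₂ hu₂
  obtain ⟨B₁, hB₁, bxu₁⟩ := hmul 1 d₁ cu₁
  obtain ⟨B₂, hB₂, bxu₂⟩ := hmul 2 d₂ hu₂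
  simp only [pow_one] at bxu₁
  have zu : ∀ x, 0 ≤ x → |u x| ≤ A₁ * x ^ 1 :=
    abs_le_mul_pow_of_deriv (k := 0) hA₁ hu hu0 (by simpa using bu₁)
  set k : ℝ → ℝ := fun x => x * u₁ x - 1 * u x with hk
  -- In the derivative of k = (D-1)u the first order terms cancel, leaving x u''. With k(0) = 0 this
  -- gives k = O(x²) at 0, as the weight of |·|₁ demands.
  have hkd : ∀ x, HasDerivAt k (x * u₂ x) x := fun x => by
    convert! ((hasDerivAt_id x).mul (hu₁ x)).sub ((hu x).const_mul 1) using 1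
    simp
  have ck : Continuous k := continuous_iff_continuousAt.2 fun x => (hkd x).continuousAt
  have zk : ∀ x, 0 ≤ x → |k x| ≤ A₂ * x ^ 2 :=
    abs_le_mul_pow_of_deriv (k := 1) hA₂ hkd (by simp [hk, hu0]) fun x hx => by
      rw [abs_mul, abs_of_nonneg hx, pow_one, mul_comm]; gcongr; exact bu₂ x hx
  have bk : ∀ x, 0 ≤ x → |k x| ≤ B₁ + A₀ := fun x hx => by
    refine (abs_sub _ _).trans (add_le_add (bxu₁ x hx) ?_)
    rw [one_mul]; exact bu x hx
  -- The vanishing term 0 * u keeps the shape produced by `isWeakEuler_of_hasDerivAt` for γ = 0.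
  set w₁ : ℝ → ℝ := fun x => x * u₁ x - 0 * u x with hw₁
  set w₂ : ℝ → ℝ := fun x => x * (u₁ x + x * u₂ x) - 0 * w₁ x with hw₂
  have hw₁d : ∀ x, HasDerivAt w₁ (u₁ x + x * u₂ x) x := fun x => by
    convert! ((hasDerivAt_id x).mul (hu₁ x)).sub ((hu x).const_mul 0) using 1
    simp
  refine ⟨locallyIntegrableOn_of_continuousOn cu.continuousOn, h.solvesResolvent hg, ?_, ?_, ?_⟩
  -- Only the entries with index at most 2 matter; beyond that the value is arbitrary.
  · let w : ℕ → ℝ → ℝ := fun j => if j = 0 then u else if j = 1 then w₁ else w₂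
    have hw : w 0 = u ∧ ∀ j < 2, IsWeakEuler 0 (w j) (w (j + 1)) := by
      refine ⟨rfl, fun j hj => ?_⟩
      interval_cases j
      · exact isWeakEuler_of_hasDerivAt 0 (fun x _ => hu x) cu₁.continuousOn
      · exact isWeakEuler_of_hasDerivAt 0 (fun x _ => hw₁d x) (by fun_prop)
    refine (iInf₂_le w hw).trans_lt ?_
    · refine ENNReal.rpow_lt_top_of_nonneg (by norm_num) (ENNReal.sum_lt_top.2 fun j hj => ?_).ne
      have hj3 : j < 3 := by simpa using hj
      interval_cases j
      · refine wNormSq_half_lt_top (C := A₁ + A₀) (fun x hx _ => ?_) fun x hx => ?_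
        · refine (zu x hx.le).trans ?_
          rw [pow_one]; gcongr; linarith
        · exact (bu x (by linarith)).trans (by linarith)
      · change wNormSq (1 / 2) w₁ < ⊤
        refine wNormSq_half_lt_top (C := A₁ + B₁) (fun x hx _ => ?_) fun x hx => ?_
        · simp only [hw₁, zero_mul, sub_zero]
          rw [abs_mul, abs_of_pos hx, mul_comm]; gcongr
          exact (bu₁ x hx.le).trans (by linarith)
        · simp only [hw₁, zero_mul, sub_zero]
          exact (bxu₁ x (by linarith)).trans (by linarith)
      · change wNormSq (1 / 2) w₂ < ⊤
        refine wNormSq_half_lt_top (C := A₁ + A₂ + B₁ + B₂) (fun x hx hx1 => ?_) fun x hx => ?_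
        · simp only [hw₂, zero_mul, sub_zero]
          rw [abs_mul, abs_of_pos hx, mul_comm]; gcongr
          refine (abs_add_le _ _).trans ?_
          have e1 := bu₁ x hx.le
          have e2 : |x * u₂ x| ≤ 1 * A₂ := by
            rw [abs_mul, abs_of_pos hx]; gcongr; exact bu₂ x hx.le
          linarith
        · simp only [hw₂, zero_mul, sub_zero]
          have e1 := bxu₁ x (by linarith)
          have e2 := bxu₂ x (by linarith)
          rw [show x * (u₁ x + x * u₂ x) = x * u₁ x + x ^ 2 * u₂ x by ring]
          have := abs_add_le (x * u₁ x) (x ^ 2 * u₂ x)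
          linarith
  · refine ⟨k, fun x => x * (x * u₂ x) - 1 * k x,
      isWeakEuler_of_hasDerivAt 1 (fun x _ => hu x) cu₁.continuousOn,
      isWeakEuler_of_hasDerivAt 1 (fun x _ => hkd x) (by fun_prop),
      ENNReal.rpow_lt_top_of_nonneg (by norm_num) (LT.lt.ne ?_),
      ENNReal.rpow_lt_top_of_nonneg (by norm_num) (LT.lt.ne ?_)⟩
    · refine wNormSq_one_lt_top (C := A₂ + (B₁ + A₀)) (fun x hx _ => ?_) fun x hx => ?_
      · refine (zk x hx.le).trans ?_
        gcongr; linarith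
      · exact (bk x (by linarith)).trans (by linarith)
    · refine wNormSq_one_lt_top (C := 2 * A₂ + (B₂ + (B₁ + A₀))) (fun x hx _ => ?_) fun x hx => ?_
      · have e1 := zk x hx.le
        have e2 : |x * (x * u₂ x)| ≤ x ^ 2 * A₂ := by
          rw [← mul_assoc, ← sq, abs_mul, abs_of_nonneg (sq_nonneg x)]; gcongr; exact bu₂ x hx.le
        have e3 : 0 ≤ (B₂ + (B₁ + A₀)) * x ^ 2 := by positivity
        have := abs_sub (x * (x * u₂ x)) (1 * k x)
        rw [one_mul] at this ⊢
        linarith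
      · have e1 := bk x (by linarith)
        have e2 := bxu₂ x (by linarith)
        rw [show x ^ 2 * u₂ x = x * (x * u₂ x) by ring] at e2
        have := abs_sub (x * (x * u₂ x)) (1 * k x)
        rw [one_mul] at this ⊢
        linarith
  · have h1 : Tendsto u (𝓝[>] 0) (𝓝 0) := by
      have := cu.tendsto 0
      rw [hu0] at this
      exact this.mono_left nhdsWithin_le_nhds
    exact h1.mono_left inf_le_left

/-! ### Interior regularity of distributional solutions. -/

theorem continuousOn_primitive_Ioi {f : ℝ → ℝ} (hf : LocallyIntegrableOn f (Ioi 0)) {c : ℝ}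
    (hc : 0 < c) : ContinuousOn (fun x => ∫ t in c..x, f t) (Ioi 0) := by
  intro x hx
  have hx' : 0 < x := hx
  have ha : 0 < min c (x / 2) := lt_min hc (by linarith)
  have hb : max c (x + 1) > 0 := lt_max_of_lt_left hc
  have h1 := intervalIntegral.continuousOn_primitive_interval' (a := c)
    (hf.intervalIntegrable_of_pos ha hb)
    (mem_uIcc_of_le (min_le_left _ _) (le_max_left _ _))
  refine (h1.continuousAt ?_).continuousWithinAt
  rw [uIcc_of_le ((min_le_left _ _).trans (le_max_left _ _))]
  exact Icc_mem_nhds ((min_le_right _ _).trans_lt (by linarith))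
    (lt_of_lt_of_le (by linarith) (le_max_right _ _))

theorem hasDerivAt_primitive_Ioi {f : ℝ → ℝ} (hf : ContinuousOn f (Ioi 0)) {c x : ℝ}
    (hc : 0 < c) (hx : 0 < x) : HasDerivAt (fun x => ∫ t in c..x, f t) (f x) x :=
  intervalIntegral.integral_hasDerivAt_right
    ((locallyIntegrableOn_of_continuousOn hf).intervalIntegrable_of_pos hc hx)
    (hf.stronglyMeasurableAtFilter isOpen_Ioi x hx) (hf.continuousAt (Ioi_mem_nhds hx))

/-- Test functions χ with ∫ χ/p = 0 are exactly those of the form p φ' with φ a test function, and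
on these the equation prescribes the third derivative of v. The kernel lemma extends this to all χ
at the price of the constant c, the integration constant of the flux. -/
theorem exists_pair_iterate_deriv_three {lam : ℝ} {g v : ℝ → ℝ}
    (hg : LocallyIntegrableOn g (Ioi 0)) (hv : LocallyIntegrableOn v (Ioi 0))
    (h : SolvesResolvent lam g v) :
    ∃ c : ℝ, ∀ χ, IsTest χ → pair v (deriv^[3] χ) =
      - pair (fun x => ((∫ t in (1 : ℝ)..x, (g t - lam * v t)) - c) / (x ^ 3 + x ^ 2)) χ := by
  have hf : LocallyIntegrableOn (fun x => g x - lam * v x) (Ioi 0) :=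
    hg.sub (locallyIntegrableOn_const_mul hv lam)
  have hV := continuousOn_primitive_Ioi hf zero_lt_one
  set V : ℝ → ℝ := fun x => ∫ t in (1 : ℝ)..x, (g t - lam * v t)
  have hpne : ∀ x ∈ Ioi (0 : ℝ), x ^ 3 + x ^ 2 ≠ 0 := fun x hx => by
    have := mem_Ioi.1 hx; positivity
  have hVp : ContinuousOn (fun x => V x / (x ^ 3 + x ^ 2)) (Ioi 0) := hV.div (by fun_prop) hpne
  have hip : ContDiffOn ℝ ∞ (fun x : ℝ => 1 / (x ^ 3 + x ^ 2)) (Ioi 0) :=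
    contDiffOn_const.div (ContDiff.contDiffOn (by fun_prop)) hpne
  have hVl := locallyIntegrableOn_of_continuousOn hVp
  have hil := locallyIntegrableOn_of_continuousOn hip.continuousOn
  obtain ⟨c, hc⟩ := exists_eq_const_mul_of_ker_le
    (fun χ => pair v (deriv^[3] χ) + pair (fun x => V x / (x ^ 3 + x ^ 2)) χ)
    (pair fun x => 1 / (x ^ 3 + x ^ 2))
    (fun φ ψ c hφ hψ => by
      rw [iterate_deriv_sub_const_mul hφ hψ, pair_sub_const_mul hv (hφ.iterate_deriv 3)
        (hψ.iterate_deriv 3), pair_sub_const_mul hVl hφ hψ]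
      ring)
    (fun φ ψ c hφ hψ => pair_sub_const_mul hil hφ hψ c)
    (fun χ hχ h0 => by
      obtain ⟨φ, hφ, hφχ⟩ := (hχ.mul_left hip).exists_primitive
        (by rw [← h0]; exact pair_congr fun x _ => by simp)
      have e : χ = fun y => (y ^ 3 + y ^ 2) * deriv φ y := by
        ext y
        rw [hφχ]
        rcases lt_or_ge 0 y with hy | hy
        · field_simp
        · obtain ⟨a, b, ha, -, hab⟩ := hχ
          simp [hab.left y (hy.trans ha.le)]
      have h1 := (solvesResolvent_iff hg hv).1 h φ hφ
      rw [opAAdj_eq_iterate, ← e] at h1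
      have h2 := pair_primitive_deriv hf zero_lt_one hφ
      have h3 : pair (fun x => V x / (x ^ 3 + x ^ 2)) χ = pair V (deriv φ) := by
        rw [hφχ]; exact pair_congr fun x _ => by ring
      rw [h1, h3, h2]; ring)
  refine ⟨c, fun χ hχ => ?_⟩
  have h1 := pair_sub_left hVl
    (locallyIntegrableOn_const_mul hil c) hχ
  rw [pair_const_mul_left, ← hc χ hχ] at h1
  rw [pair_congr (f₁ := fun x => (V x - c) / (x ^ 3 + x ^ 2))
    (f₂ := fun x => V x / (x ^ 3 + x ^ 2) - c * (1 / (x ^ 3 + x ^ 2))) (ψ := χ)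
    (fun x _ => by ring), h1]
  ring

/-- Distributional solutions of the resolvent equation are classical. -/
theorem exists_resolventSystem {lam : ℝ} {g v : ℝ → ℝ} (hg : ContinuousOn g (Ioi 0))
    (hv : LocallyIntegrableOn v (Ioi 0)) (h : SolvesResolvent lam g v) :
    ∃ u u₁ u₂ q : ℝ → ℝ,
      ResolventSystem lam g u u₁ u₂ q ∧ v =ᵐ[volume.restrict (Ioi 0)] u := by
  have hgl := locallyIntegrableOn_of_continuousOn hg
  obtain ⟨c, hc⟩ := exists_pair_iterate_deriv_three hgl hv h
  have hf : LocallyIntegrableOn (fun x => g x - lam * v x) (Ioi 0) :=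
    hgl.sub (locallyIntegrableOn_const_mul hv lam)
  have hV := continuousOn_primitive_Ioi hf zero_lt_one
  set V : ℝ → ℝ := fun x => ∫ t in (1 : ℝ)..x, (g t - lam * v t)
  set H : ℝ → ℝ := fun x => (V x - c) / (x ^ 3 + x ^ 2)
  have hH : ContinuousOn H (Ioi 0) := (hV.sub continuousOn_const).div (by fun_prop)
    fun x hx => by have := mem_Ioi.1 hx; positivity
  have hcont : ∀ {f f' : ℝ → ℝ}, (∀ x, 0 < x → HasDerivAt f (f' x) x) → ContinuousOn f (Ioi 0) :=
    fun hf x hx => (hf x hx).continuousAt.continuousWithinAt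
  set Z₂ : ℝ → ℝ := fun x => ∫ t in (1 : ℝ)..x, H t
  have hZ₂ : ∀ x, 0 < x → HasDerivAt Z₂ (H x) x := fun x hx =>
    hasDerivAt_primitive_Ioi hH zero_lt_one hx
  set Z₁ : ℝ → ℝ := fun x => ∫ t in (1 : ℝ)..x, Z₂ t
  have hZ₁ : ∀ x, 0 < x → HasDerivAt Z₁ (Z₂ x) x := fun x hx =>
    hasDerivAt_primitive_Ioi (hcont hZ₂) zero_lt_one hx
  set Z : ℝ → ℝ := fun x => ∫ t in (1 : ℝ)..x, Z₁ t
  have hZ : ∀ x, 0 < x → HasDerivAt Z (Z₁ x) x := fun x hx =>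
    hasDerivAt_primitive_Ioi (hcont hZ₁) zero_lt_one hx
  have hZl := locallyIntegrableOn_of_continuousOn (hcont hZ)
  -- Z is a classical triple primitive of the third derivative of v, so v - Z is a polynomial of
  -- degree below 3.
  obtain ⟨P, hP, hae⟩ := exists_polynomial_ae_eq 3 (hv.sub hZl) fun χ hχ => by
    have h1 : pair Z (deriv^[3] χ) = - pair H χ := by
      change pair Z (deriv (deriv (deriv χ))) = _
      rw [pair_deriv hZ (hcont hZ₁) hχ.deriv.deriv, pair_deriv hZ₁ (hcont hZ₂) hχ.deriv,
        pair_deriv hZ₂ hH hχ, neg_neg]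
    exact (pair_sub_left hv hZl (hχ.iterate_deriv 3)).trans (by rw [hc χ hχ, h1, sub_self])
  set u : ℝ → ℝ := fun x => P.eval x + Z x
  have hvu : v =ᵐ[volume.restrict (Ioi 0)] u := by
    filter_upwards [hae] with x hx
    rw [Pi.sub_apply] at hx
    simp only [u]; linarith
  have hu : ∀ x, 0 < x → HasDerivAt u (P.derivative.eval x + Z₁ x) x := fun x hx =>
    (P.hasDerivAt x).add (hZ x hx)
  -- Replacing v by its representative u inside the primitive makes the integrand continuous, so the
  -- flux becomes classically differentiable.
  have hVu : ∀ x, 0 < x → V x = ∫ t in (1 : ℝ)..x, (g t - lam * u t) := fun x hx => by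
    refine intervalIntegral.integral_congr_ae_restrict ?_
    have hsub : uIoc 1 x ⊆ Ioi 0 := fun y hy => (lt_min zero_lt_one hx).trans hy.1
    filter_upwards [ae_restrict_of_ae_restrict_of_subset hsub hvu] with t ht
    rw [ht]
  have hP3 : P.derivative.derivative.derivative = 0 := by
    by_contra hne
    have hP0 : ∀ Q : Polynomial ℝ, Q.derivative ≠ 0 → Q.derivative.natDegree < Q.natDegree :=
      fun Q hQ => Polynomial.natDegree_derivative_lt fun h0 => hQ
        (by rw [Polynomial.eq_C_of_natDegree_eq_zero h0, Polynomial.derivative_C])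
    have h2 : P.derivative.derivative ≠ 0 := fun h => hne (by rw [h, Polynomial.derivative_zero])
    have h1 : P.derivative ≠ 0 := fun h => h2 (by rw [h, Polynomial.derivative_zero])
    have h0 : P ≠ 0 := fun h => h1 (by rw [h, Polynomial.derivative_zero])
    have := hP0 _ h1
    have := hP0 _ h2
    have := hP0 _ hne
    have := (Polynomial.natDegree_lt_iff_degree_lt h0).2 hP
    omega
  refine ⟨u, fun x => P.derivative.eval x + Z₁ x, fun x => P.derivative.derivative.eval x + Z₂ x,
    fun x => (∫ t in (1 : ℝ)..x, (g t - lam * u t)) - c, ⟨hu, fun x hx =>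
      (P.derivative.hasDerivAt x).add (hZ₁ x hx), fun x hx => ?_, fun x hx => ?_⟩, hvu⟩
  · have := (P.derivative.derivative.hasDerivAt x).add (hZ₂ x hx)
    rw [hP3, Polynomial.eval_zero, zero_add] at this
    rw [← hVu x hx]; exact this
  · exact (hasDerivAt_primitive_Ioi (hg.sub ((hcont hu).const_mul lam)) zero_lt_one hx).sub_const c

/-! ### Uniqueness: boundary behaviour and the energy identity. -/

theorem IsWeakEuler.ae_eq {γ : ℝ} {v v' w w' : ℝ → ℝ} (h : IsWeakEuler γ v w)
    (h' : IsWeakEuler γ v' w') (hv : v =ᵐ[volume.restrict (Ioi 0)] v') :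
    w =ᵐ[volume.restrict (Ioi 0)] w' := by
  refine ae_eq_of_pair_eq h.1 h'.1 fun φ hφ => ?_
  obtain ⟨φ, rfl⟩ := hφ.exists_testFunction
  refine (h.2 φ).trans (Eq.trans ?_ (h'.2 φ).symm)
  congr 1
  exact pair_congr_ae (φ := fun x => deriv (fun y => y * φ y) x + γ * φ x) hv

theorem wNormSq_congr_ae {α : ℝ} {f f' : ℝ → ℝ} (h : f =ᵐ[volume.restrict (Ioi 0)] f') :
    wNormSq α f = wNormSq α f' := by
  refine lintegral_congr_ae ?_
  filter_upwards [h] with x hx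
  rw [hx]

theorem wNormSq_lt_top_of_wNorm {α : ℝ} {f : ℝ → ℝ} (h : wNorm α f < ⊤) : wNormSq α f < ⊤ :=
  (ENNReal.rpow_lt_top_iff_of_pos (by norm_num)).1 h

theorem integrableOn_of_wNormSq_one_lt_top {f : ℝ → ℝ} (hf : ContinuousOn f (Ioi 0))
    (h : wNormSq 1 f < ⊤) : IntegrableOn (fun x => f x ^ 2 / x ^ 3) (Ioi 0) := by
  have hc : ContinuousOn (fun x => f x ^ 2 / x ^ 3) (Ioi 0) := (hf.pow 2).div (by fun_prop)
    fun x hx => by have := mem_Ioi.1 hx; positivity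
  refine ⟨hc.aestronglyMeasurable measurableSet_Ioi, ?_⟩
  rw [hasFiniteIntegral_iff_ofReal]
  · refine lt_of_eq_of_lt (setLIntegral_congr_fun measurableSet_Ioi fun x hx => ?_) h
    have hx0 : 0 < x := hx
    rw [show (-2 * 1 : ℝ) = -(2 : ℕ) by norm_num, Real.rpow_neg hx0.le, Real.rpow_natCast]
    congr 1
    field_simp
  · filter_upwards [ae_restrict_mem measurableSet_Ioi] with x hx
    have hx0 : 0 < x := hx
    positivity

/-- The set of points near 0 where |u| exceeds ε/2 is open and null, hence empty; so the essential
limit is a genuine one for a continuous representative. -/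
theorem tendsto_of_hasZeroTrace {v u : ℝ → ℝ} (h : HasZeroTrace v)
    (hvu : v =ᵐ[volume.restrict (Ioi 0)] u) (hu : ContinuousOn u (Ioi 0)) :
    Tendsto u (𝓝[>] 0) (𝓝 0) := by
  rw [Metric.tendsto_nhds]
  intro ε hε
  obtain ⟨s, hs, t, ht, hst⟩ := mem_inf_iff_superset.1 (Metric.tendsto_nhds.1 h (ε / 2) (half_pos hε))
  obtain ⟨δ, hδ, hδs⟩ := mem_nhdsGT_iff_exists_Ioo_subset.1 hs
  have hδ0 : 0 < δ := hδ
  have hO : IsOpen (Ioo 0 δ ∩ (fun x => |u x|) ⁻¹' Ioi (ε / 2)) :=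
    (hu.mono Ioo_subset_Ioi_self).abs.isOpen_inter_preimage isOpen_Ioo isOpen_Ioi
  have hnull : volume (Ioo 0 δ ∩ (fun x => |u x|) ⁻¹' Ioi (ε / 2)) = 0 := by
    rw [← compl_mem_ae_iff]
    filter_upwards [ht, (ae_restrict_iff' measurableSet_Ioi).1 hvu] with x hxt hx hxu
    have h1 := hst ⟨hδs hxu.1, hxt⟩
    rw [mem_ofPred_eq, Real.dist_eq, sub_zero, hx hxu.1.1] at h1
    exact h1.not_gt hxu.2
  replace hnull := (hO.measure_eq_zero_iff volume).1 hnull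
  filter_upwards [Ioo_mem_nhdsGT hδ0] with x hx
  rw [Real.dist_eq, sub_zero]
  by_contra! h2
  have h3 : x ∈ Ioo 0 δ ∩ (fun x => |u x|) ⁻¹' Ioi (ε / 2) :=
    ⟨hx, (by linarith : ε / 2 < |u x|)⟩
  rw [hnull] at h3
  exact h3

namespace ResolventSystem

variable {lam : ℝ} {g v u u₁ u₂ q : ℝ → ℝ}

theorem continuousOn (h : ResolventSystem lam g u u₁ u₂ q) : ContinuousOn u (Ioi 0) :=
  fun x hx => (h.hasDerivAt x hx).continuousAt.continuousWithinAt

theorem continuousOn₁ (h : ResolventSystem lam g u u₁ u₂ q) : ContinuousOn u₁ (Ioi 0) :=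
  fun x hx => (h.hasDerivAt₁ x hx).continuousAt.continuousWithinAt

theorem continuousOn₂ (h : ResolventSystem lam g u u₁ u₂ q) : ContinuousOn u₂ (Ioi 0) :=
  fun x hx => (h.hasDerivAt₂ x hx).continuousAt.continuousWithinAt

theorem sub {v₁ v₂ r : ℝ → ℝ} {g' : ℝ → ℝ} (h : ResolventSystem lam g u u₁ u₂ q)
    (h' : ResolventSystem lam g' v v₁ v₂ r) :
    ResolventSystem lam (fun x => g x - g' x) (fun x => u x - v x) (fun x => u₁ x - v₁ x)
      (fun x => u₂ x - v₂ x) (fun x => q x - r x) where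
  hasDerivAt x hx := (h.hasDerivAt x hx).sub (h'.hasDerivAt x hx)
  hasDerivAt₁ x hx := (h.hasDerivAt₁ x hx).sub (h'.hasDerivAt₁ x hx)
  hasDerivAt₂ x hx := by
    rw [sub_div]; exact (h.hasDerivAt₂ x hx).sub (h'.hasDerivAt₂ x hx)
  hasDerivAt_flux x hx := by
    convert! (h.hasDerivAt_flux x hx).sub (h'.hasDerivAt_flux x hx) using 1
    ring

/-- Algebra of the Euler operator: (D-1)u + (D-1)²u = D(D-1)u = x² u'', so x (u'')² is the square of
this sum over x³, the integrand of |·|₁². -/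
theorem integrableOn_mul_sq (h : ResolventSystem lam g u u₁ u₂ q)
    (hv : IsResolventSolution lam g v) (hvu : v =ᵐ[volume.restrict (Ioi 0)] u) :
    IntegrableOn (fun x => x * u₂ x ^ 2) (Ioi 0) := by
  obtain ⟨w₁, w₂, e₁, e₂, n₁, n₂⟩ := hv.euler_lt_top
  set k₁ : ℝ → ℝ := fun x => x * u₁ x - 1 * u x
  have hk₁ : ∀ x, 0 < x → HasDerivAt k₁ (x * u₂ x) x := fun x hx => by
    convert! ((hasDerivAt_id x).mul (h.hasDerivAt₁ x hx)).sub ((h.hasDerivAt x hx).const_mul 1)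
      using 1
    simp
  have hk₁c : ContinuousOn k₁ (Ioi 0) :=
    fun x hx => (hk₁ x hx).continuousAt.continuousWithinAt
  have hxc : ContinuousOn (fun x => x * u₂ x) (Ioi 0) := continuousOn_id.mul h.continuousOn₂
  set k₂ : ℝ → ℝ := fun x => x * (x * u₂ x) - 1 * k₁ x
  have hk₂c : ContinuousOn k₂ (Ioi 0) := (continuousOn_id.mul hxc).sub (hk₁c.const_mul 1)
  have a₁ : w₁ =ᵐ[volume.restrict (Ioi 0)] k₁ :=
    e₁.ae_eq (isWeakEuler_of_hasDerivAt 1 h.hasDerivAt h.continuousOn₁) hvu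
  have a₂ : w₂ =ᵐ[volume.restrict (Ioi 0)] k₂ :=
    e₂.ae_eq (isWeakEuler_of_hasDerivAt 1 hk₁ hxc) a₁
  have i₁ := integrableOn_of_wNormSq_one_lt_top hk₁c
    (by rw [← wNormSq_congr_ae a₁]; exact wNormSq_lt_top_of_wNorm n₁)
  have i₂ := integrableOn_of_wNormSq_one_lt_top hk₂c
    (by rw [← wNormSq_congr_ae a₂]; exact wNormSq_lt_top_of_wNorm n₂)
  refine Integrable.mono' ((i₁.add i₂).const_mul 2)
    ((continuousOn_id.mul (h.continuousOn₂.pow 2)).aestronglyMeasurable measurableSet_Ioi) ?_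
  filter_upwards [ae_restrict_mem measurableSet_Ioi] with x hx
  have hx0 : 0 < x := hx
  rw [Real.norm_eq_abs, abs_of_nonneg (by positivity)]
  have e : x * u₂ x ^ 2 = (k₁ x + k₂ x) ^ 2 / x ^ 3 := by
    simp only [k₂]; field_simp; ring
  rw [e, Pi.add_apply, ← add_div, mul_div_assoc']
  gcongr
  linarith [sq_nonneg (k₁ x - k₂ x)]

end ResolventSystem

/-- A flux bounded below by ε > 0 near 0 forces u''' ≥ ε/(2y²), hence u'' ≤ -ε/(4y) for small y, and
then y (u'')² is not integrable at 0. -/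
theorem nonpos_of_integrableOn_of_flux_ge {u₂ q : ℝ → ℝ} {ε x : ℝ} (hx : 0 < x) (hx1 : x ≤ 1)
    (h : ∀ y, 0 < y → HasDerivAt u₂ (q y / (y ^ 3 + y ^ 2)) y)
    (hi : IntegrableOn (fun x => x * u₂ x ^ 2) (Ioi 0))
    (hq : ∀ y, 0 < y → y ≤ x → ε ≤ q y) : ε ≤ 0 := by
  by_contra! hε
  -- The halved constant reflects y³ + y² ≤ 2y² for y ≤ 1.
  have hd : ∀ y, 0 < y → HasDerivAt (fun y => u₂ y + ε / 2 * y⁻¹)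
      (q y / (y ^ 3 + y ^ 2) - ε / 2 / y ^ 2) y := fun y hy => by
    convert! (h y hy).add ((hasDerivAt_inv hy.ne').const_mul (ε / 2)) using 1
    ring
  have hmono : MonotoneOn (fun y => u₂ y + ε / 2 * y⁻¹) (Ioc 0 x) := by
    refine monotoneOn_of_deriv_nonneg (convex_Ioc 0 x)
      (fun y hy => (hd y hy.1).continuousAt.continuousWithinAt)
      (fun y hy => (hd y (interior_subset hy).1).differentiableAt.differentiableWithinAt)
      fun y hy => ?_
    have hy' := interior_subset hy
    have hy0 := hy'.1
    rw [(hd y hy0).deriv, sub_nonneg, div_div]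
    have h1 : y ^ 3 ≤ y ^ 2 := by nlinarith [sq_nonneg y, hy'.2]
    refine div_le_div₀ (hε.le.trans (hq y hy0 hy'.2)) (hq y hy0 hy'.2) (by positivity) (by linarith)
  set K : ℝ := |u₂ x + ε / 2 * x⁻¹| + 1
  have hK : 0 < K := by positivity
  set δ : ℝ := min x (ε / (4 * K))
  have hδ : 0 < δ := lt_min hx (by positivity)
  have hlow : ∀ y, 0 < y → y ≤ δ → (ε / 4) ^ 2 * y⁻¹ ≤ y * u₂ y ^ 2 := fun y hy hyδ => by
    have h1 : u₂ y + ε / 2 * y⁻¹ ≤ K :=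
      (hmono ⟨hy, hyδ.trans (min_le_left _ _)⟩ (right_mem_Ioc.2 hx)
        (hyδ.trans (min_le_left _ _))).trans ((le_abs_self _).trans (by simp [K]))
    have h2 : y ≤ ε / (4 * K) := hyδ.trans (min_le_right _ _)
    have h3 : K ≤ ε / 4 * y⁻¹ := by
      rw [le_div_iff₀ (by positivity)] at h2
      rw [← div_eq_mul_inv, le_div_iff₀ hy]; linarith
    have h4 : ε / 4 * y⁻¹ ≤ - u₂ y := by linarith
    calc (ε / 4) ^ 2 * y⁻¹ = y * (ε / 4 * y⁻¹) ^ 2 := by field_simp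
      _ ≤ y * (- u₂ y) ^ 2 := by gcongr
      _ = _ := by rw [neg_sq]
  have hint : IntervalIntegrable (fun y : ℝ => y⁻¹) volume 0 δ := by
    rw [intervalIntegrable_iff_integrableOn_Ioc_of_le hδ.le]
    have hi' : IntegrableOn (fun x => x * u₂ x ^ 2) (Ioc 0 δ) := hi.mono_set fun y hy => hy.1
    refine Integrable.mono' (hi'.const_mul (((ε / 4) ^ 2)⁻¹))
      measurable_inv.aestronglyMeasurable ?_
    filter_upwards [ae_restrict_mem measurableSet_Ioc] with y hy
    rw [Real.norm_eq_abs, abs_of_pos (inv_pos.2 hy.1), le_inv_mul_iff₀ (by positivity)]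
    exact hlow y hy.1 hy.2
  -- The lower bound has made 1/y integrable on (0, δ], which is false.
  rw [intervalIntegrable_inv_iff] at hint
  rcases hint with h0 | h0
  · exact hδ.ne h0
  · exact h0 left_mem_uIcc

theorem abs_sub_le_of_abs_deriv_le {f f' b b' : ℝ → ℝ} {x y : ℝ} (hxy : x ≤ y)
    (hf : ∀ t ∈ Icc x y, HasDerivAt f (f' t) t) (hb : ∀ t ∈ Icc x y, HasDerivAt b (b' t) t)
    (h : ∀ t ∈ Icc x y, |f' t| ≤ b' t) : |f y - f x| ≤ b y - b x := by
  have key : ∀ s : ℝ, |s| = 1 → s * (f y - f x) ≤ b y - b x := fun s hs => by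
    have hm : MonotoneOn (fun t => b t - s * f t) (Icc x y) := by
      have hd : ∀ t ∈ Icc x y, HasDerivAt (fun t => b t - s * f t) (b' t - s * f' t) t :=
        fun t ht => (hb t ht).sub ((hf t ht).const_mul s)
      refine monotoneOn_of_deriv_nonneg (convex_Icc x y)
        (fun t ht => (hd t ht).continuousAt.continuousWithinAt)
        (fun t ht => (hd t (interior_subset ht)).differentiableAt.differentiableWithinAt)
        fun t ht => ?_
      rw [(hd t (interior_subset ht)).deriv, sub_nonneg]
      refine (le_abs_self _).trans ?_
      rw [abs_mul, hs, one_mul]; exact h t (interior_subset ht)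
    have := hm (left_mem_Icc.2 hxy) (right_mem_Icc.2 hxy) hxy
    simp only at this
    linarith
  refine abs_le'.2 ⟨by simpa using key 1 (by simp), by simpa using key (-1) (by simp)⟩

namespace ResolventSystem

variable {lam : ℝ} {u u₁ u₂ q : ℝ → ℝ}

/-- From |u''| ≤ 1 + t (u'')² for t ≥ 1 the derivative u' grows at most linearly, and u at most
quadratically. -/
theorem exists_le_mul_sq_of_integrableOn {g : ℝ → ℝ} (h : ResolventSystem lam g u u₁ u₂ q)
    (hi : IntegrableOn (fun x => x * u₂ x ^ 2) (Ioi 0)) :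
    ∃ C, ∀ x, 1 ≤ x → |u x| ≤ C * x ^ 2 := by
  refine isBigO_pow_succ_of_deriv h.hasDerivAt ⟨|u₁ 1| + (1 + ∫ x in Ioi 0, x * u₂ x ^ 2),
    fun x hx => ?_⟩
  have hx0 : 0 < x := by linarith
  have hsub : uIcc 1 x ⊆ Ioi 0 := fun y hy => (lt_min zero_lt_one hx0).trans_le hy.1
  have hii : IntervalIntegrable (fun x => x * u₂ x ^ 2) volume 1 x :=
    (intervalIntegrable_iff_integrableOn_Ioc_of_le hx).2
      (hi.mono_set fun y hy => zero_lt_one.trans hy.1)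
  have h1 : u₁ x - u₁ 1 = ∫ t in (1 : ℝ)..x, u₂ t :=
    (intervalIntegral.integral_eq_sub_of_hasDerivAt (fun t ht => h.hasDerivAt₁ t (hsub ht))
      (h.continuousOn₂.mono hsub).intervalIntegrable).symm
  have h2 : |∫ t in (1 : ℝ)..x, u₂ t| ≤ ∫ t in (1 : ℝ)..x, (1 + t * u₂ t ^ 2) := by
    refine intervalIntegral.norm_integral_le_of_norm_le (f := u₂)
      (g := fun t => 1 + t * u₂ t ^ 2) hx (.of_forall fun t ht => ?_)
      (intervalIntegrable_const.add hii)
    have ht1 := ht.1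
    rw [Real.norm_eq_abs, ← sq_abs]
    nlinarith [sq_nonneg (|u₂ t| - 1), sq_nonneg |u₂ t|]
  have h3 : ∫ t in (1 : ℝ)..x, t * u₂ t ^ 2 ≤ ∫ x in Ioi 0, x * u₂ x ^ 2 := by
    rw [intervalIntegral.integral_of_le hx]
    refine setIntegral_mono_set hi ?_ (Eventually.of_forall fun y hy => zero_lt_one.trans hy.1)
    filter_upwards [ae_restrict_mem measurableSet_Ioi] with y hy
    have hy0 : 0 < y := hy
    exact (by positivity : 0 ≤ y * u₂ y ^ 2)
  rw [intervalIntegral.integral_add intervalIntegrable_const hii, intervalIntegral.integral_const,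
    smul_eq_mul, mul_one, ← h1] at h2
  have h4 : 0 ≤ ∫ x in Ioi 0, x * u₂ x ^ 2 := setIntegral_nonneg measurableSet_Ioi fun y hy => by
    have hy0 : 0 < y := hy
    positivity
  have h5 := abs_add_le (u₁ 1) (u₁ x - u₁ 1)
  rw [add_sub_cancel] at h5
  rw [pow_one]
  nlinarith [abs_nonneg (u₁ 1)]

/-- While |u| ≤ 1 the flux is Lipschitz with constant lam. If |q(x)| exceeded lam x, then q would
keep its sign and stay away from 0 down to the boundary, contradicting integrability of x (u'')². -/
theorem abs_flux_le_of_homogeneous (hlam : 0 < lam) {δ : ℝ}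
    (h : ResolventSystem lam (fun _ => 0) u u₁ u₂ q)
    (hi : IntegrableOn (fun x => x * u₂ x ^ 2) (Ioi 0)) (hδ1 : δ ≤ 1)
    (hu : ∀ x, 0 < x → x ≤ δ → |u x| ≤ 1) {x : ℝ} (hx : 0 < x) (hxδ : x ≤ δ) :
    |q x| ≤ lam * x := by
  have hlip : ∀ y, 0 < y → y ≤ x → |q x - q y| ≤ lam * x := fun y hy hyx => by
    refine (abs_sub_le_of_abs_deriv_le (b := fun t => lam * t) (b' := fun _ => lam) hyx
      (fun t ht => h.hasDerivAt_flux t (hy.trans_le ht.1))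
      (fun t _ => by simpa using (hasDerivAt_id t).const_mul lam) fun t ht => ?_).trans ?_
    · rw [zero_sub, abs_neg, abs_mul, abs_of_pos hlam]
      exact mul_le_of_le_one_right hlam.le (hu t (hy.trans_le ht.1) (ht.2.trans hxδ))
    · have := mul_pos hlam hy
      linarith
  refine abs_le'.2 ⟨?_, ?_⟩
  · have := nonpos_of_integrableOn_of_flux_ge (u₂ := u₂) (q := q) (ε := q x - lam * x) hx
      (hxδ.trans hδ1) h.hasDerivAt₂ hi fun y hy hyx => by
        have := (abs_le.1 (hlip y hy hyx)).2; linarith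
    linarith
  · have := nonpos_of_integrableOn_of_flux_ge (u₂ := fun y => - u₂ y) (q := fun y => - q y)
      (ε := - q x - lam * x) hx (hxδ.trans hδ1)
      (fun y hy => by rw [neg_div]; exact (h.hasDerivAt₂ y hy).neg)
      (by simpa using hi) fun y hy hyx => by
        have := (abs_le.1 (hlip y hy hyx)).1; linarith
    linarith

/-- From |q| ≤ lam x follow |u'''| ≤ lam/x, a logarithmic bound for u'' and a bound for u'. So q u''
is O(x |log x|), and u u' tends to 0 because u does. -/
theorem tendsto_energy_zero (hlam : 0 < lam) (h : ResolventSystem lam (fun _ => 0) u u₁ u₂ q)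
    (h0 : Tendsto u (𝓝[>] 0) (𝓝 0)) (hi : IntegrableOn (fun x => x * u₂ x ^ 2) (Ioi 0)) :
    Tendsto (fun x => - lam * u x * u₁ x - q x * u₂ x) (𝓝[>] 0) (𝓝 0) := by
  obtain ⟨δ, hδ, hδu⟩ := mem_nhdsGT_iff_exists_Ioc_subset.1
    (Metric.tendsto_nhds.1 h0 1 zero_lt_one)
  set d : ℝ := min δ 1
  have hd : 0 < d := lt_min hδ zero_lt_one
  have hu : ∀ x, 0 < x → x ≤ d → |u x| ≤ 1 := fun x hx hxd => by
    have := hδu ⟨hx, hxd.trans (min_le_left _ _)⟩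
    rw [mem_ofPred_eq, Real.dist_eq, sub_zero] at this
    exact this.le
  have hq : ∀ x, 0 < x → x ≤ d → |q x| ≤ lam * x := fun x hx hxd =>
    h.abs_flux_le_of_homogeneous hlam hi (min_le_right _ _) hu hx hxd
  set K : ℝ := |u₂ d| + lam * Real.log d
  have hu₂ : ∀ x, 0 < x → x ≤ d → |u₂ x| ≤ K - lam * Real.log x := fun x hx hxd => by
    have h1 := abs_sub_le_of_abs_deriv_le (b := fun t => lam * Real.log t)
      (b' := fun t => lam * t⁻¹) hxd (fun t ht => h.hasDerivAt₂ t (hx.trans_le ht.1))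
      (fun t ht => (Real.hasDerivAt_log (hx.trans_le ht.1).ne').const_mul lam) fun t ht => by
        have ht0 := hx.trans_le ht.1
        rw [abs_div, abs_of_pos (by positivity : 0 < t ^ 3 + t ^ 2), div_le_iff₀ (by positivity)]
        refine (hq t ht0 ht.2).trans ?_
        have : lam * t⁻¹ * (t ^ 3 + t ^ 2) = lam * t + lam * t ^ 2 := by field_simp; ring
        rw [this]
        have := mul_pos hlam (sq_pos_of_pos ht0)
        linarith
    have h2 := abs_sub (u₂ d) (u₂ d - u₂ x)
    rw [sub_sub_cancel] at h2
    simp only [K]; linarith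
  -- A primitive of the logarithmic majorant K - lam log t of u''; it is continuous at 0, which
  -- bounds u'.
  set b : ℝ → ℝ := fun t => (K + lam) * t - lam * (t * Real.log t)
  have hb : ∀ t, 0 < t → HasDerivAt b (K - lam * Real.log t) t := fun t ht => by
    convert! ((hasDerivAt_id t).const_mul (K + lam)).sub
      ((Real.hasDerivAt_mul_log ht.ne').const_mul lam) using 1
    ring
  have hbc : Continuous b := (continuous_const.mul continuous_id).sub
    (continuous_const.mul Real.continuous_mul_log)
  have hu₁ : ∀ x, 0 < x → x ≤ d → |u₁ x| ≤ |u₁ d| + (b d - b x) := fun x hx hxd => by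
    have h1 := abs_sub_le_of_abs_deriv_le hxd (fun t ht => h.hasDerivAt₁ t (hx.trans_le ht.1))
      (fun t ht => hb t (hx.trans_le ht.1)) fun t ht => hu₂ t (hx.trans_le ht.1) ht.2
    have h2 := abs_sub (u₁ d) (u₁ d - u₁ x)
    rw [sub_sub_cancel] at h2
    linarith
  have hlim : Tendsto (fun x => lam * |u x| * (|u₁ d| + (b d - b x)) +
      lam * (K * x - lam * (x * Real.log x))) (𝓝[>] 0) (𝓝 0) := by
    have t1 : Tendsto (fun x => |u₁ d| + (b d - b x)) (𝓝[>] 0) (𝓝 (|u₁ d| + (b d - b 0))) :=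
      ((by fun_prop : Continuous fun x => |u₁ d| + (b d - b x)).tendsto 0).mono_left
        nhdsWithin_le_nhds
    have t2 : Tendsto (fun x => lam * (K * x - lam * (x * Real.log x))) (𝓝[>] 0)
        (𝓝 (lam * (K * 0 - lam * (0 * Real.log 0)))) :=
      ((continuous_const.mul ((continuous_const.mul continuous_id).sub
        (continuous_const.mul Real.continuous_mul_log))).tendsto (0 : ℝ)).mono_left
        nhdsWithin_le_nhds
    simpa using ((h0.abs.const_mul lam).mul t1).add t2
  refine squeeze_zero_norm' ?_ hlim
  filter_upwards [Ioc_mem_nhdsGT hd] with x hx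
  rw [Real.norm_eq_abs]
  refine (abs_sub _ _).trans (add_le_add ?_ ?_)
  · rw [abs_mul, abs_mul, abs_neg, abs_of_pos hlam]
    gcongr
    exact hu₁ x hx.1 hx.2
  · rw [abs_mul]
    calc |q x| * |u₂ x| ≤ lam * x * (K - lam * Real.log x) :=
          mul_le_mul (hq x hx.1 hx.2) (hu₂ x hx.1 hx.2) (abs_nonneg _)
            (mul_nonneg hlam.le hx.1.le)
      _ = _ := by ring

/-- The homogeneous problem has only the trivial solution. -/
theorem eq_zero_of_homogeneous (hlam : 0 < lam) (h : ResolventSystem lam (fun _ => 0) u u₁ u₂ q)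
    (h0 : Tendsto u (𝓝[>] 0) (𝓝 0)) (hi : IntegrableOn (fun x => x * u₂ x ^ 2) (Ioi 0))
    {x : ℝ} (hx : 0 < x) : u x = 0 := by
  have hz : HasSubcriticalDecay lam fun _ => 0 := fun ν _ => isBigO_zero _ _
  obtain ⟨d₀, d₁, d₂, d₃⟩ := h.hasSubcriticalDecay hlam hz ⟨0, by simp⟩
    (h.exists_le_mul_sq_of_integrableOn hi)
  have ht : ∀ {f : ℝ → ℝ}, HasSubcriticalDecay lam f → Tendsto f atTop (𝓝 0) := fun hf =>
    (hf.isBigO_inv_pow hlam 1).trans_tendsto (by simpa using tendsto_inv_atTop_zero)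
  -- In E' the terms lam u u'' from both products cancel, leaving minus a sum of squares.
  set E : ℝ → ℝ := fun x => - lam * u x * u₁ x - q x * u₂ x with hE
  have hEd : ∀ x, 0 < x →
      HasDerivAt E (-(lam * u₁ x ^ 2 + q x ^ 2 / (x ^ 3 + x ^ 2))) x := fun x hx => by
    convert! (((h.hasDerivAt x hx).const_mul (-lam)).mul (h.hasDerivAt₁ x hx)).sub
      ((h.hasDerivAt_flux x hx).mul (h.hasDerivAt₂ x hx)) using 1
    ring
  have hnn : ∀ x, 0 < x → 0 ≤ q x ^ 2 / (x ^ 3 + x ^ 2) := fun x hx => by positivity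
  have hanti : AntitoneOn E (Ioi 0) := by
    refine antitoneOn_of_deriv_nonpos (convex_Ioi 0)
      (fun x hx => (hEd x hx).continuousAt.continuousWithinAt)
      (fun x hx => (hEd x (interior_subset hx)).differentiableAt.differentiableWithinAt)
      fun x hx => ?_
    have hx0 : 0 < x := interior_subset hx
    rw [(hEd x hx0).deriv]
    have := hnn x hx0
    have : 0 ≤ lam * u₁ x ^ 2 := by positivity
    linarith
  have hE_top : Tendsto E atTop (𝓝 0) := by
    simpa [hE] using (((ht d₀).const_mul (-lam)).mul (ht d₁)).sub ((ht d₃).mul (ht d₂))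
  -- An antitone function with limit 0 at both ends vanishes identically.
  have hE0 : ∀ x, 0 < x → E x = 0 := fun x hx => le_antisymm
    (ge_of_tendsto (h.tendsto_energy_zero hlam h0 hi) (by
      filter_upwards [Ioc_mem_nhdsGT hx] with y hy using hanti hy.1 hx hy.2))
    (le_of_tendsto hE_top (by
      filter_upwards [eventually_ge_atTop x] with y hy using hanti hx (hx.trans_le hy) hy))
  have hq0 : ∀ x, 0 < x → q x = 0 := fun x hx => by
    have h1 : HasDerivAt E 0 x := (hasDerivAt_const x (0 : ℝ)).congr_of_eventuallyEq (by
      filter_upwards [Ioi_mem_nhds hx] with y hy using hE0 y hy)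
    have h2 := (hEd x hx).unique h1
    have h3 : 0 ≤ lam * u₁ x ^ 2 := by positivity
    have h4 : q x ^ 2 / (x ^ 3 + x ^ 2) = 0 := by linarith [hnn x hx]
    rcases div_eq_zero_iff.1 h4 with h5 | h5
    · simpa using h5
    · exact absurd h5 (by positivity)
  have h1 : HasDerivAt q 0 x := (hasDerivAt_const x (0 : ℝ)).congr_of_eventuallyEq (by
    filter_upwards [Ioi_mem_nhds hx] with y hy using hq0 y hy)
  have h2 := (h.hasDerivAt_flux x hx).unique h1
  simpa [hlam.ne'] using h2

end ResolventSystem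

/-- Both solutions are replaced by classical representatives; their difference solves the
homogeneous system and inherits the trace and the integrability of x (u'')². -/
theorem IsResolventSolution.ae_eq {lam : ℝ} (hlam : 0 < lam) {g u v : ℝ → ℝ}
    (hg : ContinuousOn g (Ioi 0)) (hu : IsResolventSolution lam g u)
    (hv : IsResolventSolution lam g v) : v =ᵐ[volume.restrict (Ioi 0)] u := by
  obtain ⟨y, y₁, y₂, r, hy, hvy⟩ := exists_resolventSystem hg hv.locallyIntegrable hv.solves
  obtain ⟨z, z₁, z₂, q, hz, huz⟩ := exists_resolventSystem hg hu.locallyIntegrable hu.solves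
  have hd := hy.sub hz
  simp only [sub_self] at hd
  have ht : Tendsto (fun x => y x - z x) (𝓝[>] 0) (𝓝 0) := by
    simpa using (tendsto_of_hasZeroTrace hv.zero_trace hvy hy.continuousOn).sub
      (tendsto_of_hasZeroTrace hu.zero_trace huz hz.continuousOn)
  have hi : IntegrableOn (fun x => x * (y₂ x - z₂ x) ^ 2) (Ioi 0) := by
    refine Integrable.mono' (((hy.integrableOn_mul_sq hv hvy).add
      (hz.integrableOn_mul_sq hu huz)).const_mul 2)
      ((continuousOn_id.mul (hd.continuousOn₂.pow 2)).aestronglyMeasurable measurableSet_Ioi) ?_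
    filter_upwards [ae_restrict_mem measurableSet_Ioi] with x hx
    have hx0 : 0 < x := hx
    rw [Real.norm_eq_abs, abs_of_nonneg (by positivity), Pi.add_apply]
    nlinarith [mul_nonneg hx0.le (sq_nonneg (y₂ x + z₂ x))]
  filter_upwards [hvy, huz, ae_restrict_mem measurableSet_Ioi] with x hx₁ hx₂ hx
  rw [hx₁, hx₂]
  exact sub_eq_zero.1 (hd.eq_zero_of_homogeneous hlam ht hi hx)

/-! ### Assembly of existence, uniqueness, smoothness and decay. -/

theorem mainTheorem9 (lam : ℝ) (hlam : 0 < lam) (g : ℝ → ℝ)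
    (hg : ContDiffOn ℝ ∞ g (Ici 0)) (hg0 : g 0 = 0) (hgdecay : HasStretchedExpDecay lam g) :
    ∃ u : ℝ → ℝ,
      IsResolventSolution lam g u ∧
      (∀ v : ℝ → ℝ, IsResolventSolution lam g v → v =ᵐ[volume.restrict (Ioi 0)] u) ∧
      ContDiffOn ℝ ∞ u (Ici 0) ∧ u 0 = 0 ∧
      (∀ x : ℝ, 0 < x → lam * u x + opA u x = g x) ∧
      HasStretchedExpDecay lam u := by
  have hgd := hasStretchedExpDecay_iff.1 hgdecay
  obtain ⟨u, u₁, u₂, q, h, hu, hu0, hu', hu₁', hu₂, d₀, d₁, d₂, d₃⟩ :=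
    exists_smooth_solution hlam hg hg0 hgd
  have hgi := hg.mono (Ioi_subset_Ici_self (a := (0 : ℝ)))
  have hsol := h.isResolventSolution hlam hgi.continuousOn hu0 hu' hu₁' hu₂ d₀ d₁ d₂
  refine ⟨u, hsol, fun v hv => hsol.ae_eq hlam hgi.continuousOn hv, hu, hu0, fun x hx => ?_,
    hasStretchedExpDecay_iff.2 fun j => h.hasSubcriticalDecay_iteratedDeriv hlam
      (hu.mono Ioi_subset_Ici_self) hgi hgd d₀ d₁ d₂ d₃ j⟩
  exact h.opA_eq hx
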